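/- **Hexagons.** A *rectilinear* hexagon is a (strictly) convex hexagon whose three long diagonals (joining opposite vertices) all have length $1$ and whose opposite edges are parallel. It is *semi-regular* with parameter $r$ if, in addition, four of its edges have equal length and the two remaining edges, which are opposite to each other, have length $r$ (so it is congruent to the hexagon with vertices $(0,\pm\frac12)$ and $(\pm x,\pm y)$, where $x^2+y^2=\frac14$ and $r=2y$). It is *regular* if all its edges and all its angles are equal. **Tilings.** Let $P_0,\dots,P_5$ be the vertices of such a hexagon $H$ in counterclockwise order, and put $e_1=P_0-P_4$, $e_2=P_1-P_5$ (the translations of $H$ across its consecutive edges $P_0P_1$ and $P_1P_2$; for a semi-regular hexagon $P_0P_1$ is an edge of the length $r$). The tile $(i,j)\in\mathbb Z^2$ is $H+ie_1+je_2$. The distance of two tiles is the infimum of the distances between a point of one and a point of the other. For $t_1=(i_1,j_1)$, $t_2=(i_2,j_2)$ in $\mathbb Z^2$ and $d\ge 0$, say that *$H$ realises $(k;t_1,t_2;d)$* if: $H$ has diameter $1$; the tiles $(i,j)$ tile the plane (they cover it, and distinct tiles have disjoint interiors); $k=i_1j_2-i_2j_1$; the tiles can be coloured with exactly $k$ colours,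 two tiles having the same colour if and only if their indices differ by an element of the sublattice $\mathbb Zt_1+\mathbb Zt_2$; any two distinct tiles of the same colour are at distance at least $d$; and the smallest of the three mutual distances of the tiles $(0,0)$, $t_1$, $t_2$ is exactly $d$. **Algebraic numbers.** For $k=n(n+1)$ with $2\le n\le 12$ put $p=n(n-1)=k+1-\sqrt{4k+1}$, and let $f(k)$ be the largest real root of $$4p(p^2+3p+1)x^3+(-3p^4-8p^3+2p^2+4p+1)x^2+2p^2(p^2-2p-1)x+p^4 .$$ Let $q_{11},q_{23},q_{45}$ be the smallest real roots of, respectively, $$25600x^4-1459616x^3+8840377x^2-18735876x+13623552,$$ $$97344x^4-14493200x^3+287680857x^2-2041299600x+4968218624,$$ $$548800x^4-70030800x^3+2721532527x^2-44612184348x+279110188800 .$$ (All these roots exist.) **Table.** The table below has one row for each $k$ with $3\le k\le 175$. A row lists: $k$; $t_1,t_2$; one or more *cells* (a class of hexagons — regular, semi-regular with its parameter $r$, or rectilinear — with a number $D$, the squared distance), ordered from the most to the least restricted class; a decimal number; and a star for some $k$. Let $d(k)=\sqrt D$ for the last cell of row $k$. **Claim.** For every $k$ with $3\le k\le 175$: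 1. for every cell of row $k$, with number $D$, there are a hexagon $H$ of the class of the cell (with the listed $r$ if semi-regular) and $t_1',t_2'\in\mathbb Z^2$ such that $H$ realises $(k;t_1',t_2';\sqrt D)$; 2. for the last cell of row $k$ there is such a hexagon that realises $(k;t_1,t_2;d(k))$ with the listed $t_1,t_2$; 3. the numbers $D$ of the cells of the row are strictly increasing; 4. the decimal number is $d(k)$ correctly rounded to the number of digits shown; 5. row $k$ has a star if and only if $d(k)>d(k')$ for all $k'$ with $3\le k'<k$. Moreover, for $6\le k\le 175$, $\max_{3\le m\le k}d(m)>\max_{3\le m\le k-3}d(m)$: with at most $k$ colours the table achieves strictly more than with at most $k-3$ colours. Finally $d(6)>0.991445$, and $d(8)=7/5>1.37542$ (the numbers on the right are the values reported previously). - $3$: $(2,-1),(1,1)$; reg $(1/2)^2$; $0.500000$ * - $4$: $(2,0),(0,2)$; reg $3/4$; $0.866025$ * - $5$: $(3,-1),(2,1)$; semi $(5/6)^2$ [$r=5/6$]; $0.833333$ - $6$: $(3,0),(0,2)$; semi $(17+\sqrt{33})/24$ [$r=(\sqrt{33}-3)/12$], rect $f(6)$; $0.992076$ * - $7$: $(3,-1),(1,2)$;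 reg $7/4$; $1.322876$ * - $8$: $(3,-2),(1,2)$; semi $(7/5)^2$ [$r=1/5$]; $1.400000$ * - $9$: $(3,0),(0,3)$; reg $3$; $1.732051$ * - $10$: $(4,-1),(2,2)$; semi $11/4$ [$r=3/4$]; $1.658312$ - $11$: $(3,-2),(1,3)$; semi $11/4$ [$r=3/4$], rect $q_{11}$; $1.674155$ - $12$: $(4,-2),(2,2)$; reg $2^2$; $2.000000$ * - $13$: $(4,-1),(1,3)$; reg $19/4$; $2.179449$ * - $14$: $(4,-2),(1,3)$; semi $19/4$ [$r=1/4$]; $2.179449$ - $15$: $(4,-3),(1,3)$; semi $153/32$ [$r=3/8$]; $2.186607$ * - $16$: $(4,0),(0,4)$; reg $27/4$; $2.598076$ * - $17$: $(5,-1),(2,3)$; semi $627/100$ [$r=7/10$], rect $709371/111724$; $2.519785$ - $18$: $(4,-3),(2,3)$; semi $6$ [$r=2/3$], rect $20-\sqrt{192}$; $2.478627$ - $19$: $(5,-2),(2,3)$; reg $31/4$; $2.783882$ * - $20$: $(5,0),(0,4)$; semi $(5931+405\sqrt{129})/1352$ [$r=(3\sqrt{129}-15)/52$], rect $f(20)$;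 $2.862821$ * - $21$: $(5,-1),(1,4)$; reg $37/4$; $3.041381$ * - $22$: $(5,-2),(1,4)$; semi $3^2$ [$r=1/3$], rect $193496/21275$; $3.015791$ - $23$: $(5,-3),(1,4)$; semi $103/12$ [$r=1/6$], rect $q_{23}$; $2.942985$ - $24$: $(6,-2),(3,3)$; semi $1216/121$ [$r=29/44$], rect $869/86$; $3.178781$ * - $25$: $(5,0),(0,5)$; reg $12$; $3.464102$ * - $26$: $(6,-1),(2,4)$; semi $203/18$ [$r=2/3$], rect $2150/187$; $3.390771$ - $27$: $(6,-3),(3,3)$; reg $(7/2)^2$; $3.500000$ * - $28$: $(6,-2),(2,4)$; reg $13$; $3.605551$ * - $29$: $(7,-2),(4,3)$; semi $44719/3844$ [$r=47/62$], rect $481078403/41028908$; $3.424230$ - $30$: $(6,0),(0,5)$; semi $(1072+128\sqrt{51})/147$ [$r=(2\sqrt{51}-6)/21$], rect $f(30)$; $3.762292$ * - $31$: $(6,-1),(1,5)$; reg $61/4$; $3.905125$ * - $32$: $(6,-1),(2,5)$; semi $59/4$ [$r=3/8$], rect $2307733/153928$; $3.871988$ - $33$: $(7,-3),(4,3)$;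 semi $(227/58)^2$ [$r=37/58$]; $3.913793$ * - $34$: $(7,-2),(3,4)$; semi $1921/121$ [$r=7/11$], rect $170126/10611$; $4.004121$ * - $35$: $(7,0),(1,5)$; semi $(17559+135\sqrt{12257})/2048$ [$r=(\sqrt{12257}-15)/128$]; $3.983917$ - $36$: $(6,0),(0,6)$; reg $75/4$; $4.330127$ * - $37$: $(7,-3),(3,4)$; reg $73/4$; $4.272002$ - $38$: $(6,-1),(2,6)$; semi $17$ [$r=3/5$], rect $343577/19520$; $4.195388$ - $39$: $(7,-2),(2,5)$; reg $79/4$; $4.444097$ * - $40$: $(7,-4),(3,4)$; semi $(137/31)^2$ [$r=11/31$]; $4.419355$ - $41$: $(7,-2),(3,5)$; semi $637/32$ [$r=3/8$], rect $19168435/946444$; $4.500346$ * - $42$: $(7,0),(0,6)$; semi $(84075+13125\sqrt{33})/7688$ [$r=(15\sqrt{33}-35)/124$], rect $f(42)$; $4.651075$ * - $43$: $(7,-1),(1,6)$; reg $91/4$; $4.769696$ * - $44$: $(7,-1),(2,6)$; semi $22$ [$r=2/5$], rect $4700717/209612$; $4.735589$ - $45$: $(7,-3),(1,6)$; semi $423/20$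 [$r=3/10$], rect $q_{45}$; $4.607942$ - $46$: $(8,-2),(3,5)$; semi $49051/2116$ [$r=57/92$], rect $73151/3116$; $4.845197$ * - $47$: $(7,-3),(4,5)$; semi $3224/147$ [$r=13/21$], rect $5560412771/243356228$; $4.780048$ - $48$: $(8,-4),(4,4)$; reg $5^2$; $5.000000$ * - $49$: $(7,0),(0,7)$; reg $27$; $5.196152$ * - $50$: $(8,-1),(2,6)$; semi $825/32$ [$r=5/8$], rect $2143125/81224$; $5.136669$ - $51$: $(7,-1),(2,7)$; semi $6016/243$ [$r=19/27$], rect $32914863743/1281311828$; $5.068374$ - $52$: $(8,-2),(2,6)$; reg $28$; $5.291503$ * - $53$: $(9,-2),(4,5)$; semi $358639/13924$ [$r=83/118$], rect $21713005483/826893628$; $5.124307$ - $54$: $(8,-2),(3,6)$; semi $335/12$ [$r=5/12$], rect $118349/4160$; $5.333787$ * - $55$: $(9,-1),(1,6)$; semi $(449/86)^2$ [$r=21/86$], rect $15510042323/562475260$; $5.251154$ - $56$: $(8,0),(0,7)$; semi $(277/51)^2$ [$r=31/51$], rect $f(56)$; $5.533452$ * - $57$: $(8,-1),(1,7)$; reg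 $127/4$; $5.634714$ * - $58$: $(8,-1),(2,7)$; semi $123/4$ [$r=5/12$], rect $7191956/229175$; $5.601959$ - $59$: $(8,-1),(3,7)$; semi $89/3$ [$r=1/3$], rect $742918955/24763644$; $5.477261$ - $60$: $(9,-2),(3,6)$; semi $118969/3721$ [$r=37/61$], rect $4775023/147232$; $5.694907$ * - $61$: $(9,-4),(4,5)$; reg $133/4$; $5.766281$ * - $62$: $(8,-2),(3,7)$; semi $49987/1600$ [$r=47/80$], rect $2563175/79001$; $5.696037$ - $63$: $(9,-3),(3,6)$; reg $139/4$; $5.894913$ * - $64$: $(8,0),(0,8)$; reg $147/4$; $6.062178$ * - $65$: $(9,-1),(2,7)$; semi $11431/324$ [$r=11/18$], rect $42769993/1184612$; $6.008714$ - $66$: $(9,-3),(4,6)$; semi $23987/675$ [$r=17/45$], rect $1193079661/33188989$; $5.995670$ - $67$: $(9,-2),(2,7)$; reg $151/4$; $6.144103$ * - $68$: $(10,-2),(4,6)$; semi $12649/361$ [$r=13/19$], rect $3193957/89125$; $5.986387$ - $69$: $(9,-2),(3,7)$; semi $262/7$ [$r=3/7$], rect $6272261/164372$; $6.177292$ * -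 $70$: $(10,-4),(5,5)$; semi $44339/1156$ [$r=81/136$], rect $414848/10783$; $6.202613$ * - $71$: $(10,-1),(1,7)$; semi $1035/28$ [$r=5/14$], rect $3274003629/86168876$; $6.164025$ - $72$: $(9,0),(0,8)$; semi $(177233+7203\sqrt{537})/8664$ [$r=(7\sqrt{537}-63)/228$], rect $f(72)$; $6.411744$ * - $73$: $(9,-1),(1,8)$; reg $(13/2)^2$; $6.500000$ * - $74$: $(9,-1),(2,8)$; semi $41$ [$r=3/7$], rect $9026779/215683$; $6.469317$ - $75$: $(10,-5),(5,5)$; reg $(13/2)^2$; $6.500000$ - $76$: $(10,-4),(4,6)$; reg $43$; $6.557439$ * - $77$: $(11,0),(2,7)$; semi $1215/32$ [$r=5/8$]; $6.161879$ - $78$: $(9,-2),(3,8)$; semi $21844/529$ [$r=53/92$], rect $4833828787/112826683$; $6.545453$ - $79$: $(10,-3),(3,7)$; reg $181/4$; $6.726812$ * - $80$: $(10,-4),(5,6)$; semi $(63261+972\sqrt{3770})/2738$ [$r=(\sqrt{3770}-12)/74$], rect $241351/5371$; $6.703428$ - $81$: $(9,0),(0,9)$; reg $48$; $6.928203$ *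 - $82$: $(10,-1),(2,8)$; semi $1157/25$ [$r=3/5$], rect $1184696/25029$; $6.879893$ - $83$: $(9,-1),(2,9)$; semi $957559/21316$ [$r=47/146$], rect $975386934409/20985431116$; $6.817569$ - $84$: $(10,-2),(2,8)$; reg $7^2$; $7.000000$ * - $85$: $(11,-5),(6,5)$; semi $(1097/158)^2$ [$r=93/158$]; $6.943038$ - $86$: $(10,-2),(3,8)$; semi $40953/841$ [$r=17/29$], rect $30121/610$; $7.026997$ * - $87$: $(9,-2),(3,9)$; semi $638611/13924$ [$r=79/118$], rect $1080643/23188$; $6.826679$ - $88$: $(10,-2),(4,8)$; semi $191/4$ [$r=3/8$], rect $84065/1729$; $6.972847$ - $89$: $(11,-3),(4,7)$; semi $194709/3844$ [$r=109/186$], rect $511258004631/9991926364$; $7.153119$ * - $90$: $(10,0),(0,9)$; semi $(140352+30720\sqrt{19})/5329$ [$r=(12\sqrt{19}-20)/73$], rect $f(90)$; $7.287290$ * - $91$: $(10,-1),(1,9)$; reg $217/4$; $7.365460$ * - $92$: $(10,-1),(2,9)$; semi $211/4$ [$r=7/16$], rect $4639657267/86189275$; $7.336963$ - $93$: $(11,-4),(4,7)$;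 reg $217/4$; $7.365460$ - $94$: $(11,-2),(3,8)$; semi $(713/97)^2$ [$r=57/97$], rect $666148999/12139951$; $7.407595$ * - $95$: $(12,-5),(7,5)$; semi $(277/38)^2$ [$r=25/38$]; $7.289474$ - $96$: $(11,-6),(5,6)$; semi $(67/9)^2$ [$r=11/27$]; $7.444444$ * - $97$: $(11,-3),(3,8)$; reg $229/4$; $7.566373$ * - $98$: $(12,-1),(2,8)$; semi $115625/2178$ [$r=8/33$], rect $613512713/11338873$; $7.355748$ - $99$: $(11,0),(1,9)$; semi $(498775+1575\sqrt{91553})/16928$ [$r=(\sqrt{91553}-63)/368$]; $7.590561$ * - $100$: $(10,0),(0,10)$; reg $243/4$; $7.794229$ * - $101$: $(11,-1),(2,9)$; semi $28449/484$ [$r=13/22$], rect $12663270675/210818572$; $7.750300$ - $102$: $(12,-5),(6,6)$; semi $29651/500$ [$r=29/50$], rect $208565/3509$; $7.709550$ - $103$: $(11,-2),(2,9)$; reg $247/4$; $7.858117$ * - $104$: $(12,-4),(5,7)$; semi $176485/2916$ [$r=125/216$], rect $4142419871/67995631$; $7.805245$ - $105$: $(11,-2),(3,9)$; semi $1097/18$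 [$r=4/9$], rect $447216991/7200892$; $7.880722$ * - $106$: $(10,-2),(3,10)$; semi $(84/11)^2$ [$r=29/44$], rect $33151587/560347$; $7.691723$ - $107$: $(11,-5),(6,7)$; semi $2161/36$ [$r=7/18$], rect $12486512240719/202886322964$; $7.845022$ - $108$: $(12,-6),(6,6)$; reg $8^2$; $8.000000$ * - $109$: $(12,-5),(5,7)$; reg $259/4$; $8.046738$ * - $110$: $(11,0),(0,10)$; semi $(2184003+72171\sqrt{849})/66248$ [$r=(9\sqrt{849}-99)/364$], rect $f(110)$; $8.160909$ * - $111$: $(11,-1),(1,10)$; reg $271/4$; $8.231039$ * - $112$: $(11,-1),(2,10)$; reg $67$, rect $1034089141/15361771$; $8.204618$ - $113$: $(11,-1),(3,10)$; semi $451319/6962$ [$r=38/59$], rect $387649933983/5906484172$; $8.101312$ - $114$: $(12,-2),(3,9)$; semi $937099/13924$ [$r=137/236$], rect $283698767/4150532$; $8.267550$ * - $115$: $(13,-4),(6,7)$; semi $4244941/64516$ [$r=163/254$], rect $12272144911631/184524424676$; $8.155175$ - $116$: $(12,-4),(5,8)$; semi $8723/128$ [$r=13/32$], rect $2045764331/29695775$;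 $8.300045$ * - $117$: $(12,-3),(3,9)$; reg $283/4$; $8.411302$ * - $118$: $(11,-2),(4,10)$; semi $451319/6962$ [$r=38/59$], rect $22520512223/336563063$; $8.180049$ - $119$: $(13,-3),(5,8)$; semi $(1643/198)^2$ [$r=65/198$], rect $17514883072583/252372028148$; $8.330729$ - $120$: $(12,-3),(4,9)$; semi $(28677+3630\sqrt{58})/784$ [$r=(3\sqrt{58}-5)/28$], rect $102121645769/1420956281$; $8.477515$ * - $121$: $(11,0),(0,11)$; reg $75$; $8.660254$ * - $122$: $(12,-1),(2,10)$; semi $655/9$ [$r=7/12$], rect $10143575/136512$; $8.620056$ - $123$: $(11,-1),(2,11)$; semi $392863/5476$ [$r=79/222$], rect $129728247871/1768473940$; $8.564814$ - $124$: $(12,-2),(2,10)$; reg $76$; $8.717798$ * - $125$: $(13,-2),(4,9)$; semi $5551687/77284$ [$r=179/278$], rect $976273547119/13237256716$; $8.587896$ - $126$: $(12,-2),(3,10)$; semi $1499/20$ [$r=9/20$], rect $19145005/250792$; $8.737172$ * - $127$: $(13,-6),(6,7)$; reg $307/4$; $8.760708$ * - $128$: $(12,-4),(5,9)$; semi $369/5$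 [$r=2/5$], rect $795830295/10506727$; $8.703151$ - $129$: $(13,-5),(5,8)$; reg $313/4$; $8.845903$ * - $130$: $(13,0),(1,10)$; semi $(3182571+312741\sqrt{97})/84872$ [$r=(27\sqrt{97}-143)/412$], rect $(18088+16\sqrt{1192555})/469$; $8.707601$ - $131$: $(13,-1),(1,10)$; semi $3094091/40804$ [$r=81/202$], rect $192224305737/2452589252$; $8.853026$ * - $132$: $(12,0),(0,11)$; semi $(165700+10000\sqrt{258})/4107$ [$r=(5\sqrt{258}-30)/111$], rect $f(132)$; $9.033127$ * - $133$: $(12,-1),(1,11)$; reg $331/4$; $9.096703$ * - $134$: $(12,-1),(2,11)$; semi $323/4$ [$r=9/20$], rect $6558879037/79690552$; $9.072174$ - $135$: $(12,-1),(3,11)$; semi $787/10$ [$r=2/5$], rect $10272242758901/127501682004$; $8.975831$ - $136$: $(13,-2),(3,10)$; semi $181289/2209$ [$r=27/47$], rect $20689231/248261$; $9.128889$ * - $137$: $(13,-4),(5,9)$; semi $2598661/31684$ [$r=73/178$], rect $74222844365281/892932274564$; $9.117159$ - $138$: $(12,-2),(3,11)$; semi $27389/338$ [$r=19/52$], rect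 $1122833/13505$; $9.118225$ - $139$: $(13,-3),(3,10)$; reg $343/4$; $9.260130$ * - $140$: $(14,-6),(7,7)$; semi $134518/1587$ [$r=157/276$], rect $80581/949$; $9.214743$ - $141$: $(14,-3),(5,9)$; semi $929347/11236$ [$r=67/106$], rect $196014091823/2324718468$; $9.182448$ - $142$: $(13,-3),(4,10)$; semi $117688/1369$ [$r=21/37$], rect $15150070069/174437335$; $9.319392$ * - $143$: $(13,0),(1,11)$; semi $(399015+4455\sqrt{7553})/8978$ [$r=(5\sqrt{7553}-99)/536$]; $9.357805$ * - $144$: $(12,0),(0,12)$; reg $363/4$; $9.526279$ * - $145$: $(13,-1),(2,11)$; semi $59675/676$ [$r=15/26$], rect $3279780625/36423236$; $9.489277$ - $146$: $(14,-4),(5,9)$; semi $119853/1352$ [$r=59/104$], rect $16400637/183488$; $9.454238$ - $147$: $(13,-2),(2,11)$; reg $367/4$; $9.578622$ * - $148$: $(14,-6),(6,8)$; reg $91$; $9.539392$ - $149$: $(13,-2),(3,11)$; semi $995/11$ [$r=5/11$], rect $1164694451/12649484$; $9.595544$ * - $150$: $(13,-4),(5,10)$; semi $112529/1280$ [$r=103/160$],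 rect $286692851539/3160973281$; $9.523531$ - $151$: $(14,-5),(5,9)$; reg $373/4$; $9.656604$ * - $152$: $(14,-3),(4,10)$; semi $405821/4374$ [$r=46/81$], rect $7532633043/80257313$; $9.687932$ * - $153$: $(15,-6),(8,7)$; semi $1030243/11236$ [$r=199/318$], rect $894213901557691/9724451350300$; $9.589328$ - $154$: $(14,-6),(7,8)$; semi $771407/8192$ [$r=109/256$], rect $1311592/13897$; $9.714912$ * - $155$: $(14,-1),(1,11)$; semi $133856/1445$ [$r=53/85$], rect $15557710498703/164015315380$; $9.739365$ * - $156$: $(13,0),(0,12)$; reg $97$, rect $f(156)$; $9.904296$ * - $157$: $(13,-1),(1,12)$; reg $397/4$; $9.962429$ * - $158$: $(13,-1),(2,12)$; semi $97$ [$r=5/11$], rect $75425702171/763451750$; $9.939599$ - $159$: $(13,-1),(3,12)$; semi $12176361/128164$ [$r=223/358$], rect $184097879615/1897621332$; $9.849623$ - $160$: $(14,-2),(3,11)$; semi $677416/6889$ [$r=189/332$], rect $9726226252/97433683$; $9.991199$ * - $161$: $(15,-7),(8,7)$; semi $9284209/93636$ [$r=173/306$]; $9.957516$ - $162$: $(15,-6),(7,8)$;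 semi $301273/3025$ [$r=31/55$], rect $195650535281/1958502269$; $9.994901$ * - $163$: $(14,-3),(3,11)$; reg $409/4$; $10.11187$ * - $164$: $(14,-4),(6,10)$; semi $292/3$ [$r=5/12$], rect $267614/2691$; $9.972351$ - $165$: $(15,-5),(6,9)$; semi $2487641/24500$ [$r=197/350$], rect $33252082489597/325566557812$; $10.10624$ - $166$: $(14,-3),(4,11)$; semi $813/8$ [$r=11/24$], rect $544579139/5269928$; $10.16549$ * - $167$: $(15,-1),(2,11)$; semi $6025357/60516$ [$r=77/246$], rect $7169589821/70929460$; $10.05388$ - $168$: $(14,0),(1,12)$; semi $(662311+5070\sqrt{16226})/12482$ [$r=(\sqrt{16226}-30)/158$]; $10.23727$ * - $169$: $(13,0),(0,13)$; reg $108$; $10.39230$ * - $170$: $(14,-1),(2,12)$; semi $10317/98$ [$r=4/7$], rect $1618378002/15084233$; $10.35806$ - $171$: $(15,-6),(6,9)$; reg $427/4$; $10.33199$ - $172$: $(14,-2),(2,12)$; reg $109$; $10.44031$ * - $173$: $(15,-2),(4,11)$; semi $15153631/145924$ [$r=239/382$], rect $37802632989571/354544269100$; $10.32585$ - $174$: $(14,-2),(3,12)$;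 semi $2579/24$ [$r=11/24$], rect $1893749/17324$; $10.45531$ * - $175$: $(15,-5),(5,10)$; reg $439/4$; $10.47616$ * -/

import Mathlib

noncomputable section

namespace HexTiling

/-- The Euclidean plane. -/
abbrev Plane := EuclideanSpace ℝ (Fin 2)

/-- The planar cross product. -/
def cross (u v : Plane) : ℝ := u 0 * v 1 - u 1 * v 0

/-- `P 0, …, P 5` are, in counterclockwise order, the vertices of a (strictly) convex hexagon:
every other vertex lies strictly to the left of each directed edge. Indices are modulo `6`. -/
def IsConvexHexagon (P : Fin 6 → Plane) : Prop :=
  ∀ i j, j ≠ i → j ≠ i + 1 → 0 < cross (P (i + 1) - P i) (P j - P i)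

/-- Rectilinear hexagon: the three long diagonals have unit length and opposite edges are
parallel. -/
structure IsRectilinear (P : Fin 6 → Plane) : Prop where
  convex : IsConvexHexagon P
  diagonal : ∀ i, dist (P i) (P (i + 3)) = 1
  parallel : ∀ i, cross (P (i + 1) - P i) (P (i + 4) - P (i + 3)) = 0

/-- Semi-regular hexagon with parameter `r`: a rectilinear hexagon with four edges of equal length,
namely all the edges except the opposite ones `P 0 P 1` and `P 3 P 4`; the latter have
length `r` (they are the vertical ones when the hexagon is placed with two vertices at
`(0, ±1/2)`). -/
structure IsSemiRegular (r : ℝ) (P : Fin 6 → Plane) : Prop where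
  rectilinear : IsRectilinear P
  edge_two : dist (P 2) (P 3) = dist (P 1) (P 2)
  edge_four : dist (P 4) (P 5) = dist (P 1) (P 2)
  edge_five : dist (P 5) (P 0) = dist (P 1) (P 2)
  vertical : dist (P 0) (P 1) = r
  vertical' : dist (P 3) (P 4) = r

/-- Regular hexagon (with unit long diagonals): all edges are equal and all angles are equal. -/
structure IsRegular (P : Fin 6 → Plane) : Prop where
  rectilinear : IsRectilinear P
  edges : ∀ i j, dist (P i) (P (i + 1)) = dist (P j) (P (j + 1))
  angles : ∀ i j, EuclideanGeometry.angle (P i) (P (i + 1)) (P (i + 2)) =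
    EuclideanGeometry.angle (P j) (P (j + 1)) (P (j + 2))

/-- The closed hexagonal region with vertices `P`. -/
def region (P : Fin 6 → Plane) : Set Plane := convexHull ℝ (Set.range P)

/-- The tile `(i, j)`: the translate of the base tile by `i • e₁ + j • e₂`, where the translation
by `e₁ = P 0 - P 4` carries the edge `P 4 P 3` to the opposite edge `P 0 P 1` and the translation
by `e₂ = P 1 - P 5` carries the edge `P 5 P 4` to the opposite edge `P 1 P 2`.
So the first axis is perpendicular to the edge `P 0 P 1` (it is horizontal when this edge is
vertical), and the second one is perpendicular to the next edge counterclockwise. -/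
def tile (P : Fin 6 → Plane) (p : ℤ × ℤ) : Set Plane :=
  (fun x => (p.1 : ℝ) • (P 0 - P 4) + (p.2 : ℝ) • (P 1 - P 5) + x) '' region P

/-- The tiles cover the plane and distinct tiles have disjoint interiors. -/
def IsTiling (P : Fin 6 → Plane) : Prop :=
  (⋃ p, tile P p) = Set.univ ∧
    ∀ p q, p ≠ q → Disjoint (interior (tile P p)) (interior (tile P q))

/-- The distance between the tiles `p` and `q`: the infimum of the distances between a point of
one and a point of the other. -/
def tileDist (P : Fin 6 → Plane) (p q : ℤ × ℤ) : ℝ :=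
  sInf (Set.image2 dist (tile P p) (tile P q))

/-- The translates of the hexagon `P`, which has unit diameter, form a lattice tiling of the
plane; the tiles are coloured with exactly `k` colours, the colour classes being the translates
of the sublattice generated by `t₁` and `t₂`; any two distinct tiles of the same colour are at
distance at least `d`; and `d` is the smallest of the three mutual distances of the tiles
`(0, 0)`, `t₁`, `t₂`. -/
structure IsColouredTiling (P : Fin 6 → Plane) (k : ℕ) (t₁ t₂ : ℤ × ℤ) (d : ℝ) : Prop where
  diam : Metric.diam (region P) = 1
  tiling : IsTiling P
  index : (k : ℤ) = t₁.1 * t₂.2 - t₂.1 * t₁.2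
  colouring : ∃ c : ℤ × ℤ → Fin k, Function.Surjective c ∧
    (∀ p q, c p = c q ↔ p - q ∈ AddSubgroup.closure {t₁, t₂}) ∧
    ∀ p q, p ≠ q → c p = c q → d ≤ tileDist P p q
  attained : min (tileDist P 0 t₁) (min (tileDist P 0 t₂) (tileDist P t₁ t₂)) = d

/-- The cubic polynomial attached to `k = n (n + 1)`, with
`p = n (n - 1) = k + 1 - √(4 k + 1)`. -/
def cubic (k x : ℝ) : ℝ :=
  let p := k + 1 - √(4 * k + 1)
  4 * p * (p ^ 2 + 3 * p + 1) * x ^ 3 + (-3 * p ^ 4 - 8 * p ^ 3 + 2 * p ^ 2 + 4 * p + 1) * x ^ 2 +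
    2 * p ^ 2 * (p ^ 2 - 2 * p - 1) * x + p ^ 4

/-- The largest real root of `cubic k`. -/
def f (k : ℝ) : ℝ := sSup {x | cubic k x = 0}

/-- The smallest real root of `a x⁴ + b x³ + c x² + d x + e`. -/
def quarticRoot (a b c d e : ℝ) : ℝ :=
  sInf {x | a * x ^ 4 + b * x ^ 3 + c * x ^ 2 + d * x + e = 0}

/-- A row of the table: the number `k` of colours, the tiles `t₁ = (i₁, j₁)` and `t₂ = (i₂, j₂)`,
the value of `d²` for a regular hexagon, the value of `d²` and the parameter `r` for a
semi-regular hexagon, the value of `d²` for a rectilinear hexagon (`none` is a blank cell),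
the decimal approximation of `d`, the number of its decimal digits, and whether it is bold. -/
structure Row where
  k : ℕ
  t₁ : ℤ × ℤ
  t₂ : ℤ × ℤ
  regular : Option ℝ
  semiRegular : Option (ℝ × ℝ)
  rectilinear : Option ℝ
  approx : ℝ
  digits : ℕ
  bold : Bool

/-- The rows with `3 ≤ k ≤ 45`. -/
def tableA : List Row := [
  ⟨3, (2, -1), (1, 1), some ((1 / 2)^2), none, none,
    0.500000, 6, true⟩,
  ⟨4, (2, 0), (0, 2), some (3 / 4), none, none,
    0.866025, 6, true⟩,
  ⟨5, (3, -1), (2, 1), none, some ((5 / 6)^2, 5 / 6), none,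
    0.833333, 6, false⟩,
  ⟨6, (3, 0), (0, 2), none, some ((17 + √33) / 24, (√33 - 3) / 12), some (f 6),
    0.992076, 6, true⟩,
  ⟨7, (3, -1), (1, 2), some (7 / 4), none, none,
    1.322876, 6, true⟩,
  ⟨8, (3, -2), (1, 2), none, some ((7 / 5)^2, 1 / 5), none,
    1.400000, 6, true⟩,
  ⟨9, (3, 0), (0, 3), some 3, none, none,
    1.732051, 6, true⟩,
  ⟨10, (4, -1), (2, 2), none, some (11 / 4, 3 / 4), none,
    1.658312, 6, false⟩,
  ⟨11, (3, -2), (1, 3), none, some (11 / 4, 3 / 4), some (quarticRoot 25600 (-1459616) 8840377 (-18735876) 13623552),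
    1.674155, 6, false⟩,
  ⟨12, (4, -2), (2, 2), some (2^2), none, none,
    2.000000, 6, true⟩,
  ⟨13, (4, -1), (1, 3), some (19 / 4), none, none,
    2.179449, 6, true⟩,
  ⟨14, (4, -2), (1, 3), none, some (19 / 4, 1 / 4), none,
    2.179449, 6, false⟩,
  ⟨15, (4, -3), (1, 3), none, some (153 / 32, 3 / 8), none,
    2.186607, 6, true⟩,
  ⟨16, (4, 0), (0, 4), some (27 / 4), none, none,
    2.598076, 6, true⟩,
  ⟨17, (5, -1), (2, 3), none, some (627 / 100, 7 / 10), some (709371 / 111724),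
    2.519785, 6, false⟩,
  ⟨18, (4, -3), (2, 3), none, some (6, 2 / 3), some (20 - √192),
    2.478627, 6, false⟩,
  ⟨19, (5, -2), (2, 3), some (31 / 4), none, none,
    2.783882, 6, true⟩,
  ⟨20, (5, 0), (0, 4), none, some ((5931 + 405 * √129) / 1352, (3 * √129 - 15) / 52), some (f 20),
    2.862821, 6, true⟩,
  ⟨21, (5, -1), (1, 4), some (37 / 4), none, none,
    3.041381, 6, true⟩,
  ⟨22, (5, -2), (1, 4), none, some (3^2, 1 / 3), some (193496 / 21275),
    3.015791, 6, false⟩,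
  ⟨23, (5, -3), (1, 4), none, some (103 / 12, 1 / 6), some (quarticRoot 97344 (-14493200) 287680857 (-2041299600) 4968218624),
    2.942985, 6, false⟩,
  ⟨24, (6, -2), (3, 3), none, some (1216 / 121, 29 / 44), some (869 / 86),
    3.178781, 6, true⟩,
  ⟨25, (5, 0), (0, 5), some 12, none, none,
    3.464102, 6, true⟩,
  ⟨26, (6, -1), (2, 4), none, some (203 / 18, 2 / 3), some (2150 / 187),
    3.390771, 6, false⟩,
  ⟨27, (6, -3), (3, 3), some ((7 / 2)^2), none, none,
    3.500000, 6, true⟩,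
  ⟨28, (6, -2), (2, 4), some 13, none, none,
    3.605551, 6, true⟩,
  ⟨29, (7, -2), (4, 3), none, some (44719 / 3844, 47 / 62), some (481078403 / 41028908),
    3.424230, 6, false⟩,
  ⟨30, (6, 0), (0, 5), none, some ((1072 + 128 * √51) / 147, (2 * √51 - 6) / 21), some (f 30),
    3.762292, 6, true⟩,
  ⟨31, (6, -1), (1, 5), some (61 / 4), none, none,
    3.905125, 6, true⟩,
  ⟨32, (6, -1), (2, 5), none, some (59 / 4, 3 / 8), some (2307733 / 153928),
    3.871988, 6, false⟩,
  ⟨33, (7, -3), (4, 3), none, some ((227 / 58)^2, 37 / 58), none,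
    3.913793, 6, true⟩,
  ⟨34, (7, -2), (3, 4), none, some (1921 / 121, 7 / 11), some (170126 / 10611),
    4.004121, 6, true⟩,
  ⟨35, (7, 0), (1, 5), none, some ((17559 + 135 * √12257) / 2048, (√12257 - 15) / 128), none,
    3.983917, 6, false⟩,
  ⟨36, (6, 0), (0, 6), some (75 / 4), none, none,
    4.330127, 6, true⟩,
  ⟨37, (7, -3), (3, 4), some (73 / 4), none, none,
    4.272002, 6, false⟩,
  ⟨38, (6, -1), (2, 6), none, some (17, 3 / 5), some (343577 / 19520),
    4.195388, 6, false⟩,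
  ⟨39, (7, -2), (2, 5), some (79 / 4), none, none,
    4.444097, 6, true⟩,
  ⟨40, (7, -4), (3, 4), none, some ((137 / 31)^2, 11 / 31), none,
    4.419355, 6, false⟩,
  ⟨41, (7, -2), (3, 5), none, some (637 / 32, 3 / 8), some (19168435 / 946444),
    4.500346, 6, true⟩,
  ⟨42, (7, 0), (0, 6), none, some ((84075 + 13125 * √33) / 7688, (15 * √33 - 35) / 124), some (f 42),
    4.651075, 6, true⟩,
  ⟨43, (7, -1), (1, 6), some (91 / 4), none, none,
    4.769696, 6, true⟩,
  ⟨44, (7, -1), (2, 6), none, some (22, 2 / 5), some (4700717 / 209612),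
    4.735589, 6, false⟩,
  ⟨45, (7, -3), (1, 6), none, some (423 / 20, 3 / 10), some (quarticRoot 548800 (-70030800) 2721532527 (-44612184348) 279110188800),
    4.607942, 6, false⟩]

/-- The rows with `46 ≤ k ≤ 89`. -/
def tableB : List Row := [
  ⟨46, (8, -2), (3, 5), none, some (49051 / 2116, 57 / 92), some (73151 / 3116),
    4.845197, 6, true⟩,
  ⟨47, (7, -3), (4, 5), none, some (3224 / 147, 13 / 21), some (5560412771 / 243356228),
    4.780048, 6, false⟩,
  ⟨48, (8, -4), (4, 4), some (5^2), none, none,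
    5.000000, 6, true⟩,
  ⟨49, (7, 0), (0, 7), some 27, none, none,
    5.196152, 6, true⟩,
  ⟨50, (8, -1), (2, 6), none, some (825 / 32, 5 / 8), some (2143125 / 81224),
    5.136669, 6, false⟩,
  ⟨51, (7, -1), (2, 7), none, some (6016 / 243, 19 / 27), some (32914863743 / 1281311828),
    5.068374, 6, false⟩,
  ⟨52, (8, -2), (2, 6), some 28, none, none,
    5.291503, 6, true⟩,
  ⟨53, (9, -2), (4, 5), none, some (358639 / 13924, 83 / 118), some (21713005483 / 826893628),
    5.124307, 6, false⟩,
  ⟨54, (8, -2), (3, 6), none, some (335 / 12, 5 / 12), some (118349 / 4160),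
    5.333787, 6, true⟩,
  ⟨55, (9, -1), (1, 6), none, some ((449 / 86)^2, 21 / 86), some (15510042323 / 562475260),
    5.251154, 6, false⟩,
  ⟨56, (8, 0), (0, 7), none, some ((277 / 51)^2, 31 / 51), some (f 56),
    5.533452, 6, true⟩,
  ⟨57, (8, -1), (1, 7), some (127 / 4), none, none,
    5.634714, 6, true⟩,
  ⟨58, (8, -1), (2, 7), none, some (123 / 4, 5 / 12), some (7191956 / 229175),
    5.601959, 6, false⟩,
  ⟨59, (8, -1), (3, 7), none, some (89 / 3, 1 / 3), some (742918955 / 24763644),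
    5.477261, 6, false⟩,
  ⟨60, (9, -2), (3, 6), none, some (118969 / 3721, 37 / 61), some (4775023 / 147232),
    5.694907, 6, true⟩,
  ⟨61, (9, -4), (4, 5), some (133 / 4), none, none,
    5.766281, 6, true⟩,
  ⟨62, (8, -2), (3, 7), none, some (49987 / 1600, 47 / 80), some (2563175 / 79001),
    5.696037, 6, false⟩,
  ⟨63, (9, -3), (3, 6), some (139 / 4), none, none,
    5.894913, 6, true⟩,
  ⟨64, (8, 0), (0, 8), some (147 / 4), none, none,
    6.062178, 6, true⟩,
  ⟨65, (9, -1), (2, 7), none, some (11431 / 324, 11 / 18), some (42769993 / 1184612),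
    6.008714, 6, false⟩,
  ⟨66, (9, -3), (4, 6), none, some (23987 / 675, 17 / 45), some (1193079661 / 33188989),
    5.995670, 6, false⟩,
  ⟨67, (9, -2), (2, 7), some (151 / 4), none, none,
    6.144103, 6, true⟩,
  ⟨68, (10, -2), (4, 6), none, some (12649 / 361, 13 / 19), some (3193957 / 89125),
    5.986387, 6, false⟩,
  ⟨69, (9, -2), (3, 7), none, some (262 / 7, 3 / 7), some (6272261 / 164372),
    6.177292, 6, true⟩,
  ⟨70, (10, -4), (5, 5), none, some (44339 / 1156, 81 / 136), some (414848 / 10783),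
    6.202613, 6, true⟩,
  ⟨71, (10, -1), (1, 7), none, some (1035 / 28, 5 / 14), some (3274003629 / 86168876),
    6.164025, 6, false⟩,
  ⟨72, (9, 0), (0, 8), none, some ((177233 + 7203 * √537) / 8664, (7 * √537 - 63) / 228), some (f 72),
    6.411744, 6, true⟩,
  ⟨73, (9, -1), (1, 8), some ((13 / 2)^2), none, none,
    6.500000, 6, true⟩,
  ⟨74, (9, -1), (2, 8), none, some (41, 3 / 7), some (9026779 / 215683),
    6.469317, 6, false⟩,
  ⟨75, (10, -5), (5, 5), some ((13 / 2)^2), none, none,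
    6.500000, 6, false⟩,
  ⟨76, (10, -4), (4, 6), some 43, none, none,
    6.557439, 6, true⟩,
  ⟨77, (11, 0), (2, 7), none, some (1215 / 32, 5 / 8), none,
    6.161879, 6, false⟩,
  ⟨78, (9, -2), (3, 8), none, some (21844 / 529, 53 / 92), some (4833828787 / 112826683),
    6.545453, 6, false⟩,
  ⟨79, (10, -3), (3, 7), some (181 / 4), none, none,
    6.726812, 6, true⟩,
  ⟨80, (10, -4), (5, 6), none, some ((63261 + 972 * √3770) / 2738, (√3770 - 12) / 74), some (241351 / 5371),
    6.703428, 6, false⟩,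
  ⟨81, (9, 0), (0, 9), some 48, none, none,
    6.928203, 6, true⟩,
  ⟨82, (10, -1), (2, 8), none, some (1157 / 25, 3 / 5), some (1184696 / 25029),
    6.879893, 6, false⟩,
  ⟨83, (9, -1), (2, 9), none, some (957559 / 21316, 47 / 146), some (975386934409 / 20985431116),
    6.817569, 6, false⟩,
  ⟨84, (10, -2), (2, 8), some (7^2), none, none,
    7.000000, 6, true⟩,
  ⟨85, (11, -5), (6, 5), none, some ((1097 / 158)^2, 93 / 158), none,
    6.943038, 6, false⟩,
  ⟨86, (10, -2), (3, 8), none, some (40953 / 841, 17 / 29), some (30121 / 610),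
    7.026997, 6, true⟩,
  ⟨87, (9, -2), (3, 9), none, some (638611 / 13924, 79 / 118), some (1080643 / 23188),
    6.826679, 6, false⟩,
  ⟨88, (10, -2), (4, 8), none, some (191 / 4, 3 / 8), some (84065 / 1729),
    6.972847, 6, false⟩,
  ⟨89, (11, -3), (4, 7), none, some (194709 / 3844, 109 / 186), some (511258004631 / 9991926364),
    7.153119, 6, true⟩]

/-- The rows with `90 ≤ k ≤ 132`. -/
def tableC : List Row := [
  ⟨90, (10, 0), (0, 9), none, some ((140352 + 30720 * √19) / 5329, (12 * √19 - 20) / 73), some (f 90),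
    7.287290, 6, true⟩,
  ⟨91, (10, -1), (1, 9), some (217 / 4), none, none,
    7.365460, 6, true⟩,
  ⟨92, (10, -1), (2, 9), none, some (211 / 4, 7 / 16), some (4639657267 / 86189275),
    7.336963, 6, false⟩,
  ⟨93, (11, -4), (4, 7), some (217 / 4), none, none,
    7.365460, 6, false⟩,
  ⟨94, (11, -2), (3, 8), none, some ((713 / 97)^2, 57 / 97), some (666148999 / 12139951),
    7.407595, 6, true⟩,
  ⟨95, (12, -5), (7, 5), none, some ((277 / 38)^2, 25 / 38), none,
    7.289474, 6, false⟩,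
  ⟨96, (11, -6), (5, 6), none, some ((67 / 9)^2, 11 / 27), none,
    7.444444, 6, true⟩,
  ⟨97, (11, -3), (3, 8), some (229 / 4), none, none,
    7.566373, 6, true⟩,
  ⟨98, (12, -1), (2, 8), none, some (115625 / 2178, 8 / 33), some (613512713 / 11338873),
    7.355748, 6, false⟩,
  ⟨99, (11, 0), (1, 9), none, some ((498775 + 1575 * √91553) / 16928, (√91553 - 63) / 368), none,
    7.590561, 6, true⟩,
  ⟨100, (10, 0), (0, 10), some (243 / 4), none, none,
    7.794229, 6, true⟩,
  ⟨101, (11, -1), (2, 9), none, some (28449 / 484, 13 / 22), some (12663270675 / 210818572),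
    7.750300, 6, false⟩,
  ⟨102, (12, -5), (6, 6), none, some (29651 / 500, 29 / 50), some (208565 / 3509),
    7.709550, 6, false⟩,
  ⟨103, (11, -2), (2, 9), some (247 / 4), none, none,
    7.858117, 6, true⟩,
  ⟨104, (12, -4), (5, 7), none, some (176485 / 2916, 125 / 216), some (4142419871 / 67995631),
    7.805245, 6, false⟩,
  ⟨105, (11, -2), (3, 9), none, some (1097 / 18, 4 / 9), some (447216991 / 7200892),
    7.880722, 6, true⟩,
  ⟨106, (10, -2), (3, 10), none, some ((84 / 11)^2, 29 / 44), some (33151587 / 560347),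
    7.691723, 6, false⟩,
  ⟨107, (11, -5), (6, 7), none, some (2161 / 36, 7 / 18), some (12486512240719 / 202886322964),
    7.845022, 6, false⟩,
  ⟨108, (12, -6), (6, 6), some (8^2), none, none,
    8.000000, 6, true⟩,
  ⟨109, (12, -5), (5, 7), some (259 / 4), none, none,
    8.046738, 6, true⟩,
  ⟨110, (11, 0), (0, 10), none, some ((2184003 + 72171 * √849) / 66248, (9 * √849 - 99) / 364), some (f 110),
    8.160909, 6, true⟩,
  ⟨111, (11, -1), (1, 10), some (271 / 4), none, none,
    8.231039, 6, true⟩,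
  ⟨112, (11, -1), (2, 10), some 67, none, some (1034089141 / 15361771),
    8.204618, 6, false⟩,
  ⟨113, (11, -1), (3, 10), none, some (451319 / 6962, 38 / 59), some (387649933983 / 5906484172),
    8.101312, 6, false⟩,
  ⟨114, (12, -2), (3, 9), none, some (937099 / 13924, 137 / 236), some (283698767 / 4150532),
    8.267550, 6, true⟩,
  ⟨115, (13, -4), (6, 7), none, some (4244941 / 64516, 163 / 254), some (12272144911631 / 184524424676),
    8.155175, 6, false⟩,
  ⟨116, (12, -4), (5, 8), none, some (8723 / 128, 13 / 32), some (2045764331 / 29695775),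
    8.300045, 6, true⟩,
  ⟨117, (12, -3), (3, 9), some (283 / 4), none, none,
    8.411302, 6, true⟩,
  ⟨118, (11, -2), (4, 10), none, some (451319 / 6962, 38 / 59), some (22520512223 / 336563063),
    8.180049, 6, false⟩,
  ⟨119, (13, -3), (5, 8), none, some ((1643 / 198)^2, 65 / 198), some (17514883072583 / 252372028148),
    8.330729, 6, false⟩,
  ⟨120, (12, -3), (4, 9), none, some ((28677 + 3630 * √58) / 784, (3 * √58 - 5) / 28), some (102121645769 / 1420956281),
    8.477515, 6, true⟩,
  ⟨121, (11, 0), (0, 11), some 75, none, none,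
    8.660254, 6, true⟩,
  ⟨122, (12, -1), (2, 10), none, some (655 / 9, 7 / 12), some (10143575 / 136512),
    8.620056, 6, false⟩,
  ⟨123, (11, -1), (2, 11), none, some (392863 / 5476, 79 / 222), some (129728247871 / 1768473940),
    8.564814, 6, false⟩,
  ⟨124, (12, -2), (2, 10), some 76, none, none,
    8.717798, 6, true⟩,
  ⟨125, (13, -2), (4, 9), none, some (5551687 / 77284, 179 / 278), some (976273547119 / 13237256716),
    8.587896, 6, false⟩,
  ⟨126, (12, -2), (3, 10), none, some (1499 / 20, 9 / 20), some (19145005 / 250792),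
    8.737172, 6, true⟩,
  ⟨127, (13, -6), (6, 7), some (307 / 4), none, none,
    8.760708, 6, true⟩,
  ⟨128, (12, -4), (5, 9), none, some (369 / 5, 2 / 5), some (795830295 / 10506727),
    8.703151, 6, false⟩,
  ⟨129, (13, -5), (5, 8), some (313 / 4), none, none,
    8.845903, 6, true⟩,
  ⟨130, (13, 0), (1, 10), none, some ((3182571 + 312741 * √97) / 84872, (27 * √97 - 143) / 412), some ((18088 + 16 * √1192555) / 469),
    8.707601, 6, false⟩,
  ⟨131, (13, -1), (1, 10), none, some (3094091 / 40804, 81 / 202), some (192224305737 / 2452589252),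
    8.853026, 6, true⟩,
  ⟨132, (12, 0), (0, 11), none, some ((165700 + 10000 * √258) / 4107, (5 * √258 - 30) / 111), some (f 132),
    9.033127, 6, true⟩]

/-- The rows with `133 ≤ k ≤ 175`. -/
def tableD : List Row := [
  ⟨133, (12, -1), (1, 11), some (331 / 4), none, none,
    9.096703, 6, true⟩,
  ⟨134, (12, -1), (2, 11), none, some (323 / 4, 9 / 20), some (6558879037 / 79690552),
    9.072174, 6, false⟩,
  ⟨135, (12, -1), (3, 11), none, some (787 / 10, 2 / 5), some (10272242758901 / 127501682004),
    8.975831, 6, false⟩,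
  ⟨136, (13, -2), (3, 10), none, some (181289 / 2209, 27 / 47), some (20689231 / 248261),
    9.128889, 6, true⟩,
  ⟨137, (13, -4), (5, 9), none, some (2598661 / 31684, 73 / 178), some (74222844365281 / 892932274564),
    9.117159, 6, false⟩,
  ⟨138, (12, -2), (3, 11), none, some (27389 / 338, 19 / 52), some (1122833 / 13505),
    9.118225, 6, false⟩,
  ⟨139, (13, -3), (3, 10), some (343 / 4), none, none,
    9.260130, 6, true⟩,
  ⟨140, (14, -6), (7, 7), none, some (134518 / 1587, 157 / 276), some (80581 / 949),
    9.214743, 6, false⟩,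
  ⟨141, (14, -3), (5, 9), none, some (929347 / 11236, 67 / 106), some (196014091823 / 2324718468),
    9.182448, 6, false⟩,
  ⟨142, (13, -3), (4, 10), none, some (117688 / 1369, 21 / 37), some (15150070069 / 174437335),
    9.319392, 6, true⟩,
  ⟨143, (13, 0), (1, 11), none, some ((399015 + 4455 * √7553) / 8978, (5 * √7553 - 99) / 536), none,
    9.357805, 6, true⟩,
  ⟨144, (12, 0), (0, 12), some (363 / 4), none, none,
    9.526279, 6, true⟩,
  ⟨145, (13, -1), (2, 11), none, some (59675 / 676, 15 / 26), some (3279780625 / 36423236),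
    9.489277, 6, false⟩,
  ⟨146, (14, -4), (5, 9), none, some (119853 / 1352, 59 / 104), some (16400637 / 183488),
    9.454238, 6, false⟩,
  ⟨147, (13, -2), (2, 11), some (367 / 4), none, none,
    9.578622, 6, true⟩,
  ⟨148, (14, -6), (6, 8), some 91, none, none,
    9.539392, 6, false⟩,
  ⟨149, (13, -2), (3, 11), none, some (995 / 11, 5 / 11), some (1164694451 / 12649484),
    9.595544, 6, true⟩,
  ⟨150, (13, -4), (5, 10), none, some (112529 / 1280, 103 / 160), some (286692851539 / 3160973281),
    9.523531, 6, false⟩,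
  ⟨151, (14, -5), (5, 9), some (373 / 4), none, none,
    9.656604, 6, true⟩,
  ⟨152, (14, -3), (4, 10), none, some (405821 / 4374, 46 / 81), some (7532633043 / 80257313),
    9.687932, 6, true⟩,
  ⟨153, (15, -6), (8, 7), none, some (1030243 / 11236, 199 / 318), some (894213901557691 / 9724451350300),
    9.589328, 6, false⟩,
  ⟨154, (14, -6), (7, 8), none, some (771407 / 8192, 109 / 256), some (1311592 / 13897),
    9.714912, 6, true⟩,
  ⟨155, (14, -1), (1, 11), none, some (133856 / 1445, 53 / 85), some (15557710498703 / 164015315380),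
    9.739365, 6, true⟩,
  ⟨156, (13, 0), (0, 12), some 97, none, some (f 156),
    9.904296, 6, true⟩,
  ⟨157, (13, -1), (1, 12), some (397 / 4), none, none,
    9.962429, 6, true⟩,
  ⟨158, (13, -1), (2, 12), none, some (97, 5 / 11), some (75425702171 / 763451750),
    9.939599, 6, false⟩,
  ⟨159, (13, -1), (3, 12), none, some (12176361 / 128164, 223 / 358), some (184097879615 / 1897621332),
    9.849623, 6, false⟩,
  ⟨160, (14, -2), (3, 11), none, some (677416 / 6889, 189 / 332), some (9726226252 / 97433683),
    9.991199, 6, true⟩,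
  ⟨161, (15, -7), (8, 7), none, some (9284209 / 93636, 173 / 306), none,
    9.957516, 6, false⟩,
  ⟨162, (15, -6), (7, 8), none, some (301273 / 3025, 31 / 55), some (195650535281 / 1958502269),
    9.994901, 6, true⟩,
  ⟨163, (14, -3), (3, 11), some (409 / 4), none, none,
    10.11187, 5, true⟩,
  ⟨164, (14, -4), (6, 10), none, some (292 / 3, 5 / 12), some (267614 / 2691),
    9.972351, 6, false⟩,
  ⟨165, (15, -5), (6, 9), none, some (2487641 / 24500, 197 / 350), some (33252082489597 / 325566557812),
    10.10624, 5, false⟩,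
  ⟨166, (14, -3), (4, 11), none, some (813 / 8, 11 / 24), some (544579139 / 5269928),
    10.16549, 5, true⟩,
  ⟨167, (15, -1), (2, 11), none, some (6025357 / 60516, 77 / 246), some (7169589821 / 70929460),
    10.05388, 5, false⟩,
  ⟨168, (14, 0), (1, 12), none, some ((662311 + 5070 * √16226) / 12482, (√16226 - 30) / 158), none,
    10.23727, 5, true⟩,
  ⟨169, (13, 0), (0, 13), some 108, none, none,
    10.39230, 5, true⟩,
  ⟨170, (14, -1), (2, 12), none, some (10317 / 98, 4 / 7), some (1618378002 / 15084233),
    10.35806, 5, false⟩,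
  ⟨171, (15, -6), (6, 9), some (427 / 4), none, none,
    10.33199, 5, false⟩,
  ⟨172, (14, -2), (2, 12), some 109, none, none,
    10.44031, 5, true⟩,
  ⟨173, (15, -2), (4, 11), none, some (15153631 / 145924, 239 / 382), some (37802632989571 / 354544269100),
    10.32585, 5, false⟩,
  ⟨174, (14, -2), (3, 12), none, some (2579 / 24, 11 / 24), some (1893749 / 17324),
    10.45531, 5, true⟩,
  ⟨175, (15, -5), (5, 10), some (439 / 4), none, none,
    10.47616, 5, true⟩]

/-- The whole table. -/
def table : List Row := tableA ++ tableB ++ tableC ++ tableD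

/-- The nonblank cells of a row, from the most to the least restricted class of hexagons: each is
the class of hexagons together with the value of `d²`. -/
def Row.cells (R : Row) : List (((Fin 6 → Plane) → Prop) × ℝ) :=
  (R.regular.map fun x => (IsRegular, x)).toList ++
    (R.semiRegular.map fun x => (IsSemiRegular x.2, x.1)).toList ++
    (R.rectilinear.map fun x => (IsRectilinear, x)).toList

/-- `d(k)²`, the value in the last nonblank cell of the row. -/
def Row.dSq (R : Row) : ℝ := (R.cells.getLast?.map Prod.snd).getD 0

/-- `d(k)`. -/
def Row.d (R : Row) : ℝ := √R.dSq

/-- The largest tabulated value of `d` with at most `k` colours. -/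
def best (k : ℕ) : ℝ := sSup {x | ∃ R ∈ table, R.k ≤ k ∧ x = R.d}

end HexTiling

end

/-! ### Hexagons inscribed in a circle, and their classes -/

namespace HexTiling

/-! All hexagons used are centrally symmetric and inscribed in the circle of radius 1/2. Up to
rotation such a hexagon `H` is given by the unit vectors 2P₀, 2P₁, 2P₂, that is, by two consecutive
central angles α, β with α + β < π. With a = cos α, b = cos β and sines s, t, the third cosine is c
= ab - st. Since the vertices have equal norms, each edge XY lies on the perpendicular bisector of 0
and X + Y. Thus `H` is the Dirichlet cell of 0 in the lattice generated by e₁ = P₀ + P₁ and e₂ = P₁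
+ P₂. A nearest lattice point gives the covering, and strict Dirichlet inequalities give disjoint
interiors (`hexagon_isTiling`).

Because H = -H, the distance from H to v + H is the distance from v to 2H. A strip separating v from
2H bounds it from below (`far_of_strip`), and the nearest vertex of 2H or the foot of a
perpendicular on a side bounds it from above (`near_of_vertex`, `near_of_side`). Of the infinitely
many pairs of tiles of one colour only three have to be examined in this way. If u, v and w = v - u
are the vectors of t₁, t₂ and t₂ - t₁, then up to sign every nonzero vector of the sublattice lies
in one of the nonobtuse cones (u, v), (v, w), (w, -u). Apart from the generators, its length is at
least d + 1 under finitely many conditions, and then the tiles are far apart since each lies in a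
disc of radius 1/2 (`far_cone`, `isColouredTiling_of`).

All conditions are now signs of polynomials in a, b, c and d². For each cell these numbers lie in
the field of one real number: 0, a square root, or an extreme root of a cubic or quartic. Strict
signs follow from Horner evaluation in integer fixed-point arithmetic. Identities, needed because
the distance must equal d exactly and because the three unit vectors must be coplanar, follow by
eliminating with the polynomial of the generator (`Isolation.Holds.nn`, `Isolation.Holds.zz`). The
resulting test is sound (`Claim.isColouredTiling`, `Cell.exists_isColouredTiling`) and is evaluated
by the kernel on every row, with the Gram matrices of the rectilinear hexagons supplied as data.

Rounding, the order of the cells and the stars are decided by the same arithmetic. The comparison of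
k with k - 3 colours follows from the stars, because any three consecutive values of k ending in 6,
…, 175 include a starred one. -/

/-- The scalar product of the plane in coordinates. -/
def ip (u v : Plane) : ℝ := u 0 * v 0 + u 1 * v 1

/-- The centrally symmetric hexagon inscribed in the circle of radius `1 / 2` whose consecutive
vertices `P 0`, `P 1`, `P 2` are half of `(a, -s)`, `(1, 0)`, `(b, t)`. -/
noncomputable def hexagon (a s b t : ℝ) : Fin 6 → Plane :=
  ![!₂[a / 2, -s / 2], !₂[1 / 2, 0], !₂[b / 2, t / 2],
    !₂[-a / 2, s / 2], !₂[-1 / 2, 0], !₂[-b / 2, -t / 2]]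

/-- `(a, s)` and `(b, t)` are the cosines and sines of two positive angles with sum less
than `π`. -/
structure Admissible (a s b t : ℝ) : Prop where
  circ₁ : a ^ 2 + s ^ 2 = 1
  circ₂ : b ^ 2 + t ^ 2 = 1
  pos₁ : 0 < s
  pos₂ : 0 < t
  pos₃ : 0 < a + b

section
variable {a s b t : ℝ}

theorem dist_eq_sqrt (u v : Plane) : dist u v = √((u 0 - v 0) ^ 2 + (u 1 - v 1) ^ 2) := by
  simp [EuclideanSpace.dist_eq, Fin.sum_univ_two, Real.dist_eq, sq_abs]

theorem norm_sq_eq_ip (u : Plane) : ‖u‖ ^ 2 = ip u u := by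
  simp [EuclideanSpace.norm_sq_eq, Fin.sum_univ_two, ip, ← sq]

theorem inner_eq_ip (u v : Plane) : inner ℝ u v = ip u v := by
  simp [PiLp.inner_apply, Fin.sum_univ_two, ip, mul_comm]

theorem Admissible.lt_one₁ (h : Admissible a s b t) : a < 1 := by
  nlinarith [h.circ₁, h.pos₁, sq_nonneg (a - 1)]

theorem Admissible.lt_one₂ (h : Admissible a s b t) : b < 1 := by
  nlinarith [h.circ₂, h.pos₂, sq_nonneg (b - 1)]

theorem Admissible.neg_one_lt₁ (h : Admissible a s b t) : -1 < a := by
  nlinarith [h.circ₁, h.pos₁, sq_nonneg (a + 1)]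

theorem Admissible.neg_one_lt₂ (h : Admissible a s b t) : -1 < b := by
  nlinarith [h.circ₂, h.pos₂, sq_nonneg (b + 1)]

/-- In terms of the angles this is tan(α/2) tan(β/2) < 1, a form of α + β < π. After squaring, the
factor (1 - a)(1 + b) cancels and a + b > 0 remains. `lt₂` and `lt₃` are the same inequality with
the half-angle tangents written in other ways. -/
theorem Admissible.lt₁ (h : Admissible a s b t) : t * (1 - a) < s * (1 + b) := by
  have ha := sub_pos.2 h.lt_one₁
  have hb : 0 < 1 + b := by linarith [h.neg_one_lt₂]
  refine lt_of_pow_lt_pow_left₀ 2 (mul_pos h.pos₁ hb).le ?_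
  have hs : s ^ 2 = (1 - a) * (1 + a) := by linear_combination h.circ₁
  have ht : t ^ 2 = (1 - b) * (1 + b) := by linear_combination h.circ₂
  rw [mul_pow, mul_pow, hs, ht]
  nlinarith [mul_pos (mul_pos ha hb) h.pos₃]

theorem Admissible.lt₂ (h : Admissible a s b t) : s * (1 - b) < t * (1 + a) :=
  Admissible.lt₁ ⟨h.circ₂, h.circ₁, h.pos₂, h.pos₁, by linarith [h.pos₃]⟩

theorem Admissible.lt₃ (h : Admissible a s b t) : s * t < (1 + a) * (1 + b) := by
  have ha : 0 < 1 + a := by linarith [h.neg_one_lt₁]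
  have hb : 0 < 1 + b := by linarith [h.neg_one_lt₂]
  refine lt_of_pow_lt_pow_left₀ 2 (mul_pos ha hb).le ?_
  have hs : s ^ 2 = (1 - a) * (1 + a) := by linear_combination h.circ₁
  have ht : t ^ 2 = (1 - b) * (1 + b) := by linear_combination h.circ₂
  rw [mul_pow, mul_pow, hs, ht]
  nlinarith [mul_pos (mul_pos ha hb) h.pos₃]

theorem hexagon_convex (h : Admissible a s b t) : IsConvexHexagon (hexagon a s b t) := by
  have ha := sub_pos.2 h.lt_one₁
  have hb := sub_pos.2 h.lt_one₂
  have ha' : 0 < 1 + a := by linarith [h.neg_one_lt₁]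
  have hb' : 0 < 1 + b := by linarith [h.neg_one_lt₂]
  have hs := h.pos₁
  have ht := h.pos₂
  -- The orientation determinants are linear combinations of s, t, sa, sb, ta, tb, so these products
  -- together with `lt₁` and `lt₂` leave only linear arithmetic.
  have e1 := mul_pos hs hb
  have e2 := mul_pos hs hb'
  have e3 := mul_pos ht ha
  have e4 := mul_pos ht ha'
  have h3 := h.lt₁
  have h4 := h.lt₂
  intro i j h1 h2
  fin_cases i <;> fin_cases j <;>
    first
    | exact absurd rfl h1
    | exact absurd rfl h2
    | (simp [hexagon, cross]; linarith)

theorem hexagon_rectilinear (h : Admissible a s b t) : IsRectilinear (hexagon a s b t) where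
  convex := hexagon_convex h
  diagonal i := by
    have h1 := h.circ₁
    have h2 := h.circ₂
    rw [dist_eq_sqrt, Real.sqrt_eq_one]
    fin_cases i <;> simp [hexagon] <;> first | linarith | norm_num
  parallel i := by
    fin_cases i <;> simp [hexagon, cross] <;> ring

/-- The squared lengths of three consecutive edges are (1 - a)/2, (1 - b)/2 and (1 + c)/2 with c =
ab - st. The choice a = 1 - 2r², b = r, c = -r turns them into r², (1 - r)/2 and (1 - r)/2. -/
theorem hexagon_semiRegular {r : ℝ} (h : Admissible a s b t) (hr : 0 ≤ r) (ha : a = 1 - 2 * r ^ 2)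
    (hb : b = r) (hc : a * b - s * t = -r) : IsSemiRegular r (hexagon a s b t) := by
  have h1 := h.circ₁
  have h2 := h.circ₂
  have key : ∀ x y : ℝ, x = y → √x = √y := fun _ _ h => h ▸ rfl
  refine ⟨hexagon_rectilinear h, ?_, ?_, ?_, ?_, ?_⟩
  · rw [dist_eq_sqrt, dist_eq_sqrt]; apply key; simp [hexagon]; nlinarith
  · rw [dist_eq_sqrt, dist_eq_sqrt]; apply key; simp [hexagon]; nlinarith
  · rw [dist_eq_sqrt, dist_eq_sqrt]; apply key; simp [hexagon]; nlinarith
  · rw [dist_eq_sqrt, Real.sqrt_eq_iff_mul_self_eq (by positivity) hr]; simp [hexagon]; nlinarith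
  · rw [dist_eq_sqrt, Real.sqrt_eq_iff_mul_self_eq (by positivity) hr]; simp [hexagon]; nlinarith

/-- All central angles are 60°, so every edge has length 1/2 and every interior angle has cosine
-1/2. -/
theorem hexagon_regular (h : Admissible a s b t) (ha : a = 1 / 2) (hb : b = 1 / 2)
    (hst : s * t = 3 / 4) : IsRegular (hexagon a s b t) := by
  have h1 := h.circ₁
  have h2 := h.circ₂
  subst ha hb
  have hn : ∀ i, dist (hexagon (1 / 2) s (1 / 2) t i) (hexagon (1 / 2) s (1 / 2) t (i + 1))
      = 1 / 2 := by
    intro i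
    rw [dist_eq_sqrt, Real.sqrt_eq_iff_mul_self_eq (by positivity) (by norm_num)]
    fin_cases i <;> simp [hexagon] <;> nlinarith
  have ha : ∀ i, EuclideanGeometry.angle (hexagon (1 / 2) s (1 / 2) t i)
      (hexagon (1 / 2) s (1 / 2) t (i + 1)) (hexagon (1 / 2) s (1 / 2) t (i + 2))
      = Real.arccos (-1 / 2) := by
    intro i
    have e : i + 2 = i + 1 + 1 := by rw [add_assoc]; rfl
    rw [EuclideanGeometry.angle, InnerProductGeometry.angle, vsub_eq_sub, vsub_eq_sub,
      ← dist_eq_norm, ← dist_eq_norm, hn, e, dist_comm _ (hexagon _ _ _ _ (i + 1)), hn,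
      inner_eq_ip]
    congr 1
    rw [div_eq_iff (by norm_num)]
    fin_cases i <;> simp [hexagon, ip] <;> nlinarith
  exact ⟨hexagon_rectilinear h, fun i j => by rw [hn, hn], fun i j => by rw [ha, ha]⟩

end
-- The hexagonal region, its symmetry, and the translation lattice
section
variable {a s b t : ℝ}

theorem ip_comm (u v : Plane) : ip u v = ip v u := by simp only [ip]; ring

theorem ip_add_left (u v w : Plane) : ip (u + v) w = ip u w + ip v w := by
  simp only [ip, PiLp.add_apply]; ring

theorem ip_sub_left (u v w : Plane) : ip (u - v) w = ip u w - ip v w := by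
  simp only [ip, PiLp.sub_apply]; ring

theorem ip_neg_left (u w : Plane) : ip (-u) w = -ip u w := by
  simp only [ip, PiLp.neg_apply]; ring

theorem ip_smul_left (c : ℝ) (u w : Plane) : ip (c • u) w = c * ip u w := by
  simp only [ip, PiLp.smul_apply, smul_eq_mul]; ring

theorem ip_add_right (u v w : Plane) : ip u (v + w) = ip u v + ip u w := by
  simp only [ip, PiLp.add_apply]; ring

theorem ip_sub_right (u v w : Plane) : ip u (v - w) = ip u v - ip u w := by
  simp only [ip, PiLp.sub_apply]; ring

theorem ip_neg_right (u w : Plane) : ip u (-w) = -ip u w := by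
  simp only [ip, PiLp.neg_apply]; ring

theorem ip_smul_right (c : ℝ) (u w : Plane) : ip u (c • w) = c * ip u w := by
  simp only [ip, PiLp.smul_apply, smul_eq_mul]; ring

theorem ip_zero_right (u : Plane) : ip u 0 = 0 := by simp [ip]

theorem ip_self_nonneg (u : Plane) : 0 ≤ ip u u := by rw [← norm_sq_eq_ip]; positivity

theorem ip_le_of_mem_region {P : Fin 6 → Plane} {n x : Plane} {K : ℝ} (h : ∀ i, ip n (P i) ≤ K)
    (hx : x ∈ region P) : ip n x ≤ K := by
  have hc : Convex ℝ {x | ip n x ≤ K} :=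
    convex_halfSpace_le ⟨ip_add_right n, fun c x => by rw [ip_smul_right, smul_eq_mul]⟩ K
  exact convexHull_min (Set.range_subset_iff.2 h) hc hx

theorem vertex_mem_region (P : Fin 6 → Plane) (i : Fin 6) : P i ∈ region P :=
  subset_convexHull ℝ _ ⟨i, rfl⟩

theorem hexagon_add_three (i : Fin 6) : hexagon a s b t (i + 3) = -hexagon a s b t i := by
  ext j
  fin_cases i <;> fin_cases j <;> simp [hexagon] <;> ring

theorem neg_mem_region {x : Plane} (hx : x ∈ region (hexagon a s b t)) :
    -x ∈ region (hexagon a s b t) := by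
  have h : -region (hexagon a s b t) ⊆ region (hexagon a s b t) := by
    rw [region, ← convexHull_neg]
    apply convexHull_mono
    rintro y ⟨i, hi⟩
    exact ⟨i + 3, by rw [hexagon_add_three, hi, neg_neg]⟩
  exact h (by simpa using hx)

theorem zero_mem_region : (0 : Plane) ∈ region (hexagon a s b t) := by
  have h := vertex_mem_region (hexagon a s b t) 0
  simpa [region] using (convex_convexHull ℝ (Set.range (hexagon a s b t))) h (neg_mem_region h)
    (by norm_num : (0 : ℝ) ≤ 1 / 2) (by norm_num : (0 : ℝ) ≤ 1 / 2) (by norm_num)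

/-- The lattice vector with index `p`. -/
def vec (P : Fin 6 → Plane) (p : ℤ × ℤ) : Plane :=
  (p.1 : ℝ) • (P 0 - P 4) + (p.2 : ℝ) • (P 1 - P 5)

theorem vec_sub (P : Fin 6 → Plane) (p q : ℤ × ℤ) : vec P (p - q) = vec P p - vec P q := by
  simp only [vec, Prod.fst_sub, Prod.snd_sub, Int.cast_sub]; module

theorem mem_tile {P : Fin 6 → Plane} {p : ℤ × ℤ} {x : Plane} :
    x ∈ tile P p ↔ x - vec P p ∈ region P := by
  constructor
  · rintro ⟨y, hy, rfl⟩
    simpa [vec] using hy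
  · intro h
    exact ⟨_, h, by simp [vec]⟩

/-- A convex hull has the diameter of its generating set. The vertices have norm 1/2, so no two are
further apart than 1, and a long diagonal attains this. -/
theorem region_diam (h : Admissible a s b t) : Metric.diam (region (hexagon a s b t)) = 1 := by
  have hn : ∀ i, ‖hexagon a s b t i‖ = 1 / 2 := by
    intro i
    have h1 := h.circ₁
    have h2 := h.circ₂
    rw [← dist_zero_right, dist_eq_sqrt,
      Real.sqrt_eq_iff_mul_self_eq (by positivity) (by norm_num)]
    fin_cases i <;> simp [hexagon] <;> linarith
  rw [region, convexHull_diam]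
  apply le_antisymm
  · apply Metric.diam_le_of_forall_dist_le (by norm_num)
    rintro _ ⟨i, rfl⟩ _ ⟨j, rfl⟩
    exact (dist_le_norm_add_norm _ _).trans (by rw [hn, hn]; norm_num)
  · rw [← (hexagon_rectilinear h).diagonal 0]
    exact Metric.dist_le_diam_of_mem (Set.finite_range _).isBounded ⟨_, rfl⟩ ⟨_, rfl⟩

/-! ### The hexagon is the Dirichlet cell of the lattice -/

/-- When |X| = |Y|, the functional given by X + Y takes the value |X + Y|²/2 at both X and Y. The
last hypothesis therefore says l + m ≤ 1, and the point is a convex combination of 0, X and Y. -/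
theorem mem_region_of_cone {X Y : Plane} (hX : X ∈ region (hexagon a s b t))
    (hY : Y ∈ region (hexagon a s b t)) (hXY : ip X X = ip Y Y) (h0 : 0 < ip (X + Y) (X + Y))
    {l m : ℝ} (hl : 0 ≤ l) (hm : 0 ≤ m)
    (h : 2 * ip (X + Y) (l • X + m • Y) ≤ ip (X + Y) (X + Y)) :
    l • X + m • Y ∈ region (hexagon a s b t) := by
  have hlm : l + m ≤ 1 := by
    simp only [ip_add_left, ip_add_right, ip_smul_right] at h h0
    rw [ip_comm Y X, ← hXY] at h h0
    nlinarith
  have := (convex_convexHull ℝ (Set.range (hexagon a s b t))).sum_mem (t := Finset.univ)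
    (w := ![1 - l - m, l, m]) (z := ![0, X, Y])
    (by intro i _; fin_cases i <;> simp <;> linarith)
    (by simp [Fin.sum_univ_three]; ring)
    (by intro i _; fin_cases i
        exacts [zero_mem_region, hX, hY])
  simpa [Fin.sum_univ_three, region] using this

/-- The lattice generators and their difference. -/
theorem hexagon_gen (P : Fin 6 → Plane) (hP : P = hexagon a s b t) :
    P 0 - P 4 = P 0 + P 1 ∧ P 1 - P 5 = P 1 + P 2 := by
  subst hP
  have h4 : hexagon a s b t 4 = -hexagon a s b t 1 := hexagon_add_three 1
  have h5 : hexagon a s b t 5 = -hexagon a s b t 2 := hexagon_add_three 2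
  rw [h4, h5, sub_neg_eq_add, sub_neg_eq_add]
  exact ⟨rfl, rfl⟩

/-- Membership in the hexagon from the inequalities of the Dirichlet cell. -/
theorem mem_region_of_dirichlet (h : Admissible a s b t) {x : Plane}
    (hx : ∀ p, 2 * ip (vec (hexagon a s b t) p) x ≤
      ip (vec (hexagon a s b t) p) (vec (hexagon a s b t) p)) :
    x ∈ region (hexagon a s b t) := by
  obtain ⟨g1, g2⟩ := hexagon_gen _ (rfl : hexagon a s b t = _)
  have hA := vertex_mem_region (hexagon a s b t) 0
  have hB := vertex_mem_region (hexagon a s b t) 1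
  have hC := vertex_mem_region (hexagon a s b t) 2
  have hn : ∀ i, ip (hexagon a s b t i) (hexagon a s b t i) = 1 / 4 := by
    intro i
    have h1 := h.circ₁
    have h2 := h.circ₂
    fin_cases i <;> simp [hexagon, ip] <;> linarith
  have hAA := hn 0
  have hBB := hn 1
  have hCC := hn 2
  have hAB : ip (hexagon a s b t 0) (hexagon a s b t 1) = a / 4 := by
    simp [hexagon, ip]; ring
  have hBC : ip (hexagon a s b t 1) (hexagon a s b t 2) = b / 4 := by
    simp [hexagon, ip]; ring
  have hAC : ip (hexagon a s b t 0) (hexagon a s b t 2) = (a * b - s * t) / 4 := by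
    simp [hexagon, ip]; ring
  have hs := h.pos₁
  have ht := h.pos₂
  have hq : 0 < s * b + t * a := by linarith [h.lt₁, h.lt₂]
  have hCe : s • hexagon a s b t 2 =
      (s * b + t * a) • hexagon a s b t 1 - t • hexagon a s b t 0 := by
    ext j
    fin_cases j <;> simp [hexagon] <;> ring
  -- The coordinates of x in the basis P₀ = (a, -s)/2, P₁ = (1, 0)/2.
  have hxe : ∃ l m : ℝ, x = l • hexagon a s b t 0 + m • hexagon a s b t 1 := by
    refine ⟨-2 * x 1 / s, 2 * x 0 + 2 * x 1 / s * a, ?_⟩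
    ext j
    fin_cases j
    · simp [hexagon]; field_simp; ring
    · simp [hexagon]; field_simp
  simp only [vec, g1, g2] at hx
  clear g1 g2 hn
  have hneg := @neg_mem_region a s b t
  have hcone := @mem_region_of_cone a s b t
  generalize hexagon a s b t 0 = A at *
  generalize hexagon a s b t 1 = B at *
  generalize hexagon a s b t 2 = C at *
  have hA' := hneg hA
  have hB' := hneg hB
  have p1 : 0 < ip (A + B) (A + B) := by
    simp only [ip_add_left, ip_add_right, ip_comm B A, hAA, hBB, hAB]
    linarith [h.neg_one_lt₁]
  have p2 : 0 < ip (B + C) (B + C) := by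
    simp only [ip_add_left, ip_add_right, ip_comm C B, hCC, hBB, hBC]
    linarith [h.neg_one_lt₂]
  have p3 : 0 < ip (C + -A) (C + -A) := by
    simp only [ip_add_left, ip_add_right, ip_neg_left, ip_neg_right, ip_comm C A, hCC, hAA, hAC]
    nlinarith [h.lt₁, h.lt₂, h.lt_one₁, h.lt_one₂, h.circ₁, h.circ₂, sq_nonneg (a - b),
      mul_pos hs ht]
  have hv : ∀ x, (∀ p : ℤ × ℤ, 2 * ip ((p.1 : ℝ) • (A + B) + (p.2 : ℝ) • (B + C)) x ≤
      ip ((p.1 : ℝ) • (A + B) + (p.2 : ℝ) • (B + C))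
        ((p.1 : ℝ) • (A + B) + (p.2 : ℝ) • (B + C))) →
      2 * ip (A + B) x ≤ ip (A + B) (A + B) ∧ 2 * ip (B + C) x ≤ ip (B + C) (B + C) ∧
        2 * ip (C + -A) x ≤ ip (C + -A) (C + -A) := by
    intro x hx
    have e3 : ((-1 : ℤ) : ℝ) • (A + B) + ((1 : ℤ) : ℝ) • (B + C) = C + -A := by
      push_cast; module
    exact ⟨by simpa using hx (1, 0), by simpa using hx (0, 1), e3 ▸ hx (-1, 1)⟩
  -- The Dirichlet inequalities are also satisfied by -x, so only three of the six cones between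
  -- consecutive vertices need treatment.
  have hxneg : ∀ p : ℤ × ℤ, 2 * ip ((p.1 : ℝ) • (A + B) + (p.2 : ℝ) • (B + C)) (-x) ≤
      ip ((p.1 : ℝ) • (A + B) + (p.2 : ℝ) • (B + C))
        ((p.1 : ℝ) • (A + B) + (p.2 : ℝ) • (B + C)) := by
    intro p
    have e : ((-p.1 : ℤ) : ℝ) • (A + B) + ((-p.2 : ℤ) : ℝ) • (B + C) =
        -((p.1 : ℝ) • (A + B) + (p.2 : ℝ) • (B + C)) := by push_cast; module
    have := hx (-p.1, -p.2)
    rw [e, ip_neg_left, ip_neg_left, ip_neg_right, neg_neg] at this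
    rwa [ip_neg_right]
  have main1 : ∀ l m : ℝ, 0 ≤ l → 0 ≤ m → 2 * ip (A + B) (l • A + m • B) ≤ ip (A + B) (A + B) →
      l • A + m • B ∈ region (hexagon a s b t) := fun l m hl hm h =>
    hcone hA hB (by rw [hAA, hBB]) p1 hl hm h
  have main2 : ∀ l m : ℝ, l ≤ 0 → 0 ≤ m →
      2 * ip (B + C) (l • A + m • B) ≤ ip (B + C) (B + C) →
      2 * ip (C + -A) (l • A + m • B) ≤ ip (C + -A) (C + -A) →
      l • A + m • B ∈ region (hexagon a s b t) := by
    intro l m hl hm h2 h3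
    -- In the basis A, B the vertex C has the direction (-t, sb + ta). The two cases say on which
    -- side of the ray through C the point lies: in the cone of B, C or in that of C, -A.
    rcases le_total (-l * (s * b + t * a)) (m * t) with hc | hc
    · have e : l • A + m • B = (m - -l * (s * b + t * a) / t) • B + (-l / t) • s • C := by
        rw [hCe]
        match_scalars <;> field_simp
        ring
      rw [smul_smul] at e
      rw [e] at h2 ⊢
      refine hcone hB hC (by rw [hBB, hCC]) p2 (by rw [sub_nonneg, div_le_iff₀ ht]; exact hc) ?_ h2
      exact mul_nonneg (div_nonneg (by linarith) ht.le) hs.le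
    · have e : l • A + m • B =
          (m / (s * b + t * a)) • s • C + (-l - m * t / (s * b + t * a)) • -A := by
        rw [hCe]
        match_scalars <;> field_simp
        ring
      rw [smul_smul] at e
      rw [e] at h3 ⊢
      refine hcone hC hA' (by rw [ip_neg_left, ip_neg_right, hAA, hCC, neg_neg]) p3 ?_
        (by rw [sub_nonneg, div_le_iff₀ hq]; exact hc) h3
      exact mul_nonneg (div_nonneg hm hq.le) hs.le
  obtain ⟨l, m, rfl⟩ := hxe
  obtain ⟨h1, h2, h3⟩ := hv _ hx
  obtain ⟨n1, n2, n3⟩ := hv _ hxneg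
  have en : -(l • A + m • B) = (-l) • A + (-m) • B := by module
  rw [en] at n1 n2 n3
  rcases le_total 0 l with hl | hl <;> rcases le_total 0 m with hm | hm
  · exact main1 l m hl hm h1
  · rw [← neg_neg (l • A + m • B), en]
    exact hneg (main2 _ _ (by linarith) (by linarith) n2 n3)
  · exact main2 l m hl hm h2 h3
  · rw [← neg_neg (l • A + m • B), en]
    exact hneg (main1 _ _ (by linarith) (by linarith) n1)

/-- Every nonzero vector of a planar lattice lies, up to sign, in one of the three cones spanned
by consecutive members of a superbase. -/
theorem cone_induction {Q : ℤ → ℤ → Prop} (neg : ∀ m n, Q m n → Q (-m) (-n))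
    (h₁ : ∀ i j : ℤ, 0 ≤ i → 0 ≤ j → 0 < i + j → Q i j)
    (h₂ : ∀ i j : ℤ, 0 ≤ i → 0 ≤ j → 0 < i + j → Q (-j) (i + j))
    (h₃ : ∀ i j : ℤ, 0 ≤ i → 0 ≤ j → 0 < i + j → Q (-(i + j)) i)
    {m n : ℤ} (h : (m, n) ≠ 0) : Q m n := by
  have h' : m ≠ 0 ∨ n ≠ 0 := by
    by_contra! hc
    exact h (by rw [hc.1, hc.2]; rfl)
  have key : ∀ m n : ℤ, 0 ≤ n → (m ≠ 0 ∨ n ≠ 0) → Q m n := by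
    intro m n hn h
    rcases le_total 0 m with hm | hm
    · exact h₁ m n hm hn (by omega)
    · rcases le_total 0 (m + n) with hmn | hmn
      · have := h₂ (m + n) (-m) hmn (by omega) (by omega)
        rwa [neg_neg, add_assoc, add_comm n, ← add_assoc, add_neg_cancel, zero_add] at this
      · have := h₃ n (-m - n) hn (by omega) (by omega)
        rwa [show -(n + (-m - n)) = m by ring] at this
  rcases le_total 0 n with hn | hn
  · exact key m n hn h'
  · have := neg _ _ (key (-m) (-n) (by omega) (by omega))
    rwa [neg_neg, neg_neg] at this

end
-- Strict Dirichlet inequalities and the tiling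
section
variable {a s b t : ℝ}

/-- The first two members of the superbase `e₁`, `e₂`, `e₂ - e₁` and their scalar products. -/
theorem gen_acute (h : Admissible a s b t) :
    0 ≤ ip (vec (hexagon a s b t) (1, 0)) (vec (hexagon a s b t) (0, 1)) ∧
    0 ≤ ip (vec (hexagon a s b t) (0, 1)) (vec (hexagon a s b t) (-1, 1)) ∧
    0 ≤ ip (vec (hexagon a s b t) (-1, 1)) (vec (hexagon a s b t) (-1, 0)) := by
  have h1 := h.circ₁
  have h2 := h.circ₂
  have h3 := h.lt₁
  have h4 := h.lt₂
  have h5 := h.lt₃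
  have h6 := h.pos₁
  have h7 := h.pos₂
  refine ⟨?_, ?_, ?_⟩ <;> simp [vec, hexagon, ip]
  · nlinarith
  · nlinarith
  · nlinarith

theorem vec_eq_add (P : Fin 6 → Plane) (i j : ℤ) (p q : ℤ × ℤ) :
    vec P (i * p.1 + j * q.1, i * p.2 + j * q.2) = (i : ℝ) • vec P p + (j : ℝ) • vec P q := by
  simp only [vec]; push_cast; module

theorem vec_neg (P : Fin 6 → Plane) (p : ℤ × ℤ) : vec P (-p) = -vec P p := by
  rw [← zero_sub, vec_sub, ← zero_sub]; simp [vec]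

/-- For nonnegative integers i² ≥ i and j² ≥ j, and the mixed term is nonnegative. Hence |iu + jv|²
≥ i|u|² + j|v|², which exceeds 2⟨iu + jv, z⟩ because i and j are not both zero. -/
theorem cone_dirichlet {u v z : Plane} (huv : 0 ≤ ip u v) (hu : 2 * ip u z < ip u u)
    (hv : 2 * ip v z < ip v v) {i j : ℤ} (hi : 0 ≤ i) (hj : 0 ≤ j) (hij : 0 < i + j) :
    2 * ip ((i : ℝ) • u + (j : ℝ) • v) z <
      ip ((i : ℝ) • u + (j : ℝ) • v) ((i : ℝ) • u + (j : ℝ) • v) := by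
  simp only [ip_add_left, ip_add_right, ip_smul_left, ip_smul_right, ip_comm v u]
  have hi' : (0 : ℝ) ≤ i := by exact_mod_cast hi
  have hj' : (0 : ℝ) ≤ j := by exact_mod_cast hj
  have hi2 : (i : ℝ) ≤ i * i := by rw [← sq]; exact_mod_cast Int.le_self_sq i
  have hj2 : (j : ℝ) ≤ j * j := by rw [← sq]; exact_mod_cast Int.le_self_sq j
  have h1 := mul_le_mul_of_nonneg_right hi2 (ip_self_nonneg u)
  have h2 := mul_le_mul_of_nonneg_right hj2 (ip_self_nonneg v)
  have h3 := mul_nonneg (mul_nonneg hi' hj') huv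
  have h4 : (i : ℝ) * (2 * ip u z) + j * (2 * ip v z) < i * ip u u + j * ip v v := by
    rcases hi.eq_or_lt with rfl | hi
    · have : (0 : ℝ) < j := by exact_mod_cast (by omega : 0 < j)
      have := mul_lt_mul_of_pos_left hv this
      simpa using this
    · have : (0 : ℝ) < i := by exact_mod_cast hi
      have h5 := mul_lt_mul_of_pos_left hu this
      have h6 := mul_le_mul_of_nonneg_left hv.le hj'
      linarith
  nlinarith

/-- The strict inequalities for the six neighbours give those for all lattice vectors. -/
theorem dirichlet_lt (h : Admissible a s b t) {z : Plane}
    (hz : ∀ p ∈ ({(1, 0), (0, 1), (-1, 1), (-1, 0), (0, -1), (1, -1)} : Finset (ℤ × ℤ)),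
      2 * ip (vec (hexagon a s b t) p) z <
        ip (vec (hexagon a s b t) p) (vec (hexagon a s b t) p))
    {p : ℤ × ℤ} (hp : p ≠ 0) :
    2 * ip (vec (hexagon a s b t) p) z <
      ip (vec (hexagon a s b t) p) (vec (hexagon a s b t) p) := by
  obtain ⟨g1, g2, g3⟩ := gen_acute h
  have z1 := hz (1, 0) (by simp)
  have z2 := hz (0, 1) (by simp)
  have z3 := hz (-1, 1) (by simp)
  have z4 := hz (-1, 0) (by simp)
  have z5 := hz (0, -1) (by simp)
  have z6 := hz (1, -1) (by simp)
  have n1 : vec (hexagon a s b t) (0, -1) = -vec (hexagon a s b t) (0, 1) := vec_neg _ (0, 1)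
  have n2 : vec (hexagon a s b t) (-1, 0) = -vec (hexagon a s b t) (1, 0) := vec_neg _ (1, 0)
  have n3 : vec (hexagon a s b t) (1, -1) = -vec (hexagon a s b t) (-1, 1) := vec_neg _ (-1, 1)
  obtain ⟨m, n⟩ := p
  -- Asking for the inequality at both z and -z makes the property invariant under a change of sign
  -- of the lattice vector, as `cone_induction` requires.
  let Q : ℤ → ℤ → Prop := fun m n =>
    2 * ip (vec (hexagon a s b t) (m, n)) z <
      ip (vec (hexagon a s b t) (m, n)) (vec (hexagon a s b t) (m, n)) ∧
    2 * ip (vec (hexagon a s b t) (m, n)) (-z) <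
      ip (vec (hexagon a s b t) (m, n)) (vec (hexagon a s b t) (m, n))
  have key : Q m n := by
    refine cone_induction (Q := Q) ?_ ?_ ?_ ?_ hp
    · rintro m n ⟨h1, h2⟩
      have e : vec (hexagon a s b t) (-m, -n) = -vec (hexagon a s b t) (m, n) := vec_neg _ (m, n)
      simp only [Q, e, ip_neg_left, ip_neg_right, neg_neg] at h1 h2 ⊢
      exact ⟨h2, h1⟩
    · intro i j hi hj hij
      have e := vec_eq_add (hexagon a s b t) i j (1, 0) (0, 1)
      simp only [mul_one, mul_zero, add_zero, zero_add] at e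
      simp only [Q, e]
      refine ⟨cone_dirichlet g1 z1 z2 hi hj hij, cone_dirichlet g1 ?_ ?_ hi hj hij⟩
      · rw [n2] at z4; simpa [ip_neg_left, ip_neg_right] using z4
      · rw [n1] at z5; simpa [ip_neg_left, ip_neg_right] using z5
    · intro i j hi hj hij
      have e := vec_eq_add (hexagon a s b t) i j (0, 1) (-1, 1)
      simp only [mul_one, mul_zero, zero_add, mul_neg] at e
      simp only [Q, e]
      refine ⟨cone_dirichlet g2 z2 z3 hi hj hij, cone_dirichlet g2 ?_ ?_ hi hj hij⟩
      · rw [n1] at z5; simpa [ip_neg_left, ip_neg_right] using z5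
      · rw [n3] at z6; simpa [ip_neg_left, ip_neg_right] using z6
    · intro i j hi hj hij
      have e := vec_eq_add (hexagon a s b t) i j (-1, 1) (-1, 0)
      simp only [mul_one, mul_zero, add_zero, mul_neg, ← neg_add] at e
      simp only [Q, e]
      refine ⟨cone_dirichlet g3 z3 z4 hi hj hij, cone_dirichlet g3 ?_ ?_ hi hj hij⟩
      · rw [n3] at z6; simpa [ip_neg_left, ip_neg_right] using z6
      · rw [n2, ip_neg_left, ip_neg_left, ip_neg_right, ip_neg_right, neg_neg, neg_neg]
        exact z1
  exact key.1

/-- No vertex is nearer to one of the six neighbouring centres than to 0. Equality holds at the ends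
of the common edge, which lies on the perpendicular bisector. -/
theorem ip_vertices_le (h : Admissible a s b t) (i : Fin 6) :
    ∀ p ∈ ({(1, 0), (0, 1), (-1, 1), (-1, 0), (0, -1), (1, -1)} : Finset (ℤ × ℤ)),
      2 * ip (vec (hexagon a s b t) p) (hexagon a s b t i) ≤
        ip (vec (hexagon a s b t) p) (vec (hexagon a s b t) p) := by
  have h1 := h.circ₁
  have h2 := h.circ₂
  have h3 := h.lt₃
  have h4 := mul_pos h.pos₁ h.pos₂
  have ha := sub_pos.2 h.lt_one₁
  have hb := sub_pos.2 h.lt_one₂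
  have ha' : 0 < 1 + a := by linarith [h.neg_one_lt₁]
  have hb' : 0 < 1 + b := by linarith [h.neg_one_lt₂]
  have h5 := mul_pos ha hb'
  have h6 := mul_pos ha' hb
  intro p hp
  simp only [Finset.mem_insert, Finset.mem_singleton] at hp
  rcases hp with rfl | rfl | rfl | rfl | rfl | rfl <;> fin_cases i <;>
    simp [vec, hexagon, ip] <;> linarith

/-- An interior point can be moved a little in the direction n without leaving the set, and this
increases the functional. -/
theorem lt_of_mem_interior {S : Set Plane} {n x : Plane} {K : ℝ} (h : ∀ y ∈ S, ip n y ≤ K)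
    (hn : 0 < ip n n) (hx : x ∈ interior S) : ip n x < K := by
  have hc : ContinuousAt (fun c : ℝ => x + c • n) 0 := by fun_prop
  have h1 : ∀ᶠ c in nhds (0 : ℝ), x + c • n ∈ S :=
    hc.eventually (by simpa using mem_interior_iff_mem_nhds.1 hx)
  obtain ⟨c, hcS, hc0⟩ :=
    ((h1.filter_mono nhdsWithin_le_nhds).and (self_mem_nhdsWithin (s := Set.Ioi (0 : ℝ)))).exists
  have h2 := h _ hcS
  rw [ip_add_right, ip_smul_right] at h2
  have := mul_pos (Set.mem_Ioi.1 hc0) hn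
  linarith

/-- At z = 0 the strict Dirichlet inequality says that the lattice vector is not zero. Thus
`dirichlet_lt` reduces the linear independence of the generators to the six shortest cases. -/
theorem vec_pos (h : Admissible a s b t) {p : ℤ × ℤ} (hp : p ≠ 0) :
    0 < ip (vec (hexagon a s b t) p) (vec (hexagon a s b t) p) := by
  have h1 := h.circ₁
  have h2 := h.circ₂
  have h4 := mul_pos h.pos₁ h.pos₂
  have ha := sub_pos.2 h.lt_one₁
  have hb := sub_pos.2 h.lt_one₂
  have ha' : 0 < 1 + a := by linarith [h.neg_one_lt₁]
  have hb' : 0 < 1 + b := by linarith [h.neg_one_lt₂]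
  have h5 := mul_pos ha hb'
  have h6 := mul_pos ha' hb
  have := dirichlet_lt h (z := 0) (fun q hq => ?_) hp
  · simpa [ip_zero_right] using this
  · rw [ip_zero_right, mul_zero]
    simp only [Finset.mem_insert, Finset.mem_singleton] at hq
    rcases hq with rfl | rfl | rfl | rfl | rfl | rfl <;> simp [vec, hexagon, ip] <;> linarith

theorem interior_dirichlet (h : Admissible a s b t) {z : Plane}
    (hz : z ∈ interior (region (hexagon a s b t))) {p : ℤ × ℤ} (hp : p ≠ 0) :
    2 * ip (vec (hexagon a s b t) p) z <
      ip (vec (hexagon a s b t) p) (vec (hexagon a s b t) p) := by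
  refine dirichlet_lt h (fun q hq => ?_) hp
  have h0 : q ≠ 0 := by rintro rfl; revert hq; decide
  have := lt_of_mem_interior (fun y hy => ip_le_of_mem_region
    (n := vec (hexagon a s b t) q) (K := ip (vec (hexagon a s b t) q) (vec (hexagon a s b t) q) / 2)
    (fun i => by linarith [ip_vertices_le h i q hq]) hy) (vec_pos h h0) hz
  linarith

/-- By Cramer's rule a bound on the coordinates of a lattice vector bounds its indices. The
denominator (1 + a)t + (1 + b)s is four times the area of a fundamental parallelogram, and `M` is a
common bound for both indices. -/
theorem finite_vec_le (h : Admissible a s b t) (R : ℝ) :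
    {p : ℤ × ℤ | ‖vec (hexagon a s b t) p‖ ≤ R}.Finite := by
  have hs := h.pos₁
  have ht := h.pos₂
  have ha' : 0 < 1 + a := by linarith [h.neg_one_lt₁]
  have hb' : 0 < 1 + b := by linarith [h.neg_one_lt₂]
  have hΔ : 0 < (1 + a) * t + (1 + b) * s := by positivity
  set M : ℤ := ⌈R * (2 * (s + t) + 2 * (1 + a + (1 + b))) / ((1 + a) * t + (1 + b) * s)⌉
  refine ((Set.finite_Icc (-M) M).prod (Set.finite_Icc (-M) M)).subset ?_
  rintro ⟨i, j⟩ hp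
  rw [Set.mem_ofPred_eq] at hp
  have b0 : |vec (hexagon a s b t) (i, j) 0| ≤ R := (PiLp.norm_apply_le _ 0).trans hp
  have b1 : |vec (hexagon a s b t) (i, j) 1| ≤ R := (PiLp.norm_apply_le _ 1).trans hp
  have v0 : vec (hexagon a s b t) (i, j) 0 = i * ((1 + a) / 2) + j * ((1 + b) / 2) := by
    simp [vec, hexagon]; ring
  have v1 : vec (hexagon a s b t) (i, j) 1 = i * (-s / 2) + j * (t / 2) := by
    simp [vec, hexagon]; ring
  rw [v0] at b0
  rw [v1] at b1
  have hR : 0 ≤ R := (norm_nonneg _).trans hp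
  have key : ∀ n : ℤ, |(n : ℝ) * ((1 + a) * t + (1 + b) * s)| ≤
      R * (2 * (s + t) + 2 * (1 + a + (1 + b))) → n ∈ Set.Icc (-M) M := by
    intro n hn
    rw [abs_mul, abs_of_pos hΔ, ← le_div_iff₀ hΔ] at hn
    have h1 : |(n : ℝ)| ≤ M := hn.trans (Int.le_ceil _)
    rw [← Int.cast_abs, Int.cast_le] at h1
    exact abs_le.1 h1
  rw [abs_le] at b0 b1
  refine ⟨key i ?_, key j ?_⟩
  · have e : (i : ℝ) * ((1 + a) * t + (1 + b) * s) =
        2 * t * (i * ((1 + a) / 2) + j * ((1 + b) / 2)) -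
          2 * (1 + b) * (i * (-s / 2) + j * (t / 2)) := by ring
    rw [e, abs_le]
    constructor <;> nlinarith [mul_nonneg hR hs.le, mul_nonneg hR ha'.le]
  · have e : (j : ℝ) * ((1 + a) * t + (1 + b) * s) =
        2 * s * (i * ((1 + a) / 2) + j * ((1 + b) / 2)) +
          2 * (1 + a) * (i * (-s / 2) + j * (t / 2)) := by ring
    rw [e, abs_le]
    constructor <;> nlinarith [mul_nonneg hR ht.le, mul_nonneg hR hb'.le]

theorem hexagon_isTiling (h : Admissible a s b t) : IsTiling (hexagon a s b t) := by
  constructor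
  · refine Set.eq_univ_of_forall fun x => ?_
    -- A lattice point closest to x exists: those of norm above 2‖x‖ are further from x than 0 is,
    -- and only finitely many remain. Minimality is precisely the Dirichlet condition at x - p.
    obtain ⟨p, -, hp⟩ := Set.exists_min_image _ (fun p => ‖x - vec (hexagon a s b t) p‖)
      (finite_vec_le h (2 * ‖x‖)) ⟨0, by simp [vec]⟩
    have hmin : ∀ q, ‖x - vec (hexagon a s b t) p‖ ≤ ‖x - vec (hexagon a s b t) q‖ := by
      intro q
      by_cases hq : ‖vec (hexagon a s b t) q‖ ≤ 2 * ‖x‖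
      · exact hp q hq
      · have h1 := hp 0 (by simp [vec])
        have h2 := norm_sub_norm_le (vec (hexagon a s b t) q) x
        rw [norm_sub_rev] at h2
        simp only [vec, Prod.fst_zero, Int.cast_zero, zero_smul, Prod.snd_zero, add_zero,
          sub_zero] at h1
        exact h1.trans (by linarith)
    refine Set.mem_iUnion.2 ⟨p, mem_tile.2 (mem_region_of_dirichlet h fun q => ?_)⟩
    have h1 := hmin (p + q)
    have e : vec (hexagon a s b t) (p + q) = vec (hexagon a s b t) p + vec (hexagon a s b t) q := by
      have := vec_sub (hexagon a s b t) (p + q) p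
      rw [add_sub_cancel_left] at this
      rw [this]; abel
    rw [e, ← sub_sub] at h1
    have h2 := pow_le_pow_left₀ (norm_nonneg _) h1 2
    rw [norm_sq_eq_ip, norm_sq_eq_ip, ip_sub_left _ (vec _ q), ip_sub_right _ _ (vec _ q),
      ip_sub_right _ _ (vec _ q), ip_comm (x - vec _ p) (vec _ q)] at h2
    linarith
  · intro p q hpq
    rw [Set.disjoint_left]
    intro y hp hq
    have key : ∀ r, y ∈ interior (tile (hexagon a s b t) r) →
        y - vec (hexagon a s b t) r ∈ interior (region (hexagon a s b t)) := by
      intro r hr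
      have e : tile (hexagon a s b t) r =
          (Homeomorph.addLeft (vec (hexagon a s b t) r)) '' region (hexagon a s b t) := rfl
      rw [e, ← Homeomorph.image_interior] at hr
      obtain ⟨z, hz, rfl⟩ := hr
      simpa using hz
    -- A common interior point would be strictly closer to each of the two centres than to the
    -- other; the two inequalities contradict each other.
    have h1 := interior_dirichlet h (key p hp) (sub_ne_zero.2 hpq.symm)
    have h2 := interior_dirichlet h (key q hq) (sub_ne_zero.2 hpq)
    rw [vec_sub] at h1 h2
    generalize vec (hexagon a s b t) p = v at *
    generalize vec (hexagon a s b t) q = w at *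
    simp only [ip_sub_left, ip_sub_right] at h1 h2
    have c1 := ip_comm v w
    linarith

end
-- Distances between tiles, and sublattice colourings
section
variable {a s b t d : ℝ}

/-- The base tile and the tile `p` are at distance at least `d`. -/
def Far (P : Fin 6 → Plane) (d : ℝ) (p : ℤ × ℤ) : Prop :=
  ∀ x ∈ region P, ∀ y ∈ region P, d ≤ ‖vec P p + y - x‖

/-- Some points of the base tile and of the tile `p` are at distance at most `d`. -/
def Near (P : Fin 6 → Plane) (d : ℝ) (p : ℤ × ℤ) : Prop :=
  ∃ x ∈ region P, ∃ y ∈ region P, ‖vec P p + y - x‖ ≤ d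

theorem Far.neg {P : Fin 6 → Plane} {p : ℤ × ℤ} (h : Far P d p) : Far P d (-p) := by
  intro x hx y hy
  rw [vec_neg, ← norm_neg, show -(-vec P p + y - x) = vec P p + x - y by abel]
  exact h y hy x hx

theorem Far.le_tileDist {P : Fin 6 → Plane} {p q : ℤ × ℤ} (h : Far P d (q - p)) :
    d ≤ tileDist P p q := by
  have hne : ∀ r, (tile P r).Nonempty := fun r =>
    ⟨vec P r + P 0, mem_tile.2 (by simpa using vertex_mem_region P 0)⟩
  refine le_csInf ((hne p).image2 (hne q)) ?_
  rintro _ ⟨x, hx, y, hy, rfl⟩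
  have := h _ (mem_tile.1 hx) _ (mem_tile.1 hy)
  rwa [vec_sub, show vec P q - vec P p + (y - vec P q) - (x - vec P p) = y - x by abel,
    ← dist_eq_norm, dist_comm] at this

theorem Near.tileDist_le {P : Fin 6 → Plane} {p q : ℤ × ℤ} (h : Near P d (q - p)) :
    tileDist P p q ≤ d := by
  obtain ⟨x, hx, y, hy, hxy⟩ := h
  have hmem : dist (vec P p + x) (vec P q + y) ∈ Set.image2 dist (tile P p) (tile P q) :=
    ⟨_, mem_tile.2 (by simpa using hx), _, mem_tile.2 (by simpa using hy), rfl⟩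
  refine (csInf_le ⟨0, ?_⟩ hmem).trans ?_
  · rintro _ ⟨x, -, y, -, rfl⟩
    exact dist_nonneg
  · rwa [dist_comm, dist_eq_norm,
      show vec P q + y - (vec P p + x) = vec P q - vec P p + y - x by abel, ← vec_sub]

/-- Both x and -x belong to the region, whose diameter is 1. -/
theorem norm_le_of_mem_region (h : Admissible a s b t) {x : Plane}
    (hx : x ∈ region (hexagon a s b t)) : ‖x‖ ≤ 1 / 2 := by
  have h1 := Metric.dist_le_diam_of_mem
    (isBounded_convexHull.2 (Set.finite_range (hexagon a s b t)).isBounded) hx (neg_mem_region hx)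
  rw [← region, region_diam h,
    dist_eq_norm, sub_neg_eq_add, ← two_smul ℝ, norm_smul, Real.norm_two] at h1
  linarith

/-- Every tile lies in the disc of radius 1/2 about its centre, so centres at distance at least d +
1 give tiles at distance at least d. -/
theorem far_of_sq_le (h : Admissible a s b t) {p : ℤ × ℤ}
    (hp : (d + 1) ^ 2 ≤ ip (vec (hexagon a s b t) p) (vec (hexagon a s b t) p)) :
    Far (hexagon a s b t) d p := by
  intro x hx y hy
  rw [← norm_sq_eq_ip] at hp
  have h1 := le_of_sq_le_sq (by simpa using hp) (norm_nonneg _)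
  have h2 := norm_le_of_mem_region h hx
  have h3 := norm_le_of_mem_region h hy
  have h4 : ‖vec (hexagon a s b t) p‖ ≤ ‖vec (hexagon a s b t) p + y - x‖ + ‖x - y‖ := by
    simpa using norm_add_le (vec (hexagon a s b t) p + y - x) (x - y)
  have h5 := norm_sub_le x y
  linarith

/-- The lattice vectors of an acute cone whose generators are far. -/
theorem far_cone (h : Admissible a s b t) {p q : ℤ × ℤ}
    (hpq : 0 ≤ ip (vec (hexagon a s b t) p) (vec (hexagon a s b t) q))
    (hp : Far (hexagon a s b t) d p) (hq : Far (hexagon a s b t) d q)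
    (hp' : (d + 1) ^ 2 ≤ 4 * ip (vec (hexagon a s b t) p) (vec (hexagon a s b t) p))
    (hq' : (d + 1) ^ 2 ≤ 4 * ip (vec (hexagon a s b t) q) (vec (hexagon a s b t) q))
    (hpq' : (d + 1) ^ 2 ≤ ip (vec (hexagon a s b t) p) (vec (hexagon a s b t) p) +
      2 * ip (vec (hexagon a s b t) p) (vec (hexagon a s b t) q) +
      ip (vec (hexagon a s b t) q) (vec (hexagon a s b t) q))
    {i j : ℤ} (hi : 0 ≤ i) (hj : 0 ≤ j) (hij : 0 < i + j) :
    Far (hexagon a s b t) d (i * p.1 + j * q.1, i * p.2 + j * q.2) := by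
  -- Since ⟨u, v⟩ ≥ 0, a vector iu + jv of the cone other than u and v is at least as long as 2u, 2v
  -- or u + v, and these have length at least d + 1.
  have large : (i = 0 → 2 ≤ j) → (j = 0 → 2 ≤ i) →
      Far (hexagon a s b t) d (i * p.1 + j * q.1, i * p.2 + j * q.2) := by
    intro h1 h2
    apply far_of_sq_le h
    rw [vec_eq_add]
    simp only [ip_add_left, ip_add_right, ip_smul_left, ip_smul_right]
    rw [ip_comm (vec _ q) (vec _ p)]
    have p0 := ip_self_nonneg (vec (hexagon a s b t) p)
    have q0 := ip_self_nonneg (vec (hexagon a s b t) q)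
    rcases hi.eq_or_lt with rfl | hi
    · have : (2 : ℝ) ≤ j := by exact_mod_cast h1 rfl
      have : (4 : ℝ) ≤ j * j := by nlinarith
      simp
      nlinarith
    rcases hj.eq_or_lt with rfl | hj
    · have : (2 : ℝ) ≤ i := by exact_mod_cast h2 rfl
      have : (4 : ℝ) ≤ i * i := by nlinarith
      simp
      nlinarith
    have hi1 : (1 : ℝ) ≤ i := by exact_mod_cast hi
    have hj1 : (1 : ℝ) ≤ j := by exact_mod_cast hj
    have e1 : (1 : ℝ) ≤ i * i := by nlinarith
    have e2 : (1 : ℝ) ≤ i * j := by nlinarith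
    have e3 : (1 : ℝ) ≤ j * j := by nlinarith
    nlinarith [mul_le_mul_of_nonneg_right e1 p0, mul_le_mul_of_nonneg_right e2 hpq,
      mul_le_mul_of_nonneg_right e3 q0]
  by_cases h1 : i = 0 ∧ j = 1
  · simpa [h1.1, h1.2] using hq
  by_cases h2 : i = 1 ∧ j = 0
  · simpa [h2.1, h2.2] using hp
  exact large (by omega) (by omega)

/-- A colouring of `ℤ²` whose classes are the cosets of the lattice spanned by `p` and `q`. -/
theorem exists_colouring {k : ℕ} {p q : ℤ × ℤ} (hk : (k : ℤ) = p.1 * q.2 - q.1 * p.2)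
    (hk0 : 0 < k) : ∃ c : ℤ × ℤ → Fin k, Function.Surjective c ∧
      ∀ x y, c x = c y ↔ x - y ∈ AddSubgroup.closure {p, q} := by
  have hdet : p.1 * q.2 - q.1 * p.2 ≠ 0 := by omega
  have hli : LinearIndependent ℤ ![p, q] := by
    rw [LinearIndependent.pair_iff]
    intro m n h
    have h1 : m * p.1 + n * q.1 = 0 := congrArg Prod.fst h
    have h2 : m * p.2 + n * q.2 = 0 := congrArg Prod.snd h
    constructor
    · have : m * (p.1 * q.2 - q.1 * p.2) = 0 := by linear_combination q.2 * h1 - q.1 * h2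
      exact (mul_eq_zero.1 this).resolve_right hdet
    · have : n * (p.1 * q.2 - q.1 * p.2) = 0 := by linear_combination p.1 * h2 - p.2 * h1
      exact (mul_eq_zero.1 this).resolve_right hdet
  set N := Submodule.span ℤ (Set.range ![p, q])
  -- The index of the sublattice is the absolute value of the determinant of its basis, here k. The
  -- colour of a tile is its class in the quotient, numbered by `Fin k`.
  have hcard := Submodule.natAbs_det_basis_change (Module.Basis.finTwoProd ℤ) N
    (Module.Basis.span hli)
  have hb : ((↑) ∘ Module.Basis.span hli : Fin 2 → ℤ × ℤ) = ![p, q] := by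
    ext1 i
    exact congrArg _ (Module.Basis.span_apply hli i)
  rw [hb, Module.Basis.det_apply, Matrix.det_fin_two] at hcard
  simp only [Module.Basis.toMatrix_apply, Module.Basis.coe_finTwoProd_repr, Matrix.cons_val_zero,
    Matrix.cons_val_one] at hcard
  have hcard' : Nat.card ((ℤ × ℤ) ⧸ N) = k := by omega
  have : Finite ((ℤ × ℤ) ⧸ N) := Nat.finite_of_card_ne_zero (by omega)
  let e := Finite.equivFinOfCardEq hcard'
  refine ⟨fun x => e (N.mkQ x), e.surjective.comp N.mkQ_surjective, fun x y => ?_⟩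
  rw [e.apply_eq_iff_eq, Submodule.mkQ_apply, Submodule.mkQ_apply, Submodule.Quotient.eq]
  have hN : N = Submodule.span ℤ {p, q} := by
    simp only [N, Matrix.range_cons, Matrix.range_empty, Set.union_empty, Set.singleton_union]
  rw [hN, Submodule.mem_span_pair, AddSubgroup.mem_closure_pair]

/-- Conditions on the superbase `t₁`, `t₂`, `t₂ - t₁` under which the hexagon realises the
distance `d`. -/
theorem isColouredTiling_of (h : Admissible a s b t) {k : ℕ} {p q : ℤ × ℤ} (hk0 : 0 < k)
    (hk : (k : ℤ) = p.1 * q.2 - q.1 * p.2) {u v w : Plane} (hu : vec (hexagon a s b t) p = u)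
    (hv : vec (hexagon a s b t) q = v) (hw : vec (hexagon a s b t) (q - p) = w)
    (huv : 0 ≤ ip u v) (hvw : 0 ≤ ip v w) (hwu : ip w u ≤ 0)
    (fu : Far (hexagon a s b t) d p) (fv : Far (hexagon a s b t) d q)
    (fw : Far (hexagon a s b t) d (q - p))
    (u2 : (d + 1) ^ 2 ≤ 4 * ip u u) (v2 : (d + 1) ^ 2 ≤ 4 * ip v v)
    (w2 : (d + 1) ^ 2 ≤ 4 * ip w w)
    (uv2 : (d + 1) ^ 2 ≤ ip u u + 2 * ip u v + ip v v)
    (vw2 : (d + 1) ^ 2 ≤ ip v v + 2 * ip v w + ip w w)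
    (wu2 : (d + 1) ^ 2 ≤ ip w w - 2 * ip w u + ip u u)
    (near : Near (hexagon a s b t) d p ∨ Near (hexagon a s b t) d q ∨
      Near (hexagon a s b t) d (q - p)) :
    IsColouredTiling (hexagon a s b t) k p q d where
  diam := region_diam h
  tiling := hexagon_isTiling h
  index := hk
  colouring := by
    obtain ⟨c, hc, hc'⟩ := exists_colouring hk hk0
    refine ⟨c, hc, hc', fun x y hxy hcxy => Far.le_tileDist ?_⟩
    have hmem := (hc' y x).1 hcxy.symm
    obtain ⟨m, n, hmn⟩ := AddSubgroup.mem_closure_pair.1 hmem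
    have hmn0 : (m, n) ≠ (0 : ℤ × ℤ) := by
      intro h0
      rw [Prod.mk_eq_zero] at h0
      rw [h0.1, h0.2] at hmn
      exact hxy (sub_eq_zero.1 (by simpa using hmn.symm)).symm
    have e : y - x = (m * p.1 + n * q.1, m * p.2 + n * q.2) := by
      rw [← hmn]; ext <;> simp
    rw [e]
    have hu' : vec (hexagon a s b t) (-p) = -u := by rw [vec_neg, hu]
    refine cone_induction
      (Q := fun m n => Far (hexagon a s b t) d (m * p.1 + n * q.1, m * p.2 + n * q.2))
      ?_ ?_ ?_ ?_ hmn0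
    · intro m n hf
      have := hf.neg
      convert this using 1
      ext <;> simp <;> ring
    · intro i j hi hj hij
      exact far_cone h (by rwa [hu, hv]) fu fv (by rwa [hu]) (by rwa [hv]) (by rwa [hu, hv])
        hi hj hij
    · intro i j hi hj hij
      have := far_cone h (by rwa [hv, hw]) fv fw (by rwa [hv]) (by rwa [hw]) (by rwa [hv, hw])
        hi hj hij
      convert this using 2 <;> simp <;> ring
    · intro i j hi hj hij
      -- The third cone is spanned by w and -u, which is why the hypotheses ask for ⟨w, u⟩ ≤ 0 and
      -- why the sign of the mixed term changes in `wu2`.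
      have := far_cone h (p := q - p) (q := -p) (by rw [hw, hu', ip_neg_right]; linarith)
        fw fu.neg (by rwa [hw]) (by rw [hu', ip_neg_right, ip_neg_left, neg_neg]; exact u2)
        (by rw [hw, hu', ip_neg_right, ip_neg_right, ip_neg_left, neg_neg]; linarith)
        hi hj hij
      convert this using 2 <;> simp <;> ring
  attained := by
    have e1 : p - 0 = p := sub_zero p
    have e2 : q - 0 = q := sub_zero q
    apply le_antisymm
    · rcases near with hn | hn | hn
      · exact (min_le_left _ _).trans (Near.tileDist_le (by rwa [e1]))
      · exact (min_le_right _ _).trans ((min_le_left _ _).trans (Near.tileDist_le (by rwa [e2])))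
      · exact (min_le_right _ _).trans ((min_le_right _ _).trans hn.tileDist_le)
    · exact le_min (Far.le_tileDist (by rwa [e1]))
        (le_min (Far.le_tileDist (by rwa [e2])) fw.le_tileDist)

end
/-! ### Polynomials with integer coefficients, as lists -/

/-- The value at `x` of the polynomial with the given coefficients, constant term first. -/
def ev (x : ℝ) : List ℤ → ℝ
  | [] => 0
  | c :: p => c + x * ev x p

/-- Sum of polynomials. -/
def padd : List ℤ → List ℤ → List ℤ
  | [], q => q
  | c :: p, [] => c :: p
  | c :: p, e :: q => (c + e) :: padd p q

/-- Multiple of a polynomial. -/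
def psmul (c : ℤ) : List ℤ → List ℤ
  | [] => []
  | e :: p => (c * e) :: psmul c p

/-- Product of polynomials. -/
def pmul : List ℤ → List ℤ → List ℤ
  | [], _ => []
  | [c], q => psmul c q
  | c :: p, q => padd (psmul c q) (0 :: pmul p q)

/-- Difference of polynomials. -/
def psub (p q : List ℤ) : List ℤ := padd p (psmul (-1) q)

@[simp] theorem ev_nil (x : ℝ) : ev x [] = 0 := rfl

@[simp] theorem ev_cons (x : ℝ) (c : ℤ) (p : List ℤ) : ev x (c :: p) = c + x * ev x p := rfl

@[simp] theorem ev_padd (x : ℝ) (p q : List ℤ) : ev x (padd p q) = ev x p + ev x q := by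
  fun_induction padd p q with
  | case1 => simp
  | case2 => simp
  | case3 c p e q ih => simp [ih]; ring

@[simp] theorem ev_psmul (x : ℝ) (c : ℤ) (p : List ℤ) : ev x (psmul c p) = c * ev x p := by
  induction p with
  | nil => simp [psmul]
  | cons e p ih => simp [psmul, ih]; ring

@[simp] theorem ev_pmul (x : ℝ) (p q : List ℤ) : ev x (pmul p q) = ev x p * ev x q := by
  fun_induction pmul p q with
  | case1 => simp
  | case2 => simp
  | case3 q c p _ ih => simp [ih]; ring

@[simp] theorem ev_psub (x : ℝ) (p q : List ℤ) : ev x (psub p q) = ev x p - ev x q := by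
  simp [psub, sub_eq_add_neg]

/-! ### Signs of polynomial values at an algebraic number -/

/-- A polynomial and a rational interval `[l / E, h / E]` for one of its roots. -/
structure Isolation where
  m : List ℤ
  l : ℤ
  h : ℤ
  E : ℤ

/-- `x` is a root as described. -/
structure Isolation.Holds (I : Isolation) (x : ℝ) : Prop where
  nonneg : 0 ≤ x
  root : ev x I.m = 0
  pos : 0 < I.E
  lower : (I.l : ℝ) ≤ I.E * x
  upper : I.E * x ≤ I.h

/-- Is the integer nonnegative? -/
def isNonneg : ℤ → Bool
  | .ofNat _ => true
  | .negSucc _ => false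

/-- Is the integer zero? -/
def isZero : ℤ → Bool
  | .ofNat n => Nat.beq n 0
  | .negSucc _ => false

/-- The contribution of the higher terms to a lower bound. -/
def Isolation.times (I : Isolation) : ℤ → ℤ
  | .ofNat n => .ofNat n * I.l
  | .negSucc n => .negSucc n * I.h

/-- `E` times the value of the polynomial is at least this integer. -/
def Isolation.lb (I : Isolation) : List ℤ → ℤ
  | [] => 0
  | c :: p => c * I.E + I.times (I.lb p) / I.E

/-- Elimination of the constant term of `p` by means of `m`, and division by the variable. -/
def eliminate : List ℤ → List ℤ → List ℤ
  | e :: q, c :: p => bif isZero e then c :: p else psub (psmul e p) (psmul c q)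
  | _, p => p

/-- A sufficient test for the vanishing of the polynomial. -/
def Isolation.vanishes (I : Isolation) : ℕ → List ℤ → Bool
  | 0, p => p.all isZero
  | n + 1, p => p.all isZero || I.vanishes n (eliminate I.m p)

/-- A sufficient test for nonnegativity. -/
def Isolation.nn (I : Isolation) (p : List ℤ) : Bool :=
  isNonneg (I.lb p) || (isNonneg (I.lb (psmul (-1) p)) == false && I.vanishes 20 p)

/-- A sufficient test for positivity. -/
def Isolation.pos' (I : Isolation) (p : List ℤ) : Bool := isNonneg (I.lb p - 1)

/-- A sufficient test for vanishing. -/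
def Isolation.zz (I : Isolation) (p : List ℤ) : Bool := I.vanishes 20 p

theorem isNonneg_iff {n : ℤ} : isNonneg n = true ↔ 0 ≤ n := by
  cases n <;> simp [isNonneg]

theorem isZero_iff {n : ℤ} : isZero n = true ↔ n = 0 := by
  cases n with
  | ofNat n => rw [isZero, Nat.beq_eq]; simp
  | negSucc n => simp [isZero]

variable {I : Isolation} {x : ℝ}

theorem Isolation.Holds.times_le (H : I.Holds x) (n : ℤ) : (I.times n : ℝ) ≤ n * (I.E * x) := by
  cases n with
  | ofNat n =>
    rw [Isolation.times, Int.cast_mul]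
    exact mul_le_mul_of_nonneg_left H.lower (by simp)
  | negSucc n =>
    rw [Isolation.times, Int.cast_mul]
    exact mul_le_mul_of_nonpos_left H.upper (by exact_mod_cast (Int.negSucc_lt_zero n).le)

/-- Horner's scheme with one-sided rounding. The factor x is replaced by its lower or upper
approximation according to the sign of the partial result, and integer division rounds down. The
condition x ≥ 0 allows the inductive bound to be multiplied by x. -/
theorem Isolation.Holds.lb_le (H : I.Holds x) (p : List ℤ) : (I.lb p : ℝ) ≤ I.E * ev x p := by
  induction p with
  | nil => simp [Isolation.lb]
  | cons c p ih =>
    have hE : (0 : ℝ) < I.E := by exact_mod_cast H.pos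
    have key : (I.times (I.lb p) : ℝ) ≤ I.E * (I.E * x * ev x p) := by
      refine (H.times_le _).trans ?_
      have := mul_le_mul_of_nonneg_right ih (mul_nonneg hE.le H.nonneg)
      linarith
    have hdiv : ((I.times (I.lb p) / I.E : ℤ) : ℝ) ≤ I.E * x * ev x p := by
      rw [← mul_le_mul_iff_right₀ hE]
      refine le_trans ?_ key
      exact_mod_cast Int.mul_ediv_self_le (x := I.times (I.lb p)) H.pos.ne'
    rw [Isolation.lb, ev_cons, Int.cast_add, Int.cast_mul]
    linarith

theorem ev_eq_zero_of_all {p : List ℤ} (h : p.all isZero = true) : ev x p = 0 := by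
  induction p with
  | nil => rfl
  | cons c p ih =>
    rw [List.all_cons, Bool.and_eq_true, isZero_iff] at h
    rw [ev_cons, h.1, ih h.2]; simp

/-- With m = e + xq and p = c + xp', one has e·p - c·m = x(e·p' - c·q). At a root of m the left side
is e·p(x), and e ≠ 0. If p is a multiple of m, repeating this removes the cofactor term by term from
the bottom until zero is left. -/
theorem Isolation.Holds.of_eliminate (H : I.Holds x) {p : List ℤ}
    (h : ev x (eliminate I.m p) = 0) : ev x p = 0 := by
  have hr := H.root
  revert h hr
  fun_cases eliminate I.m p with
  | case1 => exact fun h _ => h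
  | case2 e q c p he =>
    intro h hr
    rw [ev_psub, ev_psmul, ev_psmul] at h
    have he : (e : ℝ) ≠ 0 := by
      rw [Int.cast_ne_zero, Ne, ← isZero_iff, he]; simp
    apply mul_left_cancel₀ he
    rw [ev_cons] at hr ⊢
    linear_combination c * hr + x * h
  | case3 => exact fun h _ => h

theorem Isolation.Holds.ev_eq_zero (H : I.Holds x) {n : ℕ} {p : List ℤ}
    (h : I.vanishes n p = true) : ev x p = 0 := by
  induction n generalizing p with
  | zero => exact ev_eq_zero_of_all h
  | succ n ih =>
    rw [Isolation.vanishes, Bool.or_eq_true] at h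
    rcases h with h | h
    · exact ev_eq_zero_of_all h
    · exact H.of_eliminate (ih h)

theorem Isolation.Holds.zz (H : I.Holds x) {p : List ℤ} (h : I.zz p = true) : ev x p = 0 :=
  H.ev_eq_zero h

/-- The interval bound cannot settle a value that is exactly zero at an irrational x; the
elimination covers this case. The guard on -p in `Isolation.nn` merely skips that attempt when p ≤ 0
is already certified, and plays no part in soundness. -/
theorem Isolation.Holds.nn (H : I.Holds x) {p : List ℤ} (h : I.nn p = true) : 0 ≤ ev x p := by
  rw [Isolation.nn, Bool.or_eq_true] at h
  rcases h with h | h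
  · have h1 : (0 : ℝ) ≤ I.lb p := by exact_mod_cast isNonneg_iff.1 h
    have hE : (0 : ℝ) < I.E := by exact_mod_cast H.pos
    exact (mul_nonneg_iff_of_pos_left hE).1 (h1.trans (H.lb_le p))
  · exact (H.ev_eq_zero (Bool.and_eq_true _ _ ▸ h).2).ge

theorem Isolation.Holds.pos' (H : I.Holds x) {p : List ℤ} (h : I.pos' p = true) :
    0 < ev x p := by
  have h2 : 0 < I.lb p := by have := isNonneg_iff.1 h; omega
  have h1 : (0 : ℝ) < I.lb p := by exact_mod_cast h2
  have hE : (0 : ℝ) < I.E := by exact_mod_cast H.pos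
  exact (mul_pos_iff_of_pos_left hE).1 (h1.trans_le (H.lb_le p))

/-! ### Extreme roots -/

/-- One step of the substitution `h / E + σ * y`, by Horner's rule. -/
def shiftStep (h E σ c : ℤ) : List ℤ × ℤ → List ℤ × ℤ
  | (q, e) => (padd [c * (E * e)] (padd (psmul h q) (0 :: psmul (E * σ) q)), E * e)

/-- The pair `(q, e)` with `q (y) = e * p (h / E + σ * y)`. -/
def shift (h E σ : ℤ) : List ℤ → List ℤ × ℤ
  | [] => ([], 1)
  | c :: p => shiftStep h E σ c (shift h E σ p)

/-- A test for a polynomial to be nonnegative on the nonnegative numbers, which allows for a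
negative linear coefficient. -/
def tailNonneg : List ℤ → Bool
  | b :: c :: d :: p => isNonneg b && isNonneg d && p.all isNonneg &&
      (isNonneg c || isNonneg (4 * b * d - c * c))
  | p => p.all isNonneg

/-- A test for a polynomial to be positive on the nonnegative numbers. -/
def headPos : List ℤ → Bool
  | [] => false
  | c :: p => isNonneg (c - 1) && tailNonneg p

/-- The constant coefficient is nonpositive. -/
def headNonpos : List ℤ → Bool
  | [] => true
  | c :: _ => isNonneg (-c)

theorem ev_shift {h E : ℤ} (hE : 0 < E) (σ : ℤ) (p : List ℤ) (y : ℝ) :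
    0 < (shift h E σ p).2 ∧
      ev y (shift h E σ p).1 = (shift h E σ p).2 * ev (h / E + σ * y) p := by
  induction p with
  | nil => simp [shift]
  | cons c p ih =>
    refine ⟨mul_pos hE ih.1, ?_⟩
    have hE' : (E : ℝ) ≠ 0 := by exact_mod_cast hE.ne'
    simp only [shift, shiftStep, ev_padd, ev_psmul, ev_cons, ev_nil, ih.2]
    push_cast
    field_simp
    ring

theorem ev_nonneg {p : List ℤ} (h : p.all isNonneg = true) {y : ℝ} (hy : 0 ≤ y) : 0 ≤ ev y p := by
  induction p with
  | nil => rfl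
  | cons c p ih =>
    rw [List.all_cons, Bool.and_eq_true, isNonneg_iff] at h
    have : (0 : ℝ) ≤ c := by exact_mod_cast h.1
    rw [ev_cons]
    exact add_nonneg this (mul_nonneg hy (ih h.2))

/-- Completing the square: 4b(b + cy + dy²) = (2b + cy)² + (4bd - c²)y². For b = 0 the second
alternative forces c = 0. -/
theorem quadratic_nonneg {b c d y : ℝ} (hb : 0 ≤ b) (hd : 0 ≤ d) (hy : 0 ≤ y)
    (h : 0 ≤ c ∨ 0 ≤ 4 * b * d - c * c) : 0 ≤ b + y * (c + y * d) := by
  rcases h with h | h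
  · positivity
  · rcases hb.eq_or_lt with rfl | hb
    · have : c = 0 := by nlinarith
      subst this
      positivity
    · have : 0 ≤ 4 * b * (b + y * (c + y * d)) := by
        have := mul_nonneg h (sq_nonneg y)
        nlinarith [sq_nonneg (2 * b + c * y)]
      exact (mul_nonneg_iff_of_pos_left (by positivity)).1 this

theorem ev_nonneg_of_tailNonneg {p : List ℤ} (h : tailNonneg p = true) {y : ℝ} (hy : 0 ≤ y) :
    0 ≤ ev y p := by
  revert h
  fun_cases tailNonneg p with
  | case1 b c d p =>
    intro h
    simp only [Bool.and_eq_true, Bool.or_eq_true, isNonneg_iff] at h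
    obtain ⟨⟨⟨hb, hd⟩, hp⟩, hc⟩ := h
    have hq : 0 ≤ (b : ℝ) + y * (c + y * d) :=
      quadratic_nonneg (by exact_mod_cast hb) (by exact_mod_cast hd) hy (by exact_mod_cast hc)
    have hr : 0 ≤ y * (y * (y * ev y p)) :=
      mul_nonneg hy (mul_nonneg hy (mul_nonneg hy (ev_nonneg hp hy)))
    simp only [ev_cons]
    linarith
  | case2 => exact fun h => ev_nonneg h hy

/-- Moving the origin to h/E and pointing the ray by σ = ±1 makes positivity on a whole half-line
visible in the coefficients. -/
theorem ev_shift_pos {h E σ : ℤ} (hE : 0 < E) {p : List ℤ}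
    (hp : headPos (shift h E σ p).1 = true) {y : ℝ} (hy : 0 ≤ y) : 0 < ev (h / E + σ * y) p := by
  obtain ⟨h1, h2⟩ := ev_shift (h := h) hE σ p y
  have h3 : 0 < ev y (shift h E σ p).1 := by
    revert hp
    cases (shift h E σ p).1 with
    | nil => simp [headPos]
    | cons c q =>
      intro hp
      rw [headPos, Bool.and_eq_true, isNonneg_iff] at hp
      have : (1 : ℝ) ≤ c := by exact_mod_cast (by omega : 1 ≤ c)
      have := mul_nonneg hy (ev_nonneg_of_tailNonneg hp.2 hy)
      rw [ev_cons]; linarith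
  rw [h2] at h3
  exact (mul_pos_iff_of_pos_left (by exact_mod_cast h1)).1 h3

theorem ev_shift_nonpos {h E σ : ℤ} (hE : 0 < E) {p : List ℤ}
    (hp : headNonpos (shift h E σ p).1 = true) : ev (h / E) p ≤ 0 := by
  obtain ⟨h1, h2⟩ := ev_shift (h := h) hE σ p 0
  rw [mul_zero, add_zero] at h2
  have h3 : ev 0 (shift h E σ p).1 ≤ 0 := by
    revert hp
    cases (shift h E σ p).1 with
    | nil => simp
    | cons c q =>
      intro hp
      rw [headNonpos, isNonneg_iff] at hp
      rw [ev_cons, zero_mul, add_zero]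
      exact_mod_cast (by omega : c ≤ 0)
  rw [h2] at h3
  have h4 : (0 : ℝ) < (shift h E σ p).2 := by exact_mod_cast h1
  by_contra! hc
  exact absurd (mul_pos h4 hc) (not_lt.2 h3)

theorem continuous_ev (p : List ℤ) : Continuous fun x => ev x p := by
  induction p with
  | nil => exact continuous_const
  | cons c p ih => exact continuous_const.add (continuous_id.mul ih)

/-- `[l / E, h / E]` contains the largest root of `p`. -/
def isolatesMax (l h E : ℤ) (p : List ℤ) : Bool :=
  isNonneg l && isNonneg (h - l) && isNonneg (E - 1) && headNonpos (shift l E 1 p).1 &&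
    headPos (shift h E 1 p).1

/-- `[l / E, h / E]` contains the smallest root of `p`. -/
def isolatesMin (l h E : ℤ) (p : List ℤ) : Bool :=
  isNonneg l && isNonneg (h - l) && isNonneg (E - 1) && headNonpos (shift h E 1 p).1 &&
    headPos (shift l E (-1) p).1

/-- The polynomial is positive from h/E on and nonpositive at l/E, so all roots lie below h/E and
the intermediate value theorem gives one in the interval. The zero set is closed, so its supremum is
a root and lies in the interval too. -/
theorem isGreatest_of_isolatesMax {l h E : ℤ} {p : List ℤ} (hp : isolatesMax l h E p = true) :
    IsGreatest {x | ev x p = 0} (sSup {x | ev x p = 0}) ∧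
      Isolation.Holds ⟨p, l, h, E⟩ (sSup {x | ev x p = 0}) := by
  simp only [isolatesMax, Bool.and_eq_true, isNonneg_iff] at hp
  obtain ⟨⟨⟨⟨h0, h1⟩, h2⟩, h3⟩, h4⟩ := hp
  have hE : 0 < E := by omega
  have hE' : (0 : ℝ) < E := by exact_mod_cast hE
  have hlh : (l : ℝ) / E ≤ h / E := by
    have : (l : ℝ) ≤ h := by exact_mod_cast (by omega : l ≤ h)
    gcongr
  have hpos : ∀ x : ℝ, h / E ≤ x → 0 < ev x p := fun x hx => by
    have := ev_shift_pos hE h4 (sub_nonneg.2 hx)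
    simpa using this
  have hbdd : (h : ℝ) / E ∈ upperBounds {x | ev x p = 0} := fun x hx => by
    by_contra! hc
    exact (hpos x hc.le).ne' hx
  obtain ⟨r, hr, hr0⟩ := intermediate_value_Icc hlh (continuous_ev p).continuousOn
    ⟨ev_shift_nonpos hE h3, (hpos _ le_rfl).le⟩
  have hclosed : IsClosed {x | ev x p = 0} := isClosed_eq (continuous_ev p) continuous_const
  have hmem := hclosed.csSup_mem ⟨r, hr0⟩ ⟨_, hbdd⟩
  have hle : (l : ℝ) / E ≤ sSup {x | ev x p = 0} := hr.1.trans (le_csSup ⟨_, hbdd⟩ hr0)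
  refine ⟨⟨hmem, fun x hx => le_csSup ⟨_, hbdd⟩ hx⟩, ?_, hmem, hE, ?_, ?_⟩
  · exact le_trans (div_nonneg (by exact_mod_cast h0) hE'.le) hle
  · rwa [div_le_iff₀' hE'] at hle
  · have := csSup_le ⟨r, hr0⟩ hbdd
    rwa [le_div_iff₀' hE'] at this

/-- The mirror image: positivity up to l/E, tested with σ = -1, and a nonpositive value at h/E. -/
theorem isLeast_of_isolatesMin {l h E : ℤ} {p : List ℤ} (hp : isolatesMin l h E p = true) :
    IsLeast {x | ev x p = 0} (sInf {x | ev x p = 0}) ∧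
      Isolation.Holds ⟨p, l, h, E⟩ (sInf {x | ev x p = 0}) := by
  simp only [isolatesMin, Bool.and_eq_true, isNonneg_iff] at hp
  obtain ⟨⟨⟨⟨h0, h1⟩, h2⟩, h3⟩, h4⟩ := hp
  have hE : 0 < E := by omega
  have hE' : (0 : ℝ) < E := by exact_mod_cast hE
  have hlh : (l : ℝ) / E ≤ h / E := by
    have : (l : ℝ) ≤ h := by exact_mod_cast (by omega : l ≤ h)
    gcongr
  have hpos : ∀ x : ℝ, x ≤ l / E → 0 < ev x p := fun x hx => by
    have := ev_shift_pos hE h4 (sub_nonneg.2 hx)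
    simpa using this
  have hbdd : (l : ℝ) / E ∈ lowerBounds {x | ev x p = 0} := fun x hx => by
    by_contra! hc
    exact (hpos x hc.le).ne' hx
  obtain ⟨r, hr, hr0⟩ := intermediate_value_Icc' hlh (continuous_ev p).continuousOn
    ⟨ev_shift_nonpos hE h3, (hpos _ le_rfl).le⟩
  have hclosed : IsClosed {x | ev x p = 0} := isClosed_eq (continuous_ev p) continuous_const
  have hmem := hclosed.csInf_mem ⟨r, hr0⟩ ⟨_, hbdd⟩
  have hle : (l : ℝ) / E ≤ sInf {x | ev x p = 0} := le_csInf ⟨r, hr0⟩ hbdd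
  refine ⟨⟨hmem, fun x hx => csInf_le ⟨_, hbdd⟩ hx⟩, ?_, hmem, hE, ?_, ?_⟩
  · exact le_trans (div_nonneg (by exact_mod_cast h0) hE'.le) hle
  · rwa [div_le_iff₀' hE'] at hle
  · have := (csInf_le ⟨_, hbdd⟩ hr0).trans hr.2
    rwa [le_div_iff₀' hE'] at this

/-! ### Distances of tiles in terms of Gram matrices -/

/-- The integral combination of the three vectors `2 • P i`, `i ≤ 2`. -/
noncomputable def lin (P : Fin 6 → Plane) (u : ℤ × ℤ × ℤ) : Plane :=
  (2 * u.1 : ℝ) • P 0 + (2 * u.2.1 : ℝ) • P 1 + (2 * u.2.2 : ℝ) • P 2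

/-- The scalar product of integral combinations of three unit vectors with cosines `a`, `b`, `c`. -/
def gram (a b c : ℝ) (u v : ℤ × ℤ × ℤ) : ℝ :=
  (u.1 * v.1 + u.2.1 * v.2.1 + u.2.2 * v.2.2 : ℤ) + (u.1 * v.2.1 + u.2.1 * v.1 : ℤ) * a +
    (u.2.1 * v.2.2 + u.2.2 * v.2.1 : ℤ) * b + (u.1 * v.2.2 + u.2.2 * v.1 : ℤ) * c

/-- Twice the lattice vector of a tile, as a combination of vertices. -/
def dbl (p : ℤ × ℤ) : ℤ × ℤ × ℤ := (p.1, p.1 + p.2, p.2)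

/-- Twice the vertices, consecutively. -/
def vertices : List (ℤ × ℤ × ℤ) :=
  [(1, 0, 0), (0, 1, 0), (0, 0, 1), (-1, 0, 0), (0, -1, 0), (0, 0, -1)]

/-- The sides, as pairs of vertices. -/
def sides : List ((ℤ × ℤ × ℤ) × (ℤ × ℤ × ℤ)) :=
  [((1, 0, 0), (0, 1, 0)), ((0, 1, 0), (0, 0, 1)), ((0, 0, 1), (-1, 0, 0)),
    ((-1, 0, 0), (0, -1, 0)), ((0, -1, 0), (0, 0, -1)), ((0, 0, -1), (1, 0, 0))]

section
variable {a s b t c d : ℝ}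

theorem lin_add (P : Fin 6 → Plane) (u v : ℤ × ℤ × ℤ) : lin P (u + v) = lin P u + lin P v := by
  simp only [lin, Prod.fst_add, Prod.snd_add]; push_cast; module

theorem lin_sub (P : Fin 6 → Plane) (u v : ℤ × ℤ × ℤ) : lin P (u - v) = lin P u - lin P v := by
  simp only [lin, Prod.fst_sub, Prod.snd_sub]; push_cast; module

/-- From here on the sines occur only through c = ab - st, so scalar products of integral
combinations of vertices are affine in a, b, c. -/
theorem ip_lin (h : Admissible a s b t) (hc : a * b - s * t = c) (u v : ℤ × ℤ × ℤ) :
    ip (lin (hexagon a s b t) u) (lin (hexagon a s b t) v) = gram a b c u v := by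
  subst hc
  simp only [lin, ip, hexagon, gram]
  simp
  linear_combination (u.1 * v.1 : ℝ) * h.circ₁ + (u.2.2 * v.2.2 : ℝ) * h.circ₂

theorem lin_dbl (p : ℤ × ℤ) :
    lin (hexagon a s b t) (dbl p) = (2 : ℝ) • vec (hexagon a s b t) p := by
  obtain ⟨g1, g2⟩ := hexagon_gen _ (rfl : hexagon a s b t = _)
  simp only [lin, vec, dbl, g1, g2]; push_cast; module

theorem two_smul_vertex (i : Fin 6) :
    ∃ u ∈ vertices, (2 : ℝ) • hexagon a s b t i = lin (hexagon a s b t) u := by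
  have e : ∀ i : Fin 6, hexagon a s b t (i + 3) = -hexagon a s b t i := hexagon_add_three
  have e3 : hexagon a s b t 3 = -hexagon a s b t 0 := e 0
  have e4 : hexagon a s b t 4 = -hexagon a s b t 1 := e 1
  have e5 : hexagon a s b t 5 = -hexagon a s b t 2 := e 2
  fin_cases i
  · exact ⟨(1, 0, 0), by simp [vertices], by simp [lin]⟩
  · exact ⟨(0, 1, 0), by simp [vertices], by simp [lin]⟩
  · exact ⟨(0, 0, 1), by simp [vertices], by simp [lin]⟩
  · exact ⟨(-1, 0, 0), by simp [vertices], by simp [lin, e3]⟩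
  · exact ⟨(0, -1, 0), by simp [vertices], by simp [lin, e4]⟩
  · exact ⟨(0, 0, -1), by simp [vertices], by simp [lin, e5]⟩

theorem half_lin_mem {u : ℤ × ℤ × ℤ} (hu : u ∈ vertices) :
    (1 / 2 : ℝ) • lin (hexagon a s b t) u ∈ region (hexagon a s b t) := by
  have h0 := vertex_mem_region (hexagon a s b t) 0
  have h1 := vertex_mem_region (hexagon a s b t) 1
  have h2 := vertex_mem_region (hexagon a s b t) 2
  simp only [vertices, List.mem_cons, List.not_mem_nil, or_false] at hu
  rcases hu with rfl | rfl | rfl | rfl | rfl | rfl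
  · simpa [lin, smul_smul] using h0
  · simpa [lin, smul_smul] using h1
  · simpa [lin, smul_smul] using h2
  · simpa [lin, smul_smul] using neg_mem_region h0
  · simpa [lin, smul_smul] using neg_mem_region h1
  · simpa [lin, smul_smul] using neg_mem_region h2

theorem sides_subset {e : (ℤ × ℤ × ℤ) × (ℤ × ℤ × ℤ)} (he : e ∈ sides) :
    e.1 ∈ vertices ∧ e.2 ∈ vertices := by
  revert e; decide

theorem gram_vertex {u : ℤ × ℤ × ℤ} (hu : u ∈ vertices) : gram a b c u u = 1 := by
  simp only [vertices, List.mem_cons, List.not_mem_nil, or_false] at hu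
  rcases hu with rfl | rfl | rfl | rfl | rfl | rfl <;> simp [gram]

theorem ip_sub_smul (u m : Plane) (l : ℝ) :
    ip (u - l • m) (u - l • m) = ip u u - 2 * l * ip u m + l * (l * ip m m) := by
  simp only [ip, PiLp.sub_apply, PiLp.smul_apply, smul_eq_mul]; ring

/-- Separation of two tiles by a strip orthogonal to `lin n`. -/
theorem far_of_strip (h : Admissible a s b t) (hc : a * b - s * t = c) {p : ℤ × ℤ}
    {n X : ℤ × ℤ × ℤ} (hX : ∀ v ∈ vertices, gram a b c n v ≤ gram a b c n X)
    (h0 : 0 ≤ gram a b c n (dbl p) - 2 * gram a b c n X)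
    (hd2 : 4 * d ^ 2 * gram a b c n n ≤ (gram a b c n (dbl p) - 2 * gram a b c n X) ^ 2)
    (hn : 0 < gram a b c n n) : Far (hexagon a s b t) d p := by
  intro x hx y hy
  set m := lin (hexagon a s b t) n
  have key : ∀ z ∈ region (hexagon a s b t), ip m z ≤ gram a b c n X / 2 := by
    intro z hz
    refine ip_le_of_mem_region (fun i => ?_) hz
    obtain ⟨u, hu, hui⟩ := two_smul_vertex (a := a) (s := s) (b := b) (t := t) i
    have h1 := hX u hu
    rw [← ip_lin h hc n u, ← hui, ip_smul_right] at h1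
    linarith
  have h1 := key x hx
  -- By central symmetry the same bound limits the other tile from the opposite side of the strip.
  have h2 := key (-y) (neg_mem_region hy)
  rw [ip_neg_right] at h2
  have h3 : ip m (vec (hexagon a s b t) p + y - x) =
      gram a b c n (dbl p) / 2 + ip m y - ip m x := by
    rw [ip_sub_right, ip_add_right, ← ip_lin h hc, lin_dbl, ip_smul_right]; ring
  have h4 := abs_real_inner_le_norm m (vec (hexagon a s b t) p + y - x)
  rw [inner_eq_ip, h3] at h4
  have h5 := le_trans (le_abs_self _) h4
  have hm : ‖m‖ ^ 2 = gram a b c n n := by rw [norm_sq_eq_ip, ip_lin h hc]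
  have hm0 : 0 < ‖m‖ := by
    rcases (norm_nonneg m).eq_or_lt with h0 | h0
    · rw [← h0] at hm; norm_num at hm; linarith
    · exact h0
  have h6 : 2 * d * ‖m‖ ≤ gram a b c n (dbl p) - 2 * gram a b c n X := by
    refine le_of_sq_le_sq ?_ h0
    rw [mul_pow, mul_pow, hm]; linarith
  refine le_of_mul_le_mul_left ?_ hm0
  nlinarith

/-- In doubled coordinates n = 2v - 2X points from the vertex of 2H represented by X to the centre
v. If H has its supporting line orthogonal to n at X, that vertex is the point of 2H nearest to v,
and the strip has width |n|/2. -/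
theorem far_of_vertex (h : Admissible a s b t) (hc : a * b - s * t = c) (hd : 0 ≤ d) {p : ℤ × ℤ}
    {X : ℤ × ℤ × ℤ} (hX : ∀ v ∈ vertices, gram a b c (dbl p - X - X) v ≤
      gram a b c (dbl p - X - X) X)
    (hd2 : 4 * d ^ 2 ≤ gram a b c (dbl p - X - X) (dbl p - X - X)) :
    Far (hexagon a s b t) d p := by
  set n := dbl p - X - X with hn
  have e : gram a b c n (dbl p) - 2 * gram a b c n X = gram a b c n n := by
    simp only [hn, gram, Prod.fst_sub, Prod.snd_sub]; push_cast; ring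
  -- For d = 0 the vector n may vanish and there is no strip; the claim is then trivial.
  rcases hd.eq_or_lt with rfl | hd'
  · exact fun x _ y _ => norm_nonneg _
  have hpos : 0 < gram a b c n n := by nlinarith
  refine far_of_strip h hc hX (by rw [e]; exact hpos.le) ?_ hpos
  rw [e, sq (gram a b c n n)]
  exact mul_le_mul_of_nonneg_right hd2 hpos.le

/-- With P = X/2 the vertex in question, P lies in the base tile and v - P in the other one; their
difference is (2v - 2X)/2. -/
theorem near_of_vertex (h : Admissible a s b t) (hc : a * b - s * t = c) (hd : 0 ≤ d) {p : ℤ × ℤ}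
    {X : ℤ × ℤ × ℤ} (hX : X ∈ vertices)
    (hd2 : gram a b c (dbl p - X - X) (dbl p - X - X) ≤ 4 * d ^ 2) :
    Near (hexagon a s b t) d p := by
  refine ⟨_, half_lin_mem hX, _, neg_mem_region (half_lin_mem hX), ?_⟩
  refine le_of_sq_le_sq ?_ hd
  rw [← ip_lin h hc, lin_sub, lin_sub, lin_dbl] at hd2
  have e : (2 : ℝ) • vec (hexagon a s b t) p - lin (hexagon a s b t) X - lin (hexagon a s b t) X =
    (2 : ℝ) • (vec (hexagon a s b t) p + -((1 / 2 : ℝ) • lin (hexagon a s b t) X) -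
      (1 / 2 : ℝ) • lin (hexagon a s b t) X) := by module
  rw [e, ip_smul_left, ip_smul_right] at hd2
  rw [norm_sq_eq_ip]
  linarith

/-- The point of 2H used is the foot of the perpendicular from v to a side; h0 and h1 place it
between the end points. Half of it and its negative give the points of the two tiles. As |X| = |Y|,
the normal of the side is X + Y. -/
theorem near_of_side (h : Admissible a s b t) (hc : a * b - s * t = c) (hd : 0 ≤ d) {p : ℤ × ℤ}
    {X Y : ℤ × ℤ × ℤ} (hX : X ∈ vertices) (hY : Y ∈ vertices)
    (h0 : 0 ≤ gram a b c (dbl p - X - X) (Y - X))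
    (h1 : gram a b c (dbl p - X - X) (Y - X) ≤ 2 * gram a b c (Y - X) (Y - X))
    (hn : 0 < gram a b c (X + Y) (X + Y)) (hm : 0 < gram a b c (Y - X) (Y - X))
    (hd2 : (gram a b c (X + Y) (dbl p) - 2 * gram a b c (X + Y) X) ^ 2 ≤
      4 * d ^ 2 * gram a b c (X + Y) (X + Y)) :
    Near (hexagon a s b t) d p := by
  have hXX := gram_vertex (a := a) (b := b) (c := c) hX
  have hYY := gram_vertex (a := a) (b := b) (c := c) hY
  have memX := half_lin_mem (a := a) (s := s) (b := b) (t := t) hX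
  have memY := half_lin_mem (a := a) (s := s) (b := b) (t := t) hY
  simp only [← ip_lin h hc, lin_sub, lin_add, lin_dbl] at *
  generalize lin (hexagon a s b t) X = A at *
  generalize lin (hexagon a s b t) Y = B at *
  set v := vec (hexagon a s b t) p with hv
  set l := ip ((2 : ℝ) • v - A - A) (B - A) / (2 * ip (B - A) (B - A)) with hl
  have l0 : 0 ≤ l := div_nonneg h0 (by linarith)
  have l1 : l ≤ 1 := by rw [hl, div_le_one (by linarith)]; exact h1
  have hmem : (1 - l) • (1 / 2 : ℝ) • A + l • (1 / 2 : ℝ) • B ∈ region (hexagon a s b t) :=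
    convex_convexHull ℝ (Set.range (hexagon a s b t)) memX memY (by linarith) l0 (by ring)
  refine ⟨_, hmem, _, neg_mem_region hmem, ?_⟩
  refine le_of_sq_le_sq ?_ hd
  have e : v + -((1 - l) • (1 / 2 : ℝ) • A + l • (1 / 2 : ℝ) • B) -
      ((1 - l) • (1 / 2 : ℝ) • A + l • (1 / 2 : ℝ) • B) = (v - A) - l • (B - A) := by module
  rw [norm_sq_eq_ip, e]
  have e2 : ip (A + B) ((2 : ℝ) • v) - 2 * ip (A + B) A = 2 * ip (A + B) (v - A) := by
    rw [ip_smul_right, ip_sub_right]; ring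
  have e3 : (2 : ℝ) • v - A - A = (2 : ℝ) • (v - A) := by module
  have hl' : l * ip (B - A) (B - A) = ip (v - A) (B - A) := by
    rw [hl, e3, ip_smul_left]; field_simp
  clear_value l
  rw [e2] at hd2
  have hperp : ip (A + B) (B - A) = 0 := by
    rw [ip_add_left, ip_sub_right, ip_sub_right, hXX, hYY, ip_comm B A]; ring
  -- Pythagoras for u = v - A in the orthogonal frame n = A + B, m = B - A, with denominators
  -- cleared. Removing the component along m leaves (n·u)²/|n|² for the squared distance.
  have lagrange : ip (v - A) (v - A) * (ip (A + B) (A + B) * ip (B - A) (B - A)) =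
      ip (A + B) (v - A) ^ 2 * ip (B - A) (B - A) +
      ip (v - A) (B - A) ^ 2 * ip (A + B) (A + B) := by
    generalize A + B = n at *
    generalize B - A = m at *
    generalize v - A = u at *
    simp only [ip] at hperp ⊢
    linear_combination ((u 0 * u 0 + u 1 * u 1) * (n 0 * m 0 + n 1 * m 1) -
      2 * (n 0 * u 0 + n 1 * u 1) * (u 0 * m 0 + u 1 * m 1)) * hperp
  have h6 : ip (v - A - l • (B - A)) (v - A - l • (B - A)) * ip (A + B) (A + B) =
      ip (A + B) (v - A) ^ 2 := by
    have : ip (v - A - l • (B - A)) (v - A - l • (B - A)) =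
        ip (v - A) (v - A) - l * (l * ip (B - A) (B - A)) := by
      rw [ip_sub_smul, ← hl']; ring
    rw [this, ← mul_left_inj' hm.ne']
    linear_combination lagrange - ip (A + B) (A + B) * (ip (v - A) (B - A) +
      l * ip (B - A) (B - A)) * hl'
  refine le_of_mul_le_mul_right ?_ hn
  linarith

/-- The hexagon realises the distance `√D` under conditions on its Gram matrix. -/
theorem exists_admissible (ha : a < 1) (ha' : -1 < a) (hb : b < 1) (hb' : -1 < b)
    (hab : 0 < a + b) (hdet : (1 - a ^ 2) * (1 - b ^ 2) = (a * b - c) ^ 2) (hc : c ≤ a * b) :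
    ∃ s t, Admissible a s b t ∧ a * b - s * t = c := by
  have h1 : 0 < 1 - a ^ 2 := by nlinarith
  have h2 : 0 < 1 - b ^ 2 := by nlinarith
  -- The hypothesis `hdet` says that the Gram determinant vanishes, so that the unit vectors fit in
  -- a plane. It gives st = |ab - c|, and c ≤ ab fixes the sign.
  refine ⟨√(1 - a ^ 2), √(1 - b ^ 2), ⟨?_, ?_, Real.sqrt_pos.2 h1, Real.sqrt_pos.2 h2, hab⟩, ?_⟩
  · rw [Real.sq_sqrt h1.le]; ring
  · rw [Real.sq_sqrt h2.le]; ring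
  · rw [← Real.sqrt_mul h1.le, hdet, Real.sqrt_sq (by linarith)]; ring

/-! ### The certificate checker -/

/-- A Gram matrix with entries `a / N`, `b / N`, `c / N`. -/
structure Gram where
  N : ℤ
  a : List ℤ
  b : List ℤ
  c : List ℤ

/-- `N` times the scalar product. -/
def Gram.form (γ : Gram) (u v : ℤ × ℤ × ℤ) : List ℤ :=
  padd [γ.N * (u.1 * v.1 + u.2.1 * v.2.1 + u.2.2 * v.2.2)]
    (padd (psmul (u.1 * v.2.1 + u.2.1 * v.1) γ.a)
      (padd (psmul (u.2.1 * v.2.2 + u.2.2 * v.2.1) γ.b)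
        (psmul (u.1 * v.2.2 + u.2.2 * v.1) γ.c)))

/-- The Gram matrix belongs to an admissible hexagon. -/
def Gram.check (γ : Gram) (I : Isolation) : Bool :=
  isNonneg (γ.N - 1) && I.pos' (psub [γ.N] γ.a) && I.pos' (padd [γ.N] γ.a) &&
    I.pos' (psub [γ.N] γ.b) && I.pos' (padd [γ.N] γ.b) && I.pos' (padd γ.a γ.b) &&
    I.nn (psub (pmul γ.a γ.b) (psmul γ.N γ.c)) &&
    I.zz (psub (pmul (psub [γ.N * γ.N] (pmul γ.a γ.a)) (psub [γ.N * γ.N] (pmul γ.b γ.b)))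
      (pmul (psub (pmul γ.a γ.b) (psmul γ.N γ.c)) (psub (pmul γ.a γ.b) (psmul γ.N γ.c))))

theorem ev_form {x : ℝ} {γ : Gram} (hN : γ.N ≠ 0) (u v : ℤ × ℤ × ℤ) :
    ev x (γ.form u v) =
      γ.N * gram (ev x γ.a / γ.N) (ev x γ.b / γ.N) (ev x γ.c / γ.N) u v := by
  have : (γ.N : ℝ) ≠ 0 := by exact_mod_cast hN
  simp only [Gram.form, gram, ev_padd, ev_psmul, ev_cons, ev_nil]
  push_cast
  field_simp
  ring

theorem Gram.exists_admissible {γ : Gram} {I : Isolation} {x : ℝ} (H : I.Holds x)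
    (h : γ.check I = true) :
    0 < γ.N ∧ ∃ s t, Admissible (ev x γ.a / γ.N) s (ev x γ.b / γ.N) t ∧
      ev x γ.a / γ.N * (ev x γ.b / γ.N) - s * t = ev x γ.c / γ.N := by
  simp only [Gram.check, Bool.and_eq_true, isNonneg_iff] at h
  obtain ⟨⟨⟨⟨⟨⟨⟨h0, h1⟩, h2⟩, h3⟩, h4⟩, h5⟩, h6⟩, h7⟩ := h
  replace h0 : 0 < γ.N := by omega
  have hN : (0 : ℝ) < γ.N := by exact_mod_cast h0
  replace h1 := H.pos' h1
  replace h2 := H.pos' h2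
  replace h3 := H.pos' h3
  replace h4 := H.pos' h4
  replace h5 := H.pos' h5
  replace h6 := H.nn h6
  replace h7 := H.zz h7
  simp only [ev_psub, ev_padd, ev_psmul, ev_pmul, ev_cons, ev_nil, mul_zero, add_zero] at *
  push_cast at h7
  refine ⟨h0, HexTiling.exists_admissible ?_ ?_ ?_ ?_ ?_ ?_ ?_⟩
  · rw [div_lt_one hN]; linarith
  · rw [lt_div_iff₀ hN]; linarith
  · rw [div_lt_one hN]; linarith
  · rw [lt_div_iff₀ hN]; linarith
  · rw [← add_div]; positivity
  · field_simp
    linear_combination h7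
  · rw [div_mul_div_comm, div_le_div_iff₀ hN (mul_pos hN hN)]
    nlinarith

end
/-- The data of a claimed distance: the Gram matrix, and `d² = D / M`. -/
structure Claim where
  γ : Gram
  D : List ℤ
  M : ℤ

/-- Test for `4 * d² ≤ |n|²`. -/
def Claim.sqLe (κ : Claim) (I : Isolation) (n : ℤ × ℤ × ℤ) : Bool :=
  I.nn (psub (psmul κ.M (κ.γ.form n n)) (psmul (4 * κ.γ.N) κ.D))

/-- Test for the hexagon to lie on one side of the line through `X` orthogonal to `n`. -/
def Claim.supports (κ : Claim) (I : Isolation) (n X : ℤ × ℤ × ℤ) : Bool :=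
  vertices.all fun v => I.nn (κ.γ.form n (X - v))

/-- Separation from the tile `p` at the vertex `X`. -/
def Claim.farVertex (κ : Claim) (I : Isolation) (p : ℤ × ℤ) (X : ℤ × ℤ × ℤ) : Bool :=
  κ.supports I (dbl p - X - X) X && κ.sqLe I (dbl p - X - X)

/-- Separation from the tile `p` along a side. -/
def Claim.farSide (κ : Claim) (I : Isolation) (p : ℤ × ℤ)
    (e : (ℤ × ℤ × ℤ) × (ℤ × ℤ × ℤ)) : Bool :=
  κ.supports I (e.1 + e.2) e.1 && I.nn (κ.γ.form (e.1 + e.2) (dbl p - e.1 - e.1)) &&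
    I.pos' (κ.γ.form (e.1 + e.2) (e.1 + e.2)) &&
    I.nn (psub (psmul κ.M (pmul (κ.γ.form (e.1 + e.2) (dbl p - e.1 - e.1))
      (κ.γ.form (e.1 + e.2) (dbl p - e.1 - e.1))))
      (psmul (4 * κ.γ.N) (pmul κ.D (κ.γ.form (e.1 + e.2) (e.1 + e.2)))))

/-- The tile `p` is at distance at least `d`. -/
def Claim.far (κ : Claim) (I : Isolation) (p : ℤ × ℤ) : Bool :=
  vertices.any (κ.farVertex I p) || sides.any (κ.farSide I p)

/-- The tile `p` is at distance at most `d` at the vertex `X`. -/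
def Claim.nearVertex (κ : Claim) (I : Isolation) (p : ℤ × ℤ) (X : ℤ × ℤ × ℤ) : Bool :=
  I.nn (psub (psmul (4 * κ.γ.N) κ.D)
    (psmul κ.M (κ.γ.form (dbl p - X - X) (dbl p - X - X))))

/-- The tile `p` is at distance at most `d` along a side. -/
def Claim.nearSide (κ : Claim) (I : Isolation) (p : ℤ × ℤ)
    (e : (ℤ × ℤ × ℤ) × (ℤ × ℤ × ℤ)) : Bool :=
  I.nn (κ.γ.form (dbl p - e.1 - e.1) (e.2 - e.1)) &&
    I.nn (psub (psmul 2 (κ.γ.form (e.2 - e.1) (e.2 - e.1)))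
      (κ.γ.form (dbl p - e.1 - e.1) (e.2 - e.1))) &&
    I.pos' (κ.γ.form (e.1 + e.2) (e.1 + e.2)) && I.pos' (κ.γ.form (e.2 - e.1) (e.2 - e.1)) &&
    I.nn (psub (psmul (4 * κ.γ.N) (pmul κ.D (κ.γ.form (e.1 + e.2) (e.1 + e.2))))
      (psmul κ.M (pmul (κ.γ.form (e.1 + e.2) (dbl p - e.1 - e.1))
        (κ.γ.form (e.1 + e.2) (dbl p - e.1 - e.1)))))

/-- The tile `p` is at distance at most `d`. -/
def Claim.near (κ : Claim) (I : Isolation) (p : ℤ × ℤ) : Bool :=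
  vertices.any (κ.nearVertex I p) || sides.any (κ.nearSide I p)

/-- `f * N * M * (|n|² / f - d² - 1)`. -/
def Claim.excess (κ : Claim) (f : ℤ) (n : ℤ × ℤ × ℤ) : List ℤ :=
  psub (psmul κ.M (κ.γ.form n n)) (padd (psmul (f * κ.γ.N) κ.D) [f * κ.γ.N * κ.M])

/-- Test for `f * (d + 1)² ≤ |n|²`. -/
def Claim.large (κ : Claim) (I : Isolation) (f : ℤ) (n : ℤ × ℤ × ℤ) : Bool :=
  I.nn (κ.excess f n) && I.nn (psub (pmul (κ.excess f n) (κ.excess f n))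
    (psmul (4 * f * f * κ.γ.N * κ.γ.N * κ.M) κ.D))

/-- Test for the hexagon with the given Gram matrix to realise the distance `d`. -/
def Claim.check (κ : Claim) (I : Isolation) (k : ℕ) (p q : ℤ × ℤ) : Bool :=
  isNonneg (k - 1 : ℤ) && isNonneg (κ.M - 1) &&
    isZero (p.1 * q.2 - q.1 * p.2 - k) && κ.γ.check I && I.nn κ.D &&
    I.nn (κ.γ.form (dbl p) (dbl q)) && I.nn (κ.γ.form (dbl q) (dbl (q - p))) &&
    I.nn (κ.γ.form (dbl (q - p)) (dbl (-p))) &&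
    κ.far I p && κ.far I q && κ.far I (q - p) &&
    κ.large I 1 (dbl p) && κ.large I 1 (dbl q) && κ.large I 1 (dbl (q - p)) &&
    κ.large I 4 (dbl p + dbl q) && κ.large I 4 (dbl q + dbl (q - p)) &&
    κ.large I 4 (dbl (q - p) - dbl p) &&
    (κ.near I p || κ.near I q || κ.near I (q - p))

section
variable {I : Isolation} {x a b c s t : ℝ} {κ : Claim}

theorem gram_sub_right (u v w : ℤ × ℤ × ℤ) :
    gram a b c u (v - w) = gram a b c u v - gram a b c u w := by
  simp only [gram, Prod.fst_sub, Prod.snd_sub]; push_cast; ring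

/-- The square of the claimed distance. -/
noncomputable def Claim.dSq (κ : Claim) (x : ℝ) : ℝ := ev x κ.D / κ.M

/-- The Gram matrix of the claim is that of the hexagon. -/
structure Claim.Fits (κ : Claim) (I : Isolation) (x a s b t c : ℝ) : Prop where
  holds : I.Holds x
  M_pos : 0 < κ.M
  N_pos : 0 < κ.γ.N
  adm : Admissible a s b t
  hc : a * b - s * t = c
  nonneg : 0 ≤ ev x κ.D
  form (u v : ℤ × ℤ × ℤ) : ev x (κ.γ.form u v) = κ.γ.N * gram a b c u v

namespace Claim.Fits
variable (F : κ.Fits I x a s b t c)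
include F

theorem N_pos' : (0 : ℝ) < κ.γ.N := by exact_mod_cast F.N_pos

theorem M_pos' : (0 : ℝ) < κ.M := by exact_mod_cast F.M_pos

theorem D_eq : ev x κ.D = κ.M * √(κ.dSq x) ^ 2 := by
  have h := F.M_pos'
  rw [Claim.dSq, Real.sq_sqrt (div_nonneg F.nonneg h.le)]
  field_simp

theorem gram_nonneg {u v : ℤ × ℤ × ℤ} (h : I.nn (κ.γ.form u v) = true) :
    0 ≤ gram a b c u v := by
  have := F.holds.nn h
  rw [F.form] at this
  exact (mul_nonneg_iff_of_pos_left F.N_pos').1 this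

theorem gram_pos {u v : ℤ × ℤ × ℤ} (h : I.pos' (κ.γ.form u v) = true) :
    0 < gram a b c u v := by
  have := F.holds.pos' h
  rw [F.form] at this
  exact (mul_pos_iff_of_pos_left F.N_pos').1 this

theorem sq_le {n : ℤ × ℤ × ℤ} (h : κ.sqLe I n = true) :
    4 * √(κ.dSq x) ^ 2 ≤ gram a b c n n := by
  have := F.holds.nn h
  simp only [ev_psub, ev_psmul, F.form, F.D_eq] at this
  push_cast at this
  have h2 := mul_pos F.M_pos' F.N_pos'
  refine le_of_mul_le_mul_left ?_ h2
  linarith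

theorem supported {n X : ℤ × ℤ × ℤ} (h : κ.supports I n X = true) :
    ∀ v ∈ vertices, gram a b c n v ≤ gram a b c n X := by
  intro v hv
  have := F.gram_nonneg (List.all_eq_true.1 h v hv)
  rw [gram_sub_right] at this
  linarith

theorem far {p : ℤ × ℤ} (h : κ.far I p = true) : Far (hexagon a s b t) √(κ.dSq x) p := by
  rw [Claim.far, Bool.or_eq_true, List.any_eq_true, List.any_eq_true] at h
  rcases h with ⟨X, hX, h⟩ | ⟨e, he, h⟩
  · rw [Claim.farVertex, Bool.and_eq_true] at h
    exact far_of_vertex F.adm F.hc (Real.sqrt_nonneg _) (F.supported h.1) (F.sq_le h.2)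
  · simp only [Claim.farSide, Bool.and_eq_true] at h
    obtain ⟨⟨⟨h1, h2⟩, h3⟩, h4⟩ := h
    replace h2 := F.gram_nonneg h2
    replace h4 := F.holds.nn h4
    have e1 : gram a b c (e.1 + e.2) (dbl p - e.1 - e.1) =
        gram a b c (e.1 + e.2) (dbl p) - 2 * gram a b c (e.1 + e.2) e.1 := by
      rw [gram_sub_right, gram_sub_right]; ring
    simp only [ev_psub, ev_psmul, ev_pmul, F.form, F.D_eq] at h4
    push_cast at h4
    rw [e1] at h2 h4
    refine far_of_strip F.adm F.hc (F.supported h1) h2 ?_ (F.gram_pos h3)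
    have h5 := mul_pos F.M_pos' (mul_pos F.N_pos' F.N_pos')
    refine le_of_mul_le_mul_left ?_ h5
    linarith

theorem near {p : ℤ × ℤ} (h : κ.near I p = true) : Near (hexagon a s b t) √(κ.dSq x) p := by
  rw [Claim.near, Bool.or_eq_true, List.any_eq_true, List.any_eq_true] at h
  rcases h with ⟨X, hX, h⟩ | ⟨e, he, h⟩
  · refine near_of_vertex F.adm F.hc (Real.sqrt_nonneg _) hX ?_
    replace h := F.holds.nn h
    simp only [ev_psub, ev_psmul, F.form, F.D_eq] at h
    push_cast at h
    have h2 := mul_pos F.M_pos' F.N_pos'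
    refine le_of_mul_le_mul_left ?_ h2
    linarith
  · simp only [Claim.nearSide, Bool.and_eq_true] at h
    obtain ⟨⟨⟨⟨h1, h2⟩, h3⟩, h4⟩, h5⟩ := h
    replace h2 := F.holds.nn h2
    replace h5 := F.holds.nn h5
    have e1 : gram a b c (e.1 + e.2) (dbl p - e.1 - e.1) =
        gram a b c (e.1 + e.2) (dbl p) - 2 * gram a b c (e.1 + e.2) e.1 := by
      rw [gram_sub_right, gram_sub_right]; ring
    simp only [ev_psub, ev_psmul, ev_pmul, F.form, F.D_eq] at h5 h2
    push_cast at h5 h2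
    rw [e1] at h5
    refine near_of_side F.adm F.hc (Real.sqrt_nonneg _) (sides_subset he).1 (sides_subset he).2
      (F.gram_nonneg h1) ?_ (F.gram_pos h3) (F.gram_pos h4) ?_
    · refine le_of_mul_le_mul_left ?_ F.N_pos'
      linarith
    · have h6 := mul_pos F.M_pos' (mul_pos F.N_pos' F.N_pos')
      refine le_of_mul_le_mul_left ?_ h6
      linarith

/-- Only d² is available in the field, not d. The inequality f(d + 1)² ≤ |n|² is written as 2fd ≤
|n|² - fd² - f and squared, given that the right side is nonnegative. -/
theorem large {f : ℤ} (hf : 0 < f) {n : ℤ × ℤ × ℤ} (h : κ.large I f n = true) :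
    f * (√(κ.dSq x) + 1) ^ 2 ≤ gram a b c n n := by
  rw [Claim.large, Bool.and_eq_true] at h
  have h1 := F.holds.nn h.1
  have h2 := F.holds.nn h.2
  simp only [Claim.excess, ev_psub, ev_psmul, ev_pmul, ev_padd, F.form, F.D_eq, ev_cons, ev_nil,
    mul_zero, add_zero] at h1 h2
  push_cast at h1 h2
  have hf' : (0 : ℝ) < f := by exact_mod_cast hf
  have hN := F.N_pos'
  have hM := F.M_pos'
  set d := √(κ.dSq x)
  have hd : 0 ≤ d := Real.sqrt_nonneg _
  have hle : 2 * f * κ.γ.N * κ.M * d ≤ κ.M * (κ.γ.N * gram a b c n n) -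
      (f * κ.γ.N * (κ.M * d ^ 2) + f * κ.γ.N * κ.M) := by
    refine le_of_sq_le_sq ?_ h1
    nlinarith
  refine le_of_mul_le_mul_left ?_ (mul_pos hM hN)
  nlinarith

end Claim.Fits

/-- Soundness of the checker: the Boolean tests supply exactly the hypotheses of
`isColouredTiling_of`. -/
theorem Claim.isColouredTiling (H : I.Holds x) {k : ℕ} {p q : ℤ × ℤ}
    (h : κ.check I k p q = true) : 0 < κ.γ.N ∧ ∃ s t,
      Admissible (ev x κ.γ.a / κ.γ.N) s (ev x κ.γ.b / κ.γ.N) t ∧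
      ev x κ.γ.a / κ.γ.N * (ev x κ.γ.b / κ.γ.N) - s * t = ev x κ.γ.c / κ.γ.N ∧
      IsColouredTiling (hexagon (ev x κ.γ.a / κ.γ.N) s (ev x κ.γ.b / κ.γ.N) t) k p q
        √(κ.dSq x) := by
  simp only [Claim.check, Bool.and_eq_true, Bool.or_eq_true, isNonneg_iff, isZero_iff] at h
  obtain ⟨⟨⟨⟨⟨⟨⟨⟨⟨⟨⟨⟨⟨⟨⟨⟨⟨hk, hM⟩, hdet⟩, hγ⟩, hD⟩, i1⟩, i2⟩, i3⟩, f1⟩, f2⟩, f3⟩, l1⟩, l2⟩, l3⟩, l4⟩,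
    l5⟩, l6⟩, hn⟩ := h
  obtain ⟨hN, s, t, hA, hc⟩ := Gram.exists_admissible H hγ
  have F : κ.Fits I x _ s _ t _ :=
    ⟨H, by omega, hN, hA, hc, H.nn hD, ev_form hN.ne'⟩
  refine ⟨hN, s, t, hA, hc, ?_⟩
  set P := hexagon (ev x κ.γ.a / κ.γ.N) s (ev x κ.γ.b / κ.γ.N) t
  have key : ∀ u v : ℤ × ℤ, gram (ev x κ.γ.a / κ.γ.N) (ev x κ.γ.b / κ.γ.N)
      (ev x κ.γ.c / κ.γ.N) (dbl u) (dbl v) = 4 * ip (vec P u) (vec P v) := by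
    intro u v
    rw [← ip_lin hA hc, lin_dbl, lin_dbl, ip_smul_left, ip_smul_right]; ring
  have key' : ∀ u v : ℤ × ℤ, gram (ev x κ.γ.a / κ.γ.N) (ev x κ.γ.b / κ.γ.N)
      (ev x κ.γ.c / κ.γ.N) (dbl u + dbl v) (dbl u + dbl v) =
      4 * (ip (vec P u) (vec P u) + 2 * ip (vec P u) (vec P v) + ip (vec P v) (vec P v)) := by
    intro u v
    rw [← ip_lin hA hc, lin_add, lin_dbl, lin_dbl, ← smul_add, ip_smul_left, ip_smul_right,
      ip_add_left, ip_add_right, ip_add_right, ip_comm (vec _ v) (vec _ u)]; ring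
  have key'' : ∀ u v : ℤ × ℤ, gram (ev x κ.γ.a / κ.γ.N) (ev x κ.γ.b / κ.γ.N)
      (ev x κ.γ.c / κ.γ.N) (dbl u - dbl v) (dbl u - dbl v) =
      4 * (ip (vec P u) (vec P u) - 2 * ip (vec P u) (vec P v) + ip (vec P v) (vec P v)) := by
    intro u v
    rw [← ip_lin hA hc, lin_sub, lin_dbl, lin_dbl, ← smul_sub, ip_smul_left, ip_smul_right,
      ip_sub_left, ip_sub_right, ip_sub_right, ip_comm (vec _ v) (vec _ u)]; ring
  replace i1 := F.gram_nonneg i1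
  replace i2 := F.gram_nonneg i2
  replace i3 := F.gram_nonneg i3
  -- `dbl` doubles lattice vectors, so these scalar products carry a factor 4. Hence f = 1 for the
  -- conditions on the doubled generators and f = 4 for those on plain sums of two of them.
  replace l1 := F.large one_pos l1
  replace l2 := F.large one_pos l2
  replace l3 := F.large one_pos l3
  replace l4 := F.large four_pos l4
  replace l5 := F.large four_pos l5
  replace l6 := F.large four_pos l6
  rw [key] at i1 i2 i3 l1 l2 l3
  rw [key'] at l4 l5
  rw [key''] at l6
  rw [vec_neg, ip_neg_right] at i3
  push_cast at l1 l2 l3 l4 l5 l6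
  exact isColouredTiling_of hA (by omega) (by omega) rfl rfl rfl (by linarith) (by linarith)
    (by linarith) (F.far f1) (F.far f2) (F.far f3) (by linarith) (by linarith) (by linarith)
    (by linarith) (by linarith) (by linarith) (by
      rcases hn with (h | h) | h
      · exact .inl (F.near h)
      · exact .inr (.inl (F.near h))
      · exact .inr (.inr (F.near h)))

end
/-! ### Algebraic numbers of the table -/

/-- The numeral `n`. -/
noncomputable def natLit : ℕ → ℝ
  | 0 => 0
  | 1 => 1
  | n + 2 => OfNat.ofNat (n + 2)

theorem natLit_eq (n : ℕ) : natLit n = n := by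
  match n with
  | 0 => simp [natLit]
  | 1 => simp [natLit]
  | n + 2 => rfl

/-- The denominator of the approximations of irrational numbers. -/
def precision : ℤ := 1000000000000000000000000000000

/-- A number generating the field of the entries of a row, and the numerator of its lower
approximation. -/
inductive Gen
  | zero
  | sqrt (n : ℕ) (l : ℤ)
  | cubic (n : ℕ) (l : ℤ)
  | quartic (a b c d e : ℕ) (l : ℤ)

/-- The coefficients of `cubic (n * (n + 1))`, for `p = n * (n - 1)`. -/
def cubicCoeff (p : ℤ) : List ℤ :=
  [p ^ 4, 2 * p ^ 2 * (p ^ 2 - 2 * p - 1), -3 * p ^ 4 - 8 * p ^ 3 + 2 * p ^ 2 + 4 * p + 1,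
    4 * p * (p ^ 2 + 3 * p + 1)]

/-- The value of the generator. -/
noncomputable def Gen.val : Gen → ℝ
  | zero => 0
  | sqrt n _ => √(natLit n)
  | cubic n _ => f (natLit (n * (n + 1)))
  | quartic a b c d e _ => quarticRoot (natLit a) (-natLit b) (natLit c) (-natLit d) (natLit e)

/-- The minimal polynomial and the isolating interval of the generator. -/
def Gen.isolation : Gen → Isolation
  | zero => ⟨[0, 1], 0, 0, 1⟩
  | sqrt n l => ⟨[-n, 0, 1], l, l + 1, precision⟩
  | cubic n l => ⟨cubicCoeff (n * (n - 1)), l, l + 1, precision⟩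
  | quartic a b c d e l => ⟨[e, -d, c, -b, a], l, l + 1, precision⟩

/-- The test of the isolating interval. -/
def Gen.check : Gen → Bool
  | zero => true
  | sqrt n l => isNonneg l && isNonneg (n * precision * precision - l * l) &&
      isNonneg ((l + 1) * (l + 1) - n * precision * precision)
  | cubic n l => isolatesMax l (l + 1) precision (cubicCoeff (n * (n - 1)))
  | quartic a b c d e l => isolatesMin l (l + 1) precision [e, -d, c, -b, a]

/-- For k = n(n + 1) the radicand 4k + 1 is (2n + 1)², so p = n(n - 1) and the coefficients are
integers. -/
theorem cubic_eq_ev (n : ℕ) (x : ℝ) :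
    cubic (n * (n + 1)) x = ev x (cubicCoeff (n * (n - 1))) := by
  have h : √(4 * ((n : ℝ) * (n + 1)) + 1) = 2 * n + 1 := by
    rw [show 4 * ((n : ℝ) * (n + 1)) + 1 = (2 * n + 1) ^ 2 by ring]
    exact Real.sqrt_sq (by positivity)
  simp only [cubic, h, cubicCoeff, ev_cons, ev_nil]
  push_cast
  ring

theorem f_eq_sSup (n : ℕ) : f (n * (n + 1)) = sSup {x | ev x (cubicCoeff (n * (n - 1))) = 0} := by
  simp only [f, cubic_eq_ev]

theorem isGreatest_f {n : ℕ} {l : ℤ} (h : (Gen.cubic n l).check = true) :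
    IsGreatest {x | cubic (n * (n + 1)) x = 0} (f (n * (n + 1))) := by
  simp only [f_eq_sSup, cubic_eq_ev]
  exact (isGreatest_of_isolatesMax h).1

theorem quartic_eq_ev (a b c d e : ℕ) (x : ℝ) :
    natLit a * x ^ 4 + -natLit b * x ^ 3 + natLit c * x ^ 2 + -natLit d * x + natLit e =
      ev x [e, -d, c, -b, a] := by
  simp only [natLit_eq, ev_cons, ev_nil]
  push_cast
  ring

theorem isLeast_quarticRoot {a b c d e : ℕ} {l : ℤ}
    (h : (Gen.quartic a b c d e l).check = true) :
    IsLeast {x | natLit a * x ^ 4 + -natLit b * x ^ 3 + natLit c * x ^ 2 + -natLit d * x +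
      natLit e = 0} (quarticRoot (natLit a) (-natLit b) (natLit c) (-natLit d) (natLit e)) := by
  simp only [quarticRoot, quartic_eq_ev]
  exact (isLeast_of_isolatesMin h).1

/-- For a square root the test amounts to l² ≤ 10⁶⁰ n ≤ (l + 1)²; the cubic and quartic generators
rest on the isolation of extreme roots. -/
theorem Gen.holds {g : Gen} (h : g.check = true) : g.isolation.Holds g.val := by
  have hp : (0 : ℤ) < precision := by norm_num [precision]
  have hp' : (0 : ℝ) < precision := by exact_mod_cast hp
  cases g with
  | zero => exact ⟨le_rfl, by simp [Gen.isolation, Gen.val], one_pos, by simp [Gen.isolation, Gen.val],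
      by simp [Gen.isolation, Gen.val]⟩
  | sqrt n l =>
    simp only [Gen.check, Bool.and_eq_true, isNonneg_iff] at h
    obtain ⟨⟨h0, h1⟩, h2⟩ := h
    have h0' : (0 : ℝ) ≤ l := by exact_mod_cast h0
    have h1' : (0 : ℝ) ≤ n * precision * precision - l * l := by exact_mod_cast h1
    have h2' : (0 : ℝ) ≤ (l + 1) * (l + 1) - n * precision * precision := by exact_mod_cast h2
    have hs : √(n : ℝ) ^ 2 = n := Real.sq_sqrt (Nat.cast_nonneg n)
    refine ⟨Real.sqrt_nonneg _, ?_, hp, ?_, ?_⟩ <;> simp only [Gen.isolation, Gen.val, natLit_eq]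
    · simp [← sq, hs]
    · refine le_of_sq_le_sq ?_ (by positivity)
      rw [mul_pow, hs]; linarith
    · push_cast
      refine le_of_sq_le_sq ?_ (by positivity)
      rw [mul_pow, hs]; linarith
  | cubic n l =>
    have := (isGreatest_of_isolatesMax h).2
    rw [← f_eq_sSup] at this
    simp only [Gen.val, natLit_eq]
    push_cast
    exact this
  | quartic a b c d e l =>
    have := (isLeast_of_isolatesMin h).2
    simp only [Gen.val, quarticRoot, quartic_eq_ev]
    exact this

/-- Expressions for the entries of the table. -/
inductive Num
  | lit (n : ℕ)
  | gen
  | add (x y : Num)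
  | sub (x y : Num)
  | mul (x y : Num)
  | div (x : Num) (n : ℕ)
  | sq (x : Num)

namespace Num

/-- The value of an expression. -/
noncomputable def val (x : ℝ) : Num → ℝ
  | lit n => natLit n
  | gen => x
  | add a b => val x a + val x b
  | sub a b => val x a - val x b
  | mul a b => val x a * val x b
  | div a n => val x a / natLit n
  | sq a => val x a ^ 2

/-- The numerator, a polynomial in the generator. -/
def num : Num → List ℤ × ℕ
  | lit n => ([n], 1)
  | gen => ([0, 1], 1)
  | add a b => (padd (psmul b.num.2 a.num.1) (psmul a.num.2 b.num.1), a.num.2 * b.num.2)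
  | sub a b => (psub (psmul b.num.2 a.num.1) (psmul a.num.2 b.num.1), a.num.2 * b.num.2)
  | mul a b => (pmul a.num.1 b.num.1, a.num.2 * b.num.2)
  | div a n => (a.num.1, a.num.2 * n)
  | sq a => (pmul a.num.1 a.num.1, a.num.2 * a.num.2)

/-- The notation lets the entries be typed as they appear in the table. Division is meant for
literal denominators only, which `toNat` reads off. -/
instance (n : ℕ) : OfNat Num n := ⟨lit n⟩
instance : Add Num := ⟨add⟩
instance : Sub Num := ⟨sub⟩
instance : Mul Num := ⟨mul⟩

/-- The number of a numeral. -/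
def toNat : Num → ℕ
  | lit n => n
  | _ => 0

instance : Div Num := ⟨fun x y => div x y.toNat⟩

theorem val_eq {x : ℝ} {a : Num} (h : a.num.2 ≠ 0) : a.val x = ev x a.num.1 / a.num.2 := by
  induction a with
  | lit n => simp [val, num, natLit_eq]
  | gen => simp [val, num]
  | add a b iha ihb =>
    have h' := mul_ne_zero_iff.1 h
    have ha : (a.num.2 : ℝ) ≠ 0 := by exact_mod_cast h'.1
    have hb : (b.num.2 : ℝ) ≠ 0 := by exact_mod_cast h'.2
    simp only [val, num, iha h'.1, ihb h'.2, ev_padd, ev_psmul]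
    push_cast
    field_simp
  | sub a b iha ihb =>
    have h' := mul_ne_zero_iff.1 h
    have ha : (a.num.2 : ℝ) ≠ 0 := by exact_mod_cast h'.1
    have hb : (b.num.2 : ℝ) ≠ 0 := by exact_mod_cast h'.2
    simp only [val, num, iha h'.1, ihb h'.2, ev_psub, ev_psmul]
    push_cast
    field_simp
  | mul a b iha ihb =>
    have h' := mul_ne_zero_iff.1 h
    simp only [val, num, iha h'.1, ihb h'.2, ev_pmul]
    push_cast
    rw [div_mul_div_comm]
  | div a n iha =>
    have h' := mul_ne_zero_iff.1 h
    simp only [val, num, iha h'.1, natLit_eq]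
    push_cast
    rw [div_div]
  | sq a iha =>
    have h' := mul_ne_zero_iff.1 h
    simp only [val, num, iha h'.1, ev_pmul]
    push_cast
    rw [div_pow, pow_two, pow_two]

end Num

/-! ### Cells -/

/-- The class of a cell, with a parameter or a Gram matrix. -/
inductive Shape
  | regular
  | semiRegular (r : Num)
  | rectilinear (γ : Gram)

/-- A cell: the class, the generator of the field, and `d²`. -/
structure Cell where
  shape : Shape
  gen : Gen
  sq : Num

namespace Cell

/-- The class of hexagons. -/
def cls (C : Cell) : (Fin 6 → Plane) → Prop :=
  match C.shape with
  | .regular => IsRegular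
  | .semiRegular r => IsSemiRegular (r.val C.gen.val)
  | .rectilinear _ => IsRectilinear

/-- The number `d²`. -/
noncomputable def val (C : Cell) : ℝ := C.sq.val C.gen.val

/-- The Gram matrix of a semiregular hexagon with parameter `R / m`. -/
def semiGram (R : List ℤ) (m : ℤ) : Gram :=
  ⟨m * m, psub [m * m] (psmul 2 (pmul R R)), psmul m R, psmul (-m) R⟩

/-- The Gram matrix of the hexagon. -/
def gram (C : Cell) : Gram :=
  match C.shape with
  | .regular => ⟨2, [1], [1], [-1]⟩
  | .semiRegular r => semiGram r.num.1 r.num.2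
  | .rectilinear γ => γ

/-- The claimed distance. -/
def claim (C : Cell) : Claim := ⟨C.gram, C.sq.num.1, C.sq.num.2⟩

/-- The test of the parameter. -/
def shapeCheck (C : Cell) : Bool :=
  match C.shape with
  | .semiRegular r => Nat.ble 1 r.num.2 && C.gen.isolation.nn r.num.1
  | _ => true

/-- The test for the cell to be realised with the tiles `p`, `q`. -/
def check (C : Cell) (k : ℕ) (p q : ℤ × ℤ) : Bool :=
  C.gen.check && Nat.ble 1 C.sq.num.2 && C.shapeCheck && C.claim.check C.gen.isolation k p q

/-- One hexagon serves both purposes: the checker yields the colouring, and the special shape of the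
Gram matrix puts the hexagon in the class of the cell. -/
theorem exists_isColouredTiling {C : Cell} {k : ℕ} {p q : ℤ × ℤ} (h : C.check k p q = true) :
    ∃ P, C.cls P ∧ IsColouredTiling P k p q √C.val := by
  simp only [check, Bool.and_eq_true, Nat.ble_eq] at h
  obtain ⟨⟨⟨h1, h2⟩, h3⟩, h4⟩ := h
  have H := Gen.holds h1
  obtain ⟨hN, s, t, hA, hc, hT⟩ := Claim.isColouredTiling H h4
  have hd : C.claim.dSq C.gen.val = C.val := by
    rw [val, Num.val_eq (by omega), Claim.dSq]; rfl
  rw [hd] at hT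
  refine ⟨_, ?_, hT⟩
  have hN' : (0 : ℝ) < C.gram.N := by exact_mod_cast hN
  change 0 < C.gram.N at hN
  change Admissible (ev C.gen.val C.gram.a / C.gram.N) s (ev C.gen.val C.gram.b / C.gram.N) t at hA
  change ev C.gen.val C.gram.a / C.gram.N * (ev C.gen.val C.gram.b / C.gram.N) - s * t =
    ev C.gen.val C.gram.c / C.gram.N at hc
  change C.cls (hexagon (ev C.gen.val C.gram.a / C.gram.N) s (ev C.gen.val C.gram.b / C.gram.N) t)
  obtain ⟨sh, g, D⟩ := C
  cases sh with
  | regular =>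
    -- The cosines are 1/2, 1/2, -1/2, and ab - st = -1/2 gives st = 3/4.
    simp only [gram, ev_cons, ev_nil] at hA hc ⊢
    norm_num at hA hc ⊢
    refine hexagon_regular hA rfl rfl (by linarith)
  | rectilinear γ => exact hexagon_rectilinear hA
  | semiRegular r =>
    simp only [shapeCheck, Bool.and_eq_true, Nat.ble_eq] at h3
    have hr : r.val g.val = ev g.val r.num.1 / r.num.2 := Num.val_eq (by omega)
    have hm : (0 : ℝ) < r.num.2 := by exact_mod_cast h3.1
    have hr0 := H.nn h3.2
    simp only [gram, semiGram, ev_cons, ev_nil, ev_psub, ev_psmul, ev_pmul] at hA hc ⊢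
    simp only [cls]
    push_cast at hA hc ⊢
    rw [hr]
    refine hexagon_semiRegular hA (div_nonneg hr0 hm.le) ?_ ?_ ?_
    · field_simp; ring
    · field_simp
    · rw [hc]; field_simp

/-- `S` times the value of the cell is at least this integer. -/
def lower (S : ℤ) (C : Cell) : ℤ :=
  S * C.gen.isolation.lb C.sq.num.1 / (C.sq.num.2 * C.gen.isolation.E)

/-- `S` times the value of the cell is at most this integer. -/
def upper (S : ℤ) (C : Cell) : ℤ :=
  -(S * C.gen.isolation.lb (psmul (-1) C.sq.num.1) / (C.sq.num.2 * C.gen.isolation.E))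

end Cell

/-! ### Rows of the table with their certificates -/

/-- A row of the table, with the tiles for the realisation of the first cell where there is a
second one. -/
structure Datum where
  k : ℕ
  t₁ : ℤ × ℤ
  t₂ : ℤ × ℤ
  regular : Option Num
  semiRegular : Option (Gen × Num × Num)
  rectilinear : Option (Gen × Num × Gram)
  first : (ℤ × ℤ) × (ℤ × ℤ)
  approx : ℕ
  digits : ℕ
  bold : Bool

namespace Datum

/-- A row with a regular hexagon. -/
def reg (k : ℕ) (t₁ t₂ : ℤ × ℤ) (D : Num) (approx digits : ℕ) (bold : Bool) : Datum :=
  ⟨k, t₁, t₂, some D, none, none, (t₁, t₂), approx, digits, bold⟩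

/-- A row with a semiregular hexagon with parameter `r`. -/
def semi (k : ℕ) (t₁ t₂ : ℤ × ℤ) (g : Gen) (D r : Num) (approx digits : ℕ) (bold : Bool) : Datum :=
  ⟨k, t₁, t₂, none, some (g, D, r), none, (t₁, t₂), approx, digits, bold⟩

/-- Add to a row a rectilinear hexagon. -/
def rect (R : Datum) (t₁ t₂ : ℤ × ℤ) (g : Gen) (D : Num) (N : ℤ) (a b c : List ℤ) : Datum :=
  { R with rectilinear := some (g, D, ⟨N, a, b, c⟩), first := (t₁, t₂) }

/-- The cells of a row. -/
def cells (R : Datum) : List Cell :=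
  (R.regular.map fun D => ⟨.regular, .zero, D⟩).toList ++
    (R.semiRegular.map fun (g, D, r) => ⟨.semiRegular r, g, D⟩).toList ++
    (R.rectilinear.map fun (g, D, γ) => ⟨.rectilinear γ, g, D⟩).toList

/-- The row in the form of the table. -/
noncomputable def toRow (R : Datum) : Row where
  k := R.k
  t₁ := R.t₁
  t₂ := R.t₂
  regular := R.regular.map fun D => D.val 0
  semiRegular := R.semiRegular.map fun (g, D, r) => (D.val g.val, r.val g.val)
  rectilinear := R.rectilinear.map fun (g, D, _) => D.val g.val
  approx := OfScientific.ofScientific R.approx true R.digits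
  digits := R.digits
  bold := R.bold

end Datum
/-- The rows of `tableA`. -/
def dataA : List Datum := [
  .reg 3 (2, -1) (1, 1) (.sq (1 / 2)) 500000 6 true,
  .reg 4 (2, 0) (0, 2) (3 / 4) 866025 6 true,
  .semi 5 (3, -1) (2, 1) .zero (.sq (5 / 6)) (5 / 6) 833333 6 false,
  (Datum.semi 6 (3, 0) (0, 2) (.sqrt 33 5744562646538028659850611468218) ((17 + .gen) / 24) ((.gen - 3) / 12) 992076 6 true
    -- The index pairs given to `rect` are a basis for realising the first cell; the tabulated pair
    -- belongs to the last cell. The final four arguments are N and the polynomials Na, Nb, Nc in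
    -- the generator.
    ).rect (-2, 3) (-2, 0) (.cubic 2 984215774235924576165424144982) .gen 4 [-4, 2] [-4, 8] [8, -11],
  .reg 7 (3, -1) (1, 2) (7 / 4) 1322876 6 true,
  .semi 8 (3, -2) (1, 2) .zero (.sq (7 / 5)) (1 / 5) 1400000 6 true,
  .reg 9 (3, 0) (0, 3) 3 1732051 6 true,
  .semi 10 (4, -1) (2, 2) .zero (11 / 4) (3 / 4) 1658312 6 false,
  (Datum.semi 11 (3, -2) (1, 3) .zero (11 / 4) (3 / 4) 1674155 6 false
    ).rect (3, 1) (-2, 3) (.quartic 25600 1459616 8840377 18735876 13623552 2802794467358050995533273788552) .gen 21894645885 [36876584517, -80592775050, 28150226112, -514099200] [-126952157829, 130515980700, -32841930464, 599782400] [178232418915, -192707014110, 46917043520, -856832000],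
  .reg 12 (4, -2) (2, 2) (.sq 2) 2000000 6 true,
  .reg 13 (4, -1) (1, 3) (19 / 4) 2179449 6 true,
  .semi 14 (4, -2) (1, 3) .zero (19 / 4) (1 / 4) 2179449 6 false,
  .semi 15 (4, -3) (1, 3) .zero (153 / 32) (3 / 8) 2186607 6 true,
  .reg 16 (4, 0) (0, 4) (27 / 4) 2598076 6 true,
  (Datum.semi 17 (5, -1) (2, 3) .zero (627 / 100) (7 / 10) 2519785 6 false
    ).rect (5, -1) (2, 3) .zero (709371 / 111724) 167586 [2387] [112047] [-123013],
  (Datum.semi 18 (4, -3) (2, 3) .zero 6 (2 / 3) 2478627 6 false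
    ).rect (3, 2) (-3, 4) (.sqrt 192 13856406460551018348219570732046) (20 - .gen) 36 [324, -21] [-60, 4] [-60, 3],
  .reg 19 (5, -2) (2, 3) (31 / 4) 2783882 6 true,
  (Datum.semi 20 (5, 0) (0, 4) (.sqrt 129 11357816691600547221784675967984) ((5931 + 405 * .gen) / 1352) ((3 * .gen - 15) / 52) 2862821 6 true
    ).rect (-4, 5) (-4, 0) (.cubic 4 8195742186004381408671984135556) .gen 864 [-864, 108] [-864, 192] [1008, -181],
  .reg 21 (5, -1) (1, 4) (37 / 4) 3041381 6 true,
  (Datum.semi 22 (5, -2) (1, 4) .zero (.sq 3) (1 / 3) 3015791 6 false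
    ).rect (5, -2) (1, 4) .zero (193496 / 21275) 85100 [70580] [26795] [-22903],
  (Datum.semi 23 (5, -3) (1, 4) .zero (103 / 12) (1 / 6) 2942985 6 false
    ).rect (5, -3) (1, 4) (.quartic 97344 14493200 287680857 2041299600 4968218624 8661158494016268893313865127917) .gen 12494457858015 [91938940745183, -35077725263182, 3155679057272, -22405376448] [-79767782061247, 25164522532508, -1915947999058, 13603264272] [129742152586305, -42938044721130, 3381084704220, -24005760480],
  (Datum.semi 24 (6, -2) (3, 3) .zero (1216 / 121) (29 / 44) 3178781 6 true
    ).rect (6, -2) (3, 3) .zero (869 / 86) 344 [43] [223] [-232],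
  .reg 25 (5, 0) (0, 5) 12 3464102 6 true,
  (Datum.semi 26 (6, -1) (2, 4) .zero (203 / 18) (2 / 3) 3390771 6 false
    ).rect (6, -1) (2, 4) .zero (2150 / 187) 1496 [165] [920] [-1071],
  .reg 27 (6, -3) (3, 3) (.sq (7 / 2)) 3500000 6 true,
  .reg 28 (6, -2) (2, 4) 13 3605551 6 true,
  (Datum.semi 29 (7, -2) (4, 3) .zero (44719 / 3844) (47 / 62) 3424230 6 false
    ).rect (7, -2) (4, 3) .zero (481078403 / 41028908) 20514454 [-3291691] [15142459] [-16090501],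
  (Datum.semi 30 (6, 0) (0, 5) (.sqrt 51 7141428428542849997999399811367) ((1072 + 128 * .gen) / 147) ((2 * .gen - 6) / 21) 3762292 6 true
    ).rect (-5, 6) (-5, 0) (.cubic 5 14154841600628377945946856996478) .gen 4000 [-4000, 320] [-4000, 500] [4400, -461],
  .reg 31 (6, -1) (1, 5) (61 / 4) 3905125 6 true,
  (Datum.semi 32 (6, -1) (2, 5) .zero (59 / 4) (3 / 8) 3871988 6 false
    ).rect (6, -2) (1, 5) .zero (2307733 / 153928) 615712 [224117] [177632] [-484433],
  .semi 33 (7, -3) (4, 3) .zero (.sq (227 / 58)) (37 / 58) 3913793 6 true,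
  (Datum.semi 34 (7, -2) (3, 4) .zero (1921 / 121) (7 / 11) 4004121 6 true
    ).rect (7, -2) (3, 4) .zero (170126 / 10611) 42444 [7764] [26069] [-28161],
  .semi 35 (7, 0) (1, 5) (.sqrt 12257 110711336366245710673494534531075) ((17559 + 135 * .gen) / 2048) ((.gen - 15) / 128) 3983917 6 false,
  .reg 36 (6, 0) (0, 6) (75 / 4) 4330127 6 true,
  .reg 37 (7, -3) (3, 4) (73 / 4) 4272002 6 false,
  (Datum.semi 38 (6, -1) (2, 6) .zero 17 (3 / 5) 4195388 6 false
    ).rect (1, -6) (7, -4) .zero (343577 / 19520) 39040 [21411] [600] [-32312],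
  .reg 39 (7, -2) (2, 5) (79 / 4) 4444097 6 true,
  .semi 40 (7, -4) (3, 4) .zero (.sq (137 / 31)) (11 / 31) 4419355 6 false,
  (Datum.semi 41 (7, -2) (3, 5) .zero (637 / 32) (3 / 8) 4500346 6 true
    ).rect (7, -5) (4, 3) .zero (19168435 / 946444) 2366110 [884985] [789831] [-1773089],
  (Datum.semi 42 (7, 0) (0, 6) (.sqrt 33 5744562646538028659850611468218) ((84075 + 13125 * .gen) / 7688) ((15 * .gen - 35) / 124) 4651075 6 true
    ).rect (-6, 7) (-6, 0) (.cubic 6 21632496325754322790562066171615) .gen 13500 [-13500, 750] [-13500, 1080] [14400, -991],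
  .reg 43 (7, -1) (1, 6) (91 / 4) 4769696 6 true,
  (Datum.semi 44 (7, -1) (2, 6) .zero 22 (2 / 5) 4735589 6 false
    ).rect (7, -6) (5, 2) .zero (4700717 / 209612) 419224 [166939] [128986] [-314534],
  (Datum.semi 45 (7, -3) (1, 6) .zero (423 / 20) (3 / 10) 4607942 6 false
    ).rect (7, -3) (1, 6) (.quartic 548800 70030800 2721532527 44612184348 279110188800 21233125274895106660537407448922) .gen 41426504646813 [169723024033725, -28814346844290, 1316425552596, -11915820000] [-154955793768165, 19467488967732, -679108419990, 6147050000] [419306174804187, -59516654252814, 2298520806120, -20805400000]]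

/-- The rows of `tableB`. -/
def dataB : List Datum := [
  (Datum.semi 46 (8, -2) (3, 5) .zero (49051 / 2116) (57 / 92) 4845197 6 true
    ).rect (8, -2) (3, 5) .zero (73151 / 3116) 12464 [2831] [7339] [-8144],
  (Datum.semi 47 (7, -3) (4, 5) .zero (3224 / 147) (13 / 21) 4780048 6 false
    ).rect (3, -7) (8, -3) .zero (5560412771 / 243356228) 851746798 [409967459] [88860789] [-699746649],
  .reg 48 (8, -4) (4, 4) (.sq 5) 5000000 6 true,
  .reg 49 (7, 0) (0, 7) 27 5196152 6 true,
  (Datum.semi 50 (8, -1) (2, 6) .zero (825 / 32) (5 / 8) 5136669 6 false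
    ).rect (8, -1) (2, 6) .zero (2143125 / 81224) 487344 [111644] [272910] [-330505],
  (Datum.semi 51 (7, -1) (2, 7) .zero (6016 / 243) (19 / 27) 5068374 6 false
    ).rect (4, -7) (9, -3) .zero (32914863743 / 1281311828) 640655914 [360485449] [45544201] [-502646429],
  .reg 52 (8, -2) (2, 6) 28 5291503 6 true,
  (Datum.semi 53 (9, -2) (4, 5) .zero (358639 / 13924) (83 / 118) 5124307 6 false
    ).rect (9, -2) (4, 5) .zero (21713005483 / 826893628) 413446814 [-268019] [268679359] [-314418709],
  (Datum.semi 54 (8, -2) (3, 6) .zero (335 / 12) (5 / 12) 5333787 6 true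
    ).rect (8, -6) (5, 3) .zero (118349 / 4160) 41600 [16614] [14375] [-30048],
  (Datum.semi 55 (9, -1) (1, 6) .zero (.sq (449 / 86)) (21 / 86) 5251154 6 false
    ).rect (8, -5) (3, 5) .zero (15510042323 / 562475260) 12093218090 [476965107] [10697843775] [-5213013281],
  (Datum.semi 56 (8, 0) (0, 7) .zero (.sq (277 / 51)) (31 / 51) 5533452 6 true
    ).rect (9, -4) (5, 4) (.cubic 7 30619091162507430273212834853643) .gen 37044 [-37044, 1512] [-37044, 2058] [38808, -1891],
  .reg 57 (8, -1) (1, 7) (127 / 4) 5634714 6 true,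
  (Datum.semi 58 (8, -1) (2, 7) .zero (123 / 4) (5 / 12) 5601959 6 false
    ).rect (8, -2) (1, 7) .zero (7191956 / 229175) 916700 [386765] [298180] [-660113],
  (Datum.semi 59 (8, -1) (3, 7) .zero (89 / 3) (1 / 3) 5477261 6 false
    ).rect (8, -3) (1, 7) .zero (742918955 / 24763644) 37145466 [11478591] [6676215] [-32689085],
  (Datum.semi 60 (9, -2) (3, 6) .zero (118969 / 3721) (37 / 61) 5694907 6 true
    ).rect (9, -2) (3, 6) .zero (4775023 / 147232) 294464 [77142] [167883] [-189488],
  .reg 61 (9, -4) (4, 5) (133 / 4) 5766281 6 true,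
  (Datum.semi 62 (8, -2) (3, 7) .zero (49987 / 1600) (47 / 80) 5696037 6 false
    ).rect (2, -8) (9, -5) .zero (2563175 / 79001) 2528032 [1348785] [327155] [-1945632],
  .reg 63 (9, -3) (3, 6) (139 / 4) 5894913 6 true,
  .reg 64 (8, 0) (0, 8) (147 / 4) 6062178 6 true,
  (Datum.semi 65 (9, -1) (2, 7) .zero (11431 / 324) (11 / 18) 6008714 6 false
    ).rect (9, -1) (2, 7) .zero (42769993 / 1184612) 4146142 [1106241] [2262729] [-2744599],
  (Datum.semi 66 (9, -3) (4, 6) .zero (23987 / 675) (17 / 45) 5995670 6 false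
    ).rect (-3, -6) (6, -10) .zero (1193079661 / 33188989) 165944945 [66685861] [61713125] [-116257823],
  .reg 67 (9, -2) (2, 7) (151 / 4) 6144103 6 true,
  (Datum.semi 68 (10, -2) (4, 6) .zero (12649 / 361) (13 / 19) 5986387 6 false
    ).rect (10, -2) (4, 6) .zero (3193957 / 89125) 89125 [5075] [55315] [-66619],
  (Datum.semi 69 (9, -2) (3, 7) .zero (262 / 7) (3 / 7) 6177292 6 true
    ).rect (9, -3) (2, 7) .zero (6272261 / 164372) 575302 [240877] [205001] [-402319],
  (Datum.semi 70 (10, -4) (5, 5) .zero (44339 / 1156) (81 / 136) 6202613 6 true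
    ).rect (10, -4) (5, 5) .zero (414848 / 10783) 43132 [12361] [25443] [-26076],
  (Datum.semi 71 (10, -1) (1, 7) .zero (1035 / 28) (5 / 14) 6164025 6 false
    ).rect (9, -7) (5, 4) .zero (3274003629 / 86168876) 2455812966 [239565337] [2078069417] [-1099722603],
  (Datum.semi 72 (9, 0) (0, 8) (.sqrt 537 23173260452512935064640098095494) ((177233 + 7203 * .gen) / 8664) ((7 * .gen - 63) / 228) 6411744 6 true
    ).rect (-8, 9) (-8, 0) (.cubic 8 41110462119156591535192071346975) .gen 87808 [-87808, 2744] [-87808, 3584] [90944, -3305],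
  .reg 73 (9, -1) (1, 8) (.sq (13 / 2)) 6500000 6 true,
  (Datum.semi 74 (9, -1) (2, 8) .zero 41 (3 / 7) 6469317 6 false
    ).rect (9, -8) (7, 2) .zero (9026779 / 215683) 215683 [94604] [73508] [-149981],
  .reg 75 (10, -5) (5, 5) (.sq (13 / 2)) 6500000 6 false,
  .reg 76 (10, -4) (4, 6) 43 6557439 6 true,
  .semi 77 (11, 0) (2, 7) .zero (1215 / 32) (5 / 8) 6161879 6 false,
  (Datum.semi 78 (9, -2) (3, 8) .zero (21844 / 529) (53 / 92) 6545453 6 false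
    ).rect (2, -9) (10, -6) .zero (4833828787 / 112826683) 112826683 [61296421] [18436496] [-83434504],
  .reg 79 (10, -3) (3, 7) (181 / 4) 6726812 6 true,
  (Datum.semi 80 (10, -4) (5, 6) (.sqrt 3770 61400325732035005222893780515965) ((63261 + 972 * .gen) / 2738) ((.gen - 12) / 74) 6703428 6 false
    ).rect (10, 0) (1, 8) .zero (241351 / 5371) 5371 [2173] [2104] [-3668],
  .reg 81 (9, 0) (0, 9) 48 6928203 6 true,
  (Datum.semi 82 (10, -1) (2, 8) .zero (1157 / 25) (3 / 5) 6879893 6 false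
    ).rect (10, -1) (2, 8) .zero (1184696 / 25029) 400464 [118503] [214608] [-259457],
  (Datum.semi 83 (9, -1) (2, 9) .zero (957559 / 21316) (47 / 146) 6817569 6 false
    ).rect (-8, 11) (-9, 2) .zero (975386934409 / 20985431116) 10492715558 [6026442929] [1628589071] [-7550008021],
  .reg 84 (10, -2) (2, 8) (.sq 7) 7000000 6 true,
  .semi 85 (11, -5) (6, 5) .zero (.sq (1097 / 158)) (93 / 158) 6943038 6 false,
  (Datum.semi 86 (10, -2) (3, 8) .zero (40953 / 841) (17 / 29) 7026997 6 true
    ).rect (6, -10) (11, -4) .zero (30121 / 610) 48800 [21152] [17873] [-33175],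
  (Datum.semi 87 (9, -2) (3, 9) .zero (638611 / 13924) (79 / 118) 6826679 6 false
    ).rect (2, -9) (11, -6) .zero (1080643 / 23188) 11594 [7429] [-31] [-8921],
  (Datum.semi 88 (10, -2) (4, 8) .zero (191 / 4) (3 / 8) 6972847 6 false
    ).rect (10, -8) (6, 4) .zero (84065 / 1729) 1729 [595] [429] [-1425],
  (Datum.semi 89 (11, -3) (4, 7) .zero (194709 / 3844) (109 / 186) 7153119 6 true
    ).rect (11, -3) (4, 7) .zero (511258004631 / 9991926364) 14987889546 [4632272857] [8417219933] [-9192450057]]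

/-- The rows of `tableC`. -/
def dataC : List Datum := [
  (Datum.semi 90 (10, 0) (0, 9) (.sqrt 19 4358898943540673552236981983859) ((140352 + 30720 * .gen) / 5329) ((12 * .gen - 20) / 73) 7287290 6 true
    ).rect (-9, 10) (-9, 0) (.cubic 9 53104597836797148743557940921692) .gen 186624 [-186624, 4608] [-186624, 5832] [191808, -5401],
  .reg 91 (10, -1) (1, 9) (217 / 4) 7365460 6 true,
  (Datum.semi 92 (10, -1) (2, 9) .zero (211 / 4) (7 / 16) 7336963 6 false
    ).rect (10, -2) (1, 9) .zero (4639657267 / 86189275) 86189275 [38845630] [30539269] [-58183190],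
  .reg 93 (11, -4) (4, 7) (217 / 4) 7365460 6 false,
  (Datum.semi 94 (11, -2) (3, 8) .zero (.sq (713 / 97)) (57 / 97) 7407595 6 true
    ).rect (11, -2) (3, 8) .zero (666148999 / 12139951) 12139951 [3794737] [6627952] [-7589528],
  .semi 95 (12, -5) (7, 5) .zero (.sq (277 / 38)) (25 / 38) 7289474 6 false,
  .semi 96 (11, -6) (5, 6) .zero (.sq (67 / 9)) (11 / 27) 7444444 6 true,
  .reg 97 (11, -3) (3, 8) (229 / 4) 7566373 6 true,
  (Datum.semi 98 (12, -1) (2, 8) .zero (115625 / 2178) (8 / 33) 7355748 6 false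
    ).rect (10, -11) (8, 1) .zero (613512713 / 11338873) 929787586 [1601031] [749960494] [-548311491],
  .semi 99 (11, 0) (1, 9) (.sqrt 91553 302577262860248638346083454585079) ((498775 + 1575 * .gen) / 16928) ((.gen - 63) / 368) 7590561 6 true,
  .reg 100 (10, 0) (0, 10) (243 / 4) 7794229 6 true,
  (Datum.semi 101 (11, -1) (2, 9) .zero (28449 / 484) (13 / 22) 7750300 6 false
    ).rect (11, -1) (2, 9) .zero (12663270675 / 210818572) 948683574 [302537075] [501718365] [-603119749],
  (Datum.semi 102 (12, -5) (6, 6) .zero (29651 / 500) (29 / 50) 7709550 6 false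
    ).rect (12, -5) (6, 6) .zero (208565 / 3509) 17545 [5687] [10103] [-10295],
  .reg 103 (11, -2) (2, 9) (247 / 4) 7858117 6 true,
  (Datum.semi 104 (12, -4) (5, 7) .zero (176485 / 2916) (125 / 216) 7805245 6 false
    ).rect (12, -4) (5, 7) .zero (4142419871 / 67995631) 67995631 [22103451] [38366299] [-40616961],
  (Datum.semi 105 (11, -2) (3, 9) .zero (1097 / 18) (4 / 9) 7880722 6 true
    ).rect (11, -9) (8, 3) .zero (447216991 / 7200892) 54006690 [24021759] [20267813] [-35819875],
  (Datum.semi 106 (10, -2) (3, 10) .zero (.sq (84 / 11)) (29 / 44) 7691723 6 false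
    ).rect (5, 7) (-8, 10) .zero (33151587 / 560347) 36982902 [23755318] [1459947] [-27384797],
  (Datum.semi 107 (11, -5) (6, 7) .zero (2161 / 36) (7 / 18) 7845022 6 false
    ).rect (11, -4) (2, 9) .zero (12486512240719 / 202886322964) 101443161482 [49661136773] [24267106357] [-74007990677],
  .reg 108 (12, -6) (6, 6) (.sq 8) 8000000 6 true,
  .reg 109 (12, -5) (5, 7) (259 / 4) 8046738 6 true,
  (Datum.semi 110 (11, 0) (0, 10) (.sqrt 849 29137604568666930826191504708477) ((2184003 + 72171 * .gen) / 66248) ((9 * .gen - 99) / 364) 8160909 6 true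
    ).rect (-10, 11) (-10, 0) (.cubic 10 66600438288584125340307325471584) .gen 364500 [-364500, 7290] [-364500, 9000] [372600, -8371],
  .reg 111 (11, -1) (1, 10) (271 / 4) 8231039 6 true,
  (Datum.reg 112 (11, -1) (2, 10) 67 8204618 6 false
    ).rect (12, -8) (8, 4) .zero (1034089141 / 15361771) 30723542 [14121827] [11245807] [-20223098],
  (Datum.semi 113 (11, -1) (3, 10) .zero (451319 / 6962) (38 / 59) 8101312 6 false
    ).rect (6, -11) (13, -5) .zero (387649933983 / 5906484172) 8859726258 [3502416083] [2175988281] [-7028571979],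
  (Datum.semi 114 (12, -2) (3, 9) .zero (937099 / 13924) (137 / 236) 8267550 6 true
    ).rect (12, -2) (3, 9) .zero (283698767 / 4150532) 8301064 [2749754] [4466689] [-5122246],
  (Datum.semi 115 (13, -4) (6, 7) .zero (4244941 / 64516) (163 / 254) 8155175 6 false
    ).rect (13, -4) (6, 7) .zero (12272144911631 / 184524424676) 92262212338 [15348538247] [56772031397] [-62269354787],
  (Datum.semi 116 (12, -4) (5, 8) .zero (8723 / 128) (13 / 32) 8300045 6 true
    ).rect (-4, -8) (8, -13) .zero (2045764331 / 29695775) 148478875 [63914909] [59524880] [-97153700],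
  .reg 117 (12, -3) (3, 9) (283 / 4) 8411302 6 true,
  (Datum.semi 118 (11, -2) (4, 10) .zero (451319 / 6962) (38 / 59) 8180049 6 false
    ).rect (5, -11) (13, -5) .zero (22520512223 / 336563063) 673126126 [317101534] [78805741] [-552547751],
  (Datum.semi 119 (13, -3) (5, 8) .zero (.sq (1643 / 198)) (65 / 198) 8330729 6 false
    ).rect (12, -7) (5, 7) .zero (17514883072583 / 252372028148) 126186014074 [21473471531] [74787931471] [-87425682721],
  (Datum.semi 120 (12, -3) (4, 9) (.sqrt 58 7615773105863908285661411027158) ((28677 + 3630 * .gen) / 784) ((3 * .gen - 5) / 28) 8477515 6 true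
    ).rect (12, 0) (1, 10) .zero (102121645769 / 1420956281) 1420956281 [627492541] [556803671] [-927060509],
  .reg 121 (11, 0) (0, 11) 75 8660254 6 true,
  (Datum.semi 122 (12, -1) (2, 10) .zero (655 / 9) (7 / 12) 8620056 6 false
    ).rect (12, -1) (2, 10) .zero (10143575 / 136512) 1365120 [460649] [714870] [-853536],
  (Datum.semi 123 (11, -1) (2, 11) .zero (392863 / 5476) (79 / 222) 8564814 6 false
    ).rect (-10, 13) (-11, 2) .zero (129728247871 / 1768473940) 884236970 [508660157] [189437425] [-597515969],
  .reg 124 (12, -2) (2, 10) 76 8717798 6 true,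
  (Datum.semi 125 (13, -2) (4, 9) .zero (5551687 / 77284) (179 / 278) 8587896 6 false
    ).rect (13, -2) (4, 9) .zero (976273547119 / 13237256716) 6618628358 [1170564913] [3761198387] [-4695012233],
  (Datum.semi 126 (12, -2) (3, 10) .zero (1499 / 20) (9 / 20) 8737172 6 true
    ).rect (12, -3) (2, 10) .zero (19145005 / 250792) 2507920 [1137670] [961676] [-1627939],
  .reg 127 (13, -6) (6, 7) (307 / 4) 8760708 6 true,
  (Datum.semi 128 (12, -4) (5, 9) .zero (369 / 5) (2 / 5) 8703151 6 false
    ).rect (12, -4) (2, 10) .zero (795830295 / 10506727) 31520181 [16340345] [7838105] [-22043931],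
  .reg 129 (13, -5) (5, 8) (313 / 4) 8845903 6 true,
  (Datum.semi 130 (13, 0) (1, 10) (.sqrt 97 9848857801796104721746211414917) ((3182571 + 312741 * .gen) / 84872) ((27 * .gen - 143) / 412) 8707601 6 false
    ).rect (10, 0) (-2, 13) (.sqrt 1192555 1092041665871774326595867348837977) ((18088 + 16 * .gen) / 469) 84420 [-39200, 40] [-10787, 67] [15309, -63],
  (Datum.semi 131 (13, -1) (1, 10) .zero (3094091 / 40804) (81 / 202) 8853026 6 true
    ).rect (11, -12) (10, 1) .zero (192224305737 / 2452589252) 136118703486 [28558425329] [103744544029] [-64393887099],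
  (Datum.semi 132 (12, 0) (0, 11) (.sqrt 258 16062378404209010540502651533534) ((165700 + 10000 * .gen) / 4107) ((5 * .gen - 30) / 111) 9033127 6 true
    ).rect (-11, 12) (-11, 0) (.cubic 11 81597384416566598649503066356548) .gen 665500 [-665500, 11000] [-665500, 13310] [677600, -12431]]

/-- The rows of `tableD`. -/
def dataD : List Datum := [
  .reg 133 (12, -1) (1, 11) (331 / 4) 9096703 6 true,
  (Datum.semi 134 (12, -1) (2, 11) .zero (323 / 4) (9 / 20) 9072174 6 false
    ).rect (12, -2) (1, 11) .zero (6558879037 / 79690552) 159381104 [74337409] [59956966] [-102662524],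
  (Datum.semi 135 (12, -1) (3, 11) .zero (787 / 10) (2 / 5) 8975831 6 false
    ).rect (12, -11) (9, 3) .zero (10272242758901 / 127501682004) 191252523006 [78793659981] [50322533213] [-147394349047],
  (Datum.semi 136 (13, -2) (3, 10) .zero (181289 / 2209) (27 / 47) 9128889 6 true
    ).rect (13, -2) (3, 10) .zero (20689231 / 248261) 496522 [172198] [264147] [-302727],
  (Datum.semi 137 (13, -4) (5, 9) .zero (2598661 / 31684) (73 / 178) 9117159 6 false
    ).rect (5, -14) (13, -9) .zero (74222844365281 / 892932274564) 446466137282 [196430611013] [180931610777] [-286930520437],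
  (Datum.semi 138 (12, -2) (3, 11) .zero (27389 / 338) (19 / 52) 9118225 6 false
    ).rect (-9, -3) (4, -14) .zero (1122833 / 13505) 67525 [37525] [16133] [-45547],
  .reg 139 (13, -3) (3, 10) (343 / 4) 9260130 6 true,
  (Datum.semi 140 (14, -6) (7, 7) .zero (134518 / 1587) (157 / 276) 9214743 6 false
    ).rect (14, -6) (7, 7) .zero (80581 / 949) 93951 [32923] [53147] [-53937],
  (Datum.semi 141 (14, -3) (5, 9) .zero (929347 / 11236) (67 / 106) 9182448 6 false
    ).rect (14, -3) (5, 9) .zero (196014091823 / 2324718468) 10461233106 [2069469909] [6060139659] [-7159790879],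
  (Datum.semi 142 (13, -3) (4, 10) .zero (117688 / 1369) (21 / 37) 9319392 6 true
    ).rect (8, -13) (14, -5) .zero (15150070069 / 174437335) 348874670 [156986497] [138738205] [-223434082],
  .semi 143 (13, 0) (1, 11) (.sqrt 7553 86907997330510383818665652759425) ((399015 + 4455 * .gen) / 8978) ((5 * .gen - 99) / 536) 9357805 6 true,
  .reg 144 (12, 0) (0, 12) (363 / 4) 9526279 6 true,
  (Datum.semi 145 (13, -1) (2, 11) .zero (59675 / 676) (15 / 26) 9489277 6 false
    ).rect (13, -1) (2, 11) .zero (3279780625 / 36423236) 200327798 [70649273] [104119125] [-123428655],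
  (Datum.semi 146 (14, -4) (5, 9) .zero (119853 / 1352) (59 / 104) 9454238 6 false
    ).rect (14, -4) (5, 9) .zero (16400637 / 183488) 2201856 [777184] [1205421] [-1298516],
  .reg 147 (13, -2) (2, 11) (367 / 4) 9578622 6 true,
  .reg 148 (14, -6) (6, 8) 91 9539392 6 false,
  (Datum.semi 149 (13, -2) (3, 11) .zero (995 / 11) (5 / 11) 9595544 6 true
    ).rect (13, -11) (10, 3) .zero (1164694451 / 12649484) 347860810 [160225747] [135950875] [-221587229],
  (Datum.semi 150 (13, -4) (5, 10) .zero (112529 / 1280) (103 / 160) 9523531 6 false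
    ).rect (2, -12) (14, -9) .zero (286692851539 / 3160973281) 31609732810 [16574166886] [8370796399] [-21565961435],
  .reg 151 (14, -5) (5, 9) (373 / 4) 9656604 6 true,
  (Datum.semi 152 (14, -3) (4, 10) .zero (405821 / 4374) (46 / 81) 9687932 6 true
    ).rect (14, -3) (4, 10) .zero (7532633043 / 80257313) 481543878 [171336217] [258850442] [-287382477],
  (Datum.semi 153 (15, -6) (8, 7) .zero (1030243 / 11236) (199 / 318) 9589328 6 false
    ).rect (15, -6) (8, 7) .zero (894213901557691 / 9724451350300) 4862225675150 [1032069905345] [3013973621711] [-3088692649465],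
  (Datum.semi 154 (14, -6) (7, 8) .zero (771407 / 8192) (109 / 256) 9714912 6 true
    ).rect (-6, -8) (8, -15) .zero (1311592 / 13897) 55588 [23972] [23547] [-35277],
  (Datum.semi 155 (14, -1) (1, 11) .zero (133856 / 1445) (53 / 85) 9739365 6 true
    ).rect (8, -13) (15, -5) .zero (15557710498703 / 164015315380) 10907018472770 [2560756629027] [8092538433675] [-5208213467681],
  (Datum.reg 156 (13, 0) (0, 12) 97 9904296 6 true
    ).rect (14, -4) (4, 10) (.cubic 12 98095077911069275073746664103889) .gen 1149984 [-1149984, 15972] [-1149984, 19008] [1167408, -17821],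
  .reg 157 (13, -1) (1, 12) (397 / 4) 9962429 6 true,
  (Datum.semi 158 (13, -1) (2, 12) .zero 97 (5 / 11) 9939599 6 false
    ).rect (13, -12) (11, 2) .zero (75425702171 / 763451750) 3053807000 [1440319025] [1175814605] [-1930631848],
  (Datum.semi 159 (13, -1) (3, 12) .zero (12176361 / 128164) (223 / 358) 9849623 6 false
    ).rect (9, -13) (15, -4) .zero (184097879615 / 1897621332) 2846431998 [1210079273] [793327755] [-2137059285],
  (Datum.semi 160 (14, -2) (3, 11) .zero (677416 / 6889) (189 / 332) 9991199 6 true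
    ).rect (14, -2) (3, 11) .zero (9726226252 / 97433683) 389734732 [140272471] [205471059] [-235025364],
  .semi 161 (15, -7) (8, 7) .zero (9284209 / 93636) (173 / 306) 9957516 6 false,
  (Datum.semi 162 (15, -6) (7, 8) .zero (301273 / 3025) (31 / 55) 9994901 6 true
    ).rect (15, -6) (7, 8) .zero (195650535281 / 1958502269) 1958502269 [707207563] [1092308588] [-1121495192],
  .reg 163 (14, -3) (3, 11) (409 / 4) 1011187 5 true,
  (Datum.semi 164 (14, -4) (6, 10) .zero (292 / 3) (5 / 12) 9972351 6 false
    ).rect (14, -10) (8, 6) .zero (267614 / 2691) 226044 [86652] [73623] [-169169],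
  (Datum.semi 165 (15, -5) (6, 9) .zero (2487641 / 24500) (197 / 350) 1010624 5 false
    ).rect (15, -5) (6, 9) .zero (33252082489597 / 325566557812) 162783278906 [58961669841] [89481545871] [-94338472379],
  (Datum.semi 166 (14, -3) (4, 11) .zero (813 / 8) (11 / 24) 1016549 5 true
    ).rect (14, -11) (10, 4) .zero (544579139 / 5269928) 421594240 [192580517] [169936000] [-265597531],
  (Datum.semi 167 (15, -1) (2, 11) .zero (6025357 / 60516) (77 / 246) 1005388 5 false
    ).rect (13, -14) (11, 1) .zero (7169589821 / 70929460) 11313248870 [1363772151] [8348508245] [-6572861049],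
  .semi 168 (14, 0) (1, 12) (.sqrt 16226 127381317311448777464750419465801) ((662311 + 5070 * .gen) / 12482) ((.gen - 30) / 158) 1023727 5 true,
  .reg 169 (13, 0) (0, 13) 108 1039230 5 true,
  (Datum.semi 170 (14, -1) (2, 12) .zero (10317 / 98) (4 / 7) 1035806 5 false
    ).rect (14, -1) (2, 12) .zero (1618378002 / 15084233) 362021592 [132272131] [187059864] [-220173329],
  .reg 171 (15, -6) (6, 9) (427 / 4) 1033199 5 false,
  .reg 172 (14, -2) (2, 12) 109 1044031 5 true,
  (Datum.semi 173 (15, -2) (4, 11) .zero (15153631 / 145924) (239 / 382) 1032585 5 false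
    ).rect (15, -2) (4, 11) .zero (37802632989571 / 354544269100) 177272134550 [40554788005] [97437739195] [-121873847221],
  (Datum.semi 174 (14, -2) (3, 12) .zero (2579 / 24) (11 / 24) 1045531 5 true
    ).rect (14, -12) (11, 3) .zero (1893749 / 17324) 138592 [64608] [55083] [-86833],
  .reg 175 (15, -5) (5, 10) (439 / 4) 1047616 5 true]

/-- The rows of the table. -/
def data : List Datum := dataA ++ dataB ++ dataC ++ dataD

/-! ### Verification of the rows -/

namespace Cell
variable {C : Cell}

/-- The expression for `d²` is meaningful. -/
def ok (C : Cell) : Bool := C.gen.check && Nat.ble 1 C.sq.num.2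

theorem ok_of_check {k : ℕ} {p q : ℤ × ℤ} (h : C.check k p q = true) : C.ok = true := by
  simp only [check, Bool.and_eq_true] at h
  rw [ok, Bool.and_eq_true]
  exact h.1.1

theorem holds (h : C.ok = true) : C.gen.isolation.Holds C.gen.val :=
  Gen.holds (Bool.and_eq_true _ _ ▸ h).1

theorem den_pos (h : C.ok = true) : 0 < C.sq.num.2 :=
  Nat.le_of_ble_eq_true (Bool.and_eq_true _ _ ▸ h).2

theorem den_mul_val (h : C.ok = true) :
    (C.sq.num.2 : ℝ) * C.val = ev C.gen.val C.sq.num.1 := by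
  have hM : (C.sq.num.2 : ℝ) ≠ 0 := by exact_mod_cast (den_pos h).ne'
  rw [val, Num.val_eq (den_pos h).ne', mul_div_cancel₀ _ hM]

/-- Common source of both bounds: `lower` uses the numerator itself, `upper` its negative with the
result negated. -/
theorem floor_le (h : C.ok = true) {S : ℤ} (hS : 0 ≤ S) {p : List ℤ} {x : ℝ}
    (hx : ev C.gen.val p = C.sq.num.2 * x) :
    ((S * C.gen.isolation.lb p / (C.sq.num.2 * C.gen.isolation.E) : ℤ) : ℝ) ≤ S * x := by
  have H := holds h
  have hM : (0 : ℤ) < C.sq.num.2 := by exact_mod_cast den_pos h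
  have hME := mul_pos hM H.pos
  have h1 : (C.sq.num.2 * C.gen.isolation.E : ℝ) *
      ((S * C.gen.isolation.lb p / (C.sq.num.2 * C.gen.isolation.E) : ℤ) : ℝ) ≤
      S * C.gen.isolation.lb p := by
    exact_mod_cast Int.mul_ediv_self_le (x := S * C.gen.isolation.lb p) hME.ne'
  have h2 := mul_le_mul_of_nonneg_left (H.lb_le p) (by exact_mod_cast hS : (0 : ℝ) ≤ S)
  rw [hx] at h2
  have h3 : (0 : ℝ) < C.sq.num.2 * C.gen.isolation.E := by exact_mod_cast hME
  refine le_of_mul_le_mul_left ?_ h3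
  linarith

theorem lower_le (h : C.ok = true) {S : ℤ} (hS : 0 ≤ S) : (C.lower S : ℝ) ≤ S * C.val :=
  floor_le h hS (den_mul_val h).symm

theorem le_upper (h : C.ok = true) {S : ℤ} (hS : 0 ≤ S) : S * C.val ≤ C.upper S := by
  have := floor_le (p := psmul (-1) C.sq.num.1) (x := -C.val) h hS (by
    rw [ev_psmul, ← den_mul_val h]; push_cast; ring)
  rw [upper, Int.cast_neg]
  linarith

/-- The precision of comparisons. -/
def scale : ℤ := 1000000000000

theorem scale_pos : 0 < scale := by norm_num [scale]

theorem scale_pos' : (0 : ℝ) < scale := by exact_mod_cast scale_pos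

/-- A test for the strict comparison of the values of two cells. -/
def lt (C C' : Cell) : Bool := isNonneg (C'.lower scale - C.upper scale - 1)

/-- A test for the comparison of the values of two cells. -/
def le (C C' : Cell) : Bool := isNonneg (C'.lower scale - C.upper scale)

/-- Ties have to pass this test, as for k = 13 and 14, 73 and 75, 91 and 93. Their values are
rational with denominator 4, so both bounds are exact at the chosen scale. -/
theorem val_le {C' : Cell} (h : C.ok = true) (h' : C'.ok = true) (hle : C.le C' = true) :
    C.val ≤ C'.val := by
  have h1 : C.upper scale ≤ C'.lower scale := by have := isNonneg_iff.1 hle; omega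
  have h2 : (C.upper scale : ℝ) ≤ C'.lower scale := by exact_mod_cast h1
  exact le_of_mul_le_mul_left
    (((le_upper h scale_pos.le).trans h2).trans (lower_le h' scale_pos.le)) scale_pos'

theorem val_lt {C' : Cell} (h : C.ok = true) (h' : C'.ok = true) (hlt : C.lt C' = true) :
    C.val < C'.val := by
  have h1 : C.upper scale < C'.lower scale := by have := isNonneg_iff.1 hlt; omega
  have h2 : (C.upper scale : ℝ) < C'.lower scale := by exact_mod_cast h1
  exact lt_of_mul_lt_mul_left
    (((le_upper h scale_pos.le).trans_lt h2).trans_le (lower_le h' scale_pos.le)) scale_pos'.le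

/-- The test for `m / 10 ^ e` to be the rounded value of `d`. -/
def rounds (C : Cell) (m : ℤ) (e : ℕ) : Bool :=
  isNonneg (m - 1) &&
    C.gen.isolation.nn (psub (psmul (4 * (10 ^ e * 10 ^ e)) C.sq.num.1)
      [(2 * m - 1) * (2 * m - 1) * C.sq.num.2]) &&
    C.gen.isolation.nn (psub [(2 * m + 1) * (2 * m + 1) * C.sq.num.2]
      (psmul (4 * (10 ^ e * 10 ^ e)) C.sq.num.1))

/-- Rounding to m/10ᵉ means 2m - 1 ≤ 2·10ᵉ√D ≤ 2m + 1. Squaring turns this into two sign conditions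
on D. -/
theorem rounded (h : C.ok = true) {m : ℤ} {e : ℕ} (hr : C.rounds m e = true) :
    0 ≤ C.val ∧ |√C.val - m / 10 ^ e| ≤ 1 / 2 * (1 / 10) ^ e := by
  simp only [rounds, Bool.and_eq_true, isNonneg_iff] at hr
  obtain ⟨⟨h0, h1⟩, h2⟩ := hr
  have hm : (1 : ℝ) ≤ m := by exact_mod_cast (by omega : 1 ≤ m)
  have hM : (0 : ℝ) < C.sq.num.2 := by exact_mod_cast den_pos h
  replace h1 := (holds h).nn h1
  replace h2 := (holds h).nn h2
  simp only [ev_psub, ev_psmul, ← den_mul_val h, ev_cons, ev_nil, mul_zero, add_zero] at h1 h2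
  push_cast at h1 h2
  set T : ℝ := 10 ^ e
  have hT : 0 < T := by positivity
  have h1' : (2 * m - 1) ^ 2 ≤ 4 * T ^ 2 * C.val :=
    le_of_mul_le_mul_left (by linarith) hM
  have h2' : 4 * T ^ 2 * C.val ≤ (2 * m + 1) ^ 2 :=
    le_of_mul_le_mul_left (by linarith) hM
  have hv : 0 ≤ C.val := by
    have : 0 ≤ 4 * T ^ 2 * C.val := (sq_nonneg _).trans h1'
    exact (mul_nonneg_iff_of_pos_left (by positivity)).1 this
  refine ⟨hv, ?_⟩
  have hs : √C.val ^ 2 = C.val := Real.sq_sqrt hv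
  have hd := Real.sqrt_nonneg C.val
  have a1 : 2 * m - 1 ≤ 2 * T * √C.val := by
    refine le_of_sq_le_sq ?_ (by positivity)
    rw [mul_pow, hs]; linarith
  have a2 : 2 * T * √C.val ≤ 2 * m + 1 := by
    refine le_of_sq_le_sq ?_ (by linarith)
    rw [mul_pow, hs]; linarith
  have e1 : √C.val - m / T = (2 * T * √C.val - 2 * m) * (1 / 2 * (1 / T)) := by field_simp
  rw [e1, one_div_pow, abs_mul, abs_of_nonneg (by positivity : (0 : ℝ) ≤ 1 / 2 * (1 / T))]
  refine mul_le_of_le_one_left (by positivity) ?_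
  rw [abs_le]
  constructor <;> linarith

end Cell

namespace Datum
variable {R : Datum}

/-- The last cell of a row. -/
def last (R : Datum) : Cell := R.cells.getLast?.getD ⟨.regular, .zero, 0⟩

/-- The test of a row. -/
def check (R : Datum) : Bool :=
  match R.cells with
  | [C] => C.check R.k R.t₁ R.t₂ && C.rounds R.approx R.digits
  | [C, C'] => C.check R.k R.first.1 R.first.2 && C'.check R.k R.t₁ R.t₂ && C.lt C' &&
      C'.rounds R.approx R.digits
  | _ => false

theorem cells_toRow (R : Datum) : R.toRow.cells = R.cells.map fun C => (C.cls, C.val) := by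
  obtain ⟨k, t₁, t₂, r, s, l, p, a, d, b⟩ := R
  cases r <;> cases s <;> cases l <;> rfl

theorem approx_toRow (R : Datum) : R.toRow.approx = (R.approx : ℤ) / 10 ^ R.digits := by
  change (OfScientific.ofScientific R.approx true R.digits : ℝ) = _
  rw [NNRatCast.ofScientific_eq_ite]
  simp

/-- What is to be shown about a single row. -/
structure Valid (R : Datum) : Prop where
  realised : ∀ C ∈ R.toRow.cells, ∃ (P : Fin 6 → Plane) (t₁ t₂ : ℤ × ℤ),
    C.1 P ∧ IsColouredTiling P R.toRow.k t₁ t₂ (√C.2)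
  last_realised : ∃ C, R.toRow.cells.getLast? = some C ∧ ∃ P : Fin 6 → Plane,
    C.1 P ∧ IsColouredTiling P R.toRow.k R.toRow.t₁ R.toRow.t₂ (√C.2)
  increasing : (R.toRow.cells.map Prod.snd).Pairwise (· < ·)
  rounded : |R.toRow.d - R.toRow.approx| ≤ 1 / 2 * (1 / 10) ^ R.toRow.digits
  ok : R.last.ok = true
  nonneg : 0 ≤ R.last.val
  d_eq : R.toRow.d = √R.last.val

theorem valid (h : R.check = true) : R.Valid := by
  have hc := cells_toRow R
  have ha := approx_toRow R
  have hd : R.toRow.d = √((R.toRow.cells.getLast?.map Prod.snd).getD 0) := rfl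
  rw [check] at h
  split at h
  · rename_i C hC
    have hl : R.last = C := by rw [last, hC]; rfl
    rw [Bool.and_eq_true] at h
    rw [hC, List.map_singleton] at hc
    have hok := Cell.ok_of_check h.1
    have hr := Cell.rounded hok h.2
    obtain ⟨P, hP⟩ := Cell.exists_isColouredTiling h.1
    have hd' : R.toRow.d = √C.val := by rw [hd, hc]; rfl
    refine ⟨?_, ?_, ?_, ?_, hl ▸ hok, hl ▸ hr.1, hl ▸ hd'⟩
    · rw [hc]
      simp only [List.mem_singleton, forall_eq]
      exact ⟨P, _, _, hP⟩
    · rw [hc]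
      exact ⟨_, rfl, P, hP⟩
    · simp [hc]
    · rw [ha, hd']
      exact hr.2
  · rename_i C C' hC
    have hl : R.last = C' := by rw [last, hC]; rfl
    simp only [Bool.and_eq_true] at h
    obtain ⟨⟨⟨h1, h2⟩, h3⟩, h4⟩ := h
    rw [hC, List.map_cons, List.map_singleton] at hc
    have hok := Cell.ok_of_check h2
    have hr := Cell.rounded hok h4
    obtain ⟨P, hP⟩ := Cell.exists_isColouredTiling h1
    obtain ⟨P', hP'⟩ := Cell.exists_isColouredTiling h2
    have hd' : R.toRow.d = √C'.val := by rw [hd, hc]; rfl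
    refine ⟨?_, ?_, ?_, ?_, hl ▸ hok, hl ▸ hr.1, hl ▸ hd'⟩
    · rw [hc]
      simp only [List.mem_cons, List.not_mem_nil, or_false, forall_eq_or_imp, forall_eq]
      exact ⟨⟨P, _, _, hP⟩, P', _, _, hP'⟩
    · rw [hc]
      exact ⟨_, rfl, P', hP'⟩
    · simpa [hc] using Cell.val_lt (Cell.ok_of_check h1) hok h3
    · rw [ha, hd']
      exact hr.2
  · cases h

theorem d_lt {R' : Datum} (h : R.Valid) (h' : R'.Valid) :
    R.toRow.d < R'.toRow.d ↔ R.last.val < R'.last.val := by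
  rw [h.d_eq, h'.d_eq, Real.sqrt_lt_sqrt_iff h.nonneg]

/-- The test of the marks of the record values, where `B` is the last row with a mark. -/
def boldCheck : Datum → List Datum → Bool
  | _, [] => true
  | B, R :: l => bif R.bold then B.last.lt R.last && boldCheck R l
      else R.last.le B.last && boldCheck B l

/-- Invariant of the scan: `B` attains the maximum over the rows already read. A starred row exceeds
`B`, hence all earlier rows, and replaces it; for an unstarred row `B` is the earlier row that it
fails to beat. -/
theorem bold_iff {B : Datum} {prev l : List Datum} (hB : B ∈ prev)
    (hmax : ∀ R ∈ prev, R.last.val ≤ B.last.val)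
    (hsort : (prev ++ l).Pairwise fun R R' => R.k < R'.k) (hv : ∀ R ∈ prev ++ l, R.last.ok = true)
    (h : boldCheck B l = true) : ∀ R ∈ l,
      (R.bold = true ↔ ∀ R' ∈ prev ++ l, R'.k < R.k → R'.last.val < R.last.val) := by
  induction l generalizing B prev with
  | nil => simp
  | cons R l ih =>
    have hBo : B.last.ok = true := hv B (by simp [hB])
    have hRo : R.last.ok = true := hv R (by simp)
    have hs := List.pairwise_append.1 hsort
    have hs' := List.pairwise_cons.1 hs.2.1
    -- The list is sorted by k, so the rows with smaller k are those already read.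
    have key : (∀ R' ∈ prev ++ R :: l, R'.k < R.k → R'.last.val < R.last.val) ↔
        ∀ R' ∈ prev, R'.last.val < R.last.val := by
      refine ⟨fun H R' h' => H R' (by simp [h']) (hs.2.2 R' h' R (by simp)), fun H R' h' hk => ?_⟩
      rw [List.mem_append, List.mem_cons] at h'
      rcases h' with h' | rfl | h'
      · exact H R' h'
      · exact absurd hk (lt_irrefl _)
      · exact absurd hk (hs'.1 R' h').not_gt
    rw [List.append_cons] at hsort hv
    have ih' := fun B hB hmax h => ih (B := B) (prev := prev ++ [R]) hB hmax hsort hv h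
    rw [List.forall_mem_cons, key]
    rw [← List.append_cons] at ih'
    rw [boldCheck] at h
    cases hb : R.bold with
    | true =>
      rw [hb, cond_true, Bool.and_eq_true] at h
      have hlt := Cell.val_lt hBo hRo h.1
      refine ⟨by simpa using fun R' h' => (hmax R' h').trans_lt hlt, ih' R (by simp) ?_ h.2⟩
      intro R' h'
      rw [List.mem_append, List.mem_singleton] at h'
      rcases h' with h' | rfl
      · exact (hmax R' h').trans hlt.le
      · exact le_rfl
    | false =>
      rw [hb, cond_false, Bool.and_eq_true] at h
      have hle := Cell.val_le hRo hBo h.1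
      refine ⟨by simpa using ⟨B, hB, hle⟩, ih' B (by simp [hB]) ?_ h.2⟩
      intro R' h'
      rw [List.mem_append, List.mem_singleton] at h'
      rcases h' with h' | rfl
      · exact hmax R' h'
      · exact hle

end Datum

/-! ### The table -/

theorem table_eq : table = data.map Datum.toRow := by
  -- This holds by definition because `natLit`, `Num.val` and `Gen.val` unfold to the very numerals
  -- and operations of the table, and the decimals use the same `OfScientific` literals.
  have hA : tableA = dataA.map Datum.toRow := rfl
  have hB : tableB = dataB.map Datum.toRow := rfl
  have hC : tableC = dataC.map Datum.toRow := rfl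
  have hD : tableD = dataD.map Datum.toRow := rfl
  rw [table, data, hA, hB, hC, hD, List.map_append, List.map_append, List.map_append]

theorem map_k_data : data.map Datum.k = List.range' 3 173 := by decide +kernel

theorem check_dataA : dataA.all Datum.check = true := by decide +kernel

theorem check_dataB : dataB.all Datum.check = true := by decide +kernel

theorem check_dataC : dataC.all Datum.check = true := by decide +kernel

theorem check_dataD : dataD.all Datum.check = true := by decide +kernel

theorem valid_of_mem {R : Datum} (h : R ∈ data) : R.Valid := by
  refine Datum.valid ?_
  simp only [data, List.mem_append] at h
  rcases h with ((h | h) | h) | h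
  · exact List.all_eq_true.1 check_dataA R h
  · exact List.all_eq_true.1 check_dataB R h
  · exact List.all_eq_true.1 check_dataC R h
  · exact List.all_eq_true.1 check_dataD R h

theorem boldCheck_data : (match data with
    | [] => false
    | B :: l => B.bold && Datum.boldCheck B l) = true := by decide +kernel

theorem pairwise_k_data : data.Pairwise fun R R' => R.k < R'.k := by
  have h : (data.map Datum.k).Pairwise (· < ·) := by
    rw [map_k_data]
    exact List.pairwise_lt_range'
  exact List.pairwise_map.1 h

theorem bold_data : ∀ R ∈ data,
    (R.bold = true ↔ ∀ R' ∈ data, R'.k < R.k → R'.toRow.d < R.toRow.d) := by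
  have hv : ∀ R ∈ data, R.Valid := fun R => valid_of_mem
  have hs := pairwise_k_data
  have hb := boldCheck_data
  have key : ∀ R ∈ data,
      (R.bold = true ↔ ∀ R' ∈ data, R'.k < R.k → R'.last.val < R.last.val) := by
    revert hv hs hb
    cases data with
    | nil => simp
    | cons B l =>
      intro hv hs hb
      rw [Bool.and_eq_true] at hb
      rw [List.forall_mem_cons]
      constructor
      -- The first row is a record vacuously and opens the scan as `B`.
      · refine iff_of_true hb.1 fun R' h' hk => ?_
        rw [List.mem_cons] at h'
        rcases h' with rfl | h'
        · exact absurd hk (lt_irrefl _)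
        · exact absurd hk ((List.pairwise_cons.1 hs).1 R' h').not_gt
      · exact Datum.bold_iff (prev := [B]) (by simp) (by simp) hs (fun R hR => (hv R hR).ok) hb.2
  intro R hR
  rw [key R hR]
  refine forall₂_congr fun R' hR' => ?_
  rw [Datum.d_lt (hv R' hR') (hv R hR)]

/-- Between two consecutive stars there are at most two rows without one. -/
theorem exists_bold : ∀ k ∈ List.range' 6 170,
    ∃ R ∈ data, R.bold = true ∧ k - 3 < R.k ∧ R.k ≤ k := by
  have h : (List.range' 6 170).all (fun k =>
      ((data.filter Datum.bold).map Datum.k).any fun m => Nat.blt (k - 3) m && Nat.ble m k) =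
      true := by decide +kernel
  intro k hk
  have := List.all_eq_true.1 h k hk
  simp only [List.any_eq_true, List.mem_map, List.mem_filter, Bool.and_eq_true, Nat.blt_eq,
    Nat.ble_eq] at this
  obtain ⟨_, ⟨R, ⟨h1, h2⟩, rfl⟩, h3, h4⟩ := this
  exact ⟨R, h1, h2, h3, h4⟩

theorem exists_mem_data {k : ℕ} (h : 3 ≤ k) (h' : k ≤ 175) : ∃ R ∈ data, R.k = k := by
  have : k ∈ data.map Datum.k := by rw [map_k_data, List.mem_range']; exact ⟨k - 3, by omega⟩
  simpa using this

/-- A starred row among k - 2, k - 1, k beats every row up to k - 3, in particular one that attains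
the maximum there. -/
theorem best_lt_best {k : ℕ} (h : 6 ≤ k) (h' : k ≤ 175) : best (k - 3) < best k := by
  have hfin : ∀ k, {x | ∃ R ∈ table, R.k ≤ k ∧ x = R.d}.Finite := fun k =>
    (table.finite_toSet.image Row.d).subset (by
      rintro _ ⟨R, hR, -, rfl⟩
      exact ⟨R, hR, rfl⟩)
  obtain ⟨R₀, hR₀, hk₀⟩ := exists_mem_data (k := k - 3) (by omega) (by omega)
  obtain ⟨R, hR, hb, h1, h2⟩ := exists_bold k (by rw [List.mem_range']; exact ⟨k - 6, by omega⟩)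
  have hmem : ∀ {R : Datum}, R ∈ data → R.toRow ∈ table := fun {R} hR => by
    rw [table_eq]; exact List.mem_map_of_mem hR
  have hne : {x | ∃ R ∈ table, R.k ≤ k - 3 ∧ x = R.d}.Nonempty :=
    ⟨_, R₀.toRow, hmem hR₀, hk₀.le, rfl⟩
  -- The supremum of a finite nonempty set is the value of some row.
  obtain ⟨R', hR', hk', e⟩ := hne.csSup_mem (hfin _)
  rw [table_eq, List.mem_map] at hR'
  obtain ⟨R', hR', rfl⟩ := hR'
  rw [best, e]
  refine ((bold_data R hR).1 hb R' hR' (lt_of_le_of_lt hk' h1)).trans_le ?_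
  exact le_csSup (hfin k).bddAbove ⟨R.toRow, hmem hR, h2, rfl⟩

/-- That is, d(6)² ≥ 0.984, which is already more than 0.991445². -/
theorem lower_six : ∀ R ∈ data, R.k = 6 → 984 ≤ R.last.lower 1000 := by decide +kernel

/-- Coinciding lower and upper bounds for 25 d(8)² determine it exactly. -/
theorem eq_eight : ∀ R ∈ data, R.k = 8 → R.last.lower 25 = 49 ∧ R.last.upper 25 = 49 := by
  decide +kernel

/-- Approximations of `f (n * (n + 1))` for `2 ≤ n ≤ 12`. -/
def cubicRoots : List ℤ := [
  984215774235924576165424144982,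
  3780520538850730918720280344787,
  8195742186004381408671984135556,
  14154841600628377945946856996478,
  21632496325754322790562066171615,
  30619091162507430273212834853643,
  41110462119156591535192071346975,
  53104597836797148743557940921692,
  66600438288584125340307325471584,
  81597384416566598649503066356548,
  98095077911069275073746664103889]

/-- The statement on largest roots includes n = 3, although row 12 has a regular hexagon and does
not use f(12). This is why the approximations are listed separately from the rows. -/
theorem check_cubicRoots {n : ℕ} (h : 2 ≤ n) (h' : n ≤ 12) :
    (Gen.cubic n (cubicRoots.getD (n - 2) 0)).check = true := by
  have key : ∀ i < 11, (Gen.cubic (i + 2) (cubicRoots.getD i 0)).check = true := by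
    decide +kernel
  have := key (n - 2) (by omega)
  rwa [Nat.sub_add_cancel h] at this

end HexTiling

/-! ### Assembly of the claims -/

theorem mainTheorem1 :
    -- the table has exactly one row for each `k` with `3 ≤ k ≤ 175`
    HexTiling.table.map HexTiling.Row.k = List.range' 3 173 ∧
    (∀ R ∈ HexTiling.table,
      -- every nonblank cell is realised by a hexagon of its class
      (∀ C ∈ R.cells, ∃ (P : Fin 6 → HexTiling.Plane) (t₁ t₂ : ℤ × ℤ),
        C.1 P ∧ HexTiling.IsColouredTiling P R.k t₁ t₂ (√C.2)) ∧
      -- the last nonblank cell is realised with the tabulated sublattice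
      (∃ C, R.cells.getLast? = some C ∧ ∃ P : Fin 6 → HexTiling.Plane,
        C.1 P ∧ HexTiling.IsColouredTiling P R.k R.t₁ R.t₂ (√C.2)) ∧
      -- a less restricted class is listed only where it does better
      (R.cells.map Prod.snd).Pairwise (· < ·) ∧
      -- the decimal approximation is correctly rounded
      |R.d - R.approx| ≤ 1 / 2 * (1 / 10) ^ R.digits ∧
      -- bold type marks the values that beat those of all smaller `k`
      (R.bold = true ↔ ∀ R' ∈ HexTiling.table, R'.k < R.k → R'.d < R.d)) ∧
    -- at most `k` colours achieve more than at most `k - 3` colours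
    (∀ k, 6 ≤ k → k ≤ 175 → HexTiling.best (k - 3) < HexTiling.best k) ∧
    -- improvements on the previously reported values
    (∀ R ∈ HexTiling.table, R.k = 6 → 0.991445 < R.d) ∧
    (∀ R ∈ HexTiling.table, R.k = 8 → R.d = 7 / 5 ∧ 1.37542 < R.d) ∧
    -- the algebraic numbers of degree 3 and 4 in the table are what they are said to be
    (∀ n : ℕ, 2 ≤ n → n ≤ 12 →
      IsGreatest {x | HexTiling.cubic (n * (n + 1)) x = 0} (HexTiling.f (n * (n + 1)))) ∧
    IsLeast {x : ℝ | 25600 * x ^ 4 + (-1459616) * x ^ 3 + 8840377 * x ^ 2 + (-18735876) * x +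
      13623552 = 0} (HexTiling.quarticRoot 25600 (-1459616) 8840377 (-18735876) 13623552) ∧
    IsLeast {x : ℝ | 97344 * x ^ 4 + (-14493200) * x ^ 3 + 287680857 * x ^ 2 +
      (-2041299600) * x + 4968218624 = 0}
      (HexTiling.quarticRoot 97344 (-14493200) 287680857 (-2041299600) 4968218624) ∧
    IsLeast {x : ℝ | 548800 * x ^ 4 + (-70030800) * x ^ 3 + 2721532527 * x ^ 2 +
      (-44612184348) * x + 279110188800 = 0}
      (HexTiling.quarticRoot 548800 (-70030800) 2721532527 (-44612184348) 279110188800) := by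
  refine ⟨?_, ?_, fun k => HexTiling.best_lt_best, ?_, ?_, ?_,
    -- Each l, over 10³⁰, is the lower end of the interval that the test certifies for the smallest
    -- root.
    HexTiling.isLeast_quarticRoot (a := 25600) (b := 1459616) (c := 8840377) (d := 18735876)
      (e := 13623552) (l := 2802794467358050995533273788552) (by decide +kernel),
    HexTiling.isLeast_quarticRoot (a := 97344) (b := 14493200) (c := 287680857)
      (d := 2041299600) (e := 4968218624)
      (l := 8661158494016268893313865127917) (by decide +kernel),
    HexTiling.isLeast_quarticRoot (a := 548800) (b := 70030800) (c := 2721532527)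
      (d := 44612184348) (e := 279110188800)
      (l := 21233125274895106660537407448922) (by decide +kernel)⟩
  · rw [HexTiling.table_eq, List.map_map]
    exact HexTiling.map_k_data
  · rw [HexTiling.table_eq, List.forall_mem_map]
    intro R hR
    have hv := HexTiling.valid_of_mem hR
    refine ⟨hv.realised, hv.last_realised, hv.increasing, hv.rounded, ?_⟩
    rw [List.forall_mem_map]
    exact HexTiling.bold_data R hR
  · rw [HexTiling.table_eq, List.forall_mem_map]
    intro R hR hk
    have hv := HexTiling.valid_of_mem hR
    have h1 : (984 : ℝ) ≤ R.last.lower 1000 := by exact_mod_cast HexTiling.lower_six R hR hk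
    have h2 := HexTiling.Cell.lower_le hv.ok (S := 1000) (by norm_num)
    push_cast at h2
    rw [hv.d_eq]
    -- It remains to compare 0.991445² with 0.984.
    refine Real.lt_sqrt_of_sq_lt ?_
    norm_num1
    linarith
  · rw [HexTiling.table_eq, List.forall_mem_map]
    intro R hR hk
    have hv := HexTiling.valid_of_mem hR
    obtain ⟨h1, h2⟩ := HexTiling.eq_eight R hR hk
    have h3 := HexTiling.Cell.lower_le hv.ok (S := 25) (by norm_num)
    have h4 := HexTiling.Cell.le_upper hv.ok (S := 25) (by norm_num)
    rw [h1] at h3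
    rw [h2] at h4
    push_cast at h3 h4
    have h5 : R.last.val = (7 / 5) ^ 2 := by linarith
    have h6 : R.toRow.d = 7 / 5 := by
      rw [hv.d_eq, h5]
      exact Real.sqrt_sq (by norm_num)
    rw [h6]
    norm_num
  · intro n h2 h12
    exact HexTiling.isGreatest_f (HexTiling.check_cubicRoots h2 h12)
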